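/- Let $n\ge 1$ and let $\Sigma=\{(z,w)\in\mathbb C^n\times\mathbb C:\operatorname{Im}w>|z|^2\}\subset\mathbb C^{n+1}$ be the Siegel upper half space. A $C^m$ defining function for an open set $\Omega\subset\mathbb C^N$ is a real $C^m$ function $\rho$ on an open neighbourhood $U$ of $b\Omega$ with $\Omega\cap U=\{x\in U:\rho(x)<0\}$ and $d\rho\ne0$ on $b\Omega$; it is normalized if $|d\rho|=1$ on $b\Omega$. It is uniformly $C^m$ if moreover $\operatorname{dist}(b\Omega,bU)>0$, $\|\rho\|_{C^m(U)}<\infty$ and $\inf_U|\nabla\rho|>0$, and uniformly $C^\infty$ if this holds, with the same $U$, for every $m$. The Levi form at $p\in b\Omega$ is the restriction of the complex Hessian $(\rho_{j\bar k}(p))$ to $T^{1,0}_p(b\Omega)=\{L=\sum_jL_j\,\partial/\partial z_j:\partial\rho(L)=0\}$; its eigenvalues are taken in the Hermitian metric in which the $\partial/\partial z_j$ are orthonormal; the Levi form of a normalized $C^2$ defining function is the normalized Levi form. $\Omega$ is strictly pseudoconvex if for some $C^2$ defining function all Levi eigenvalues are positive at every boundary point, and uniformly strictly pseudoconvex if for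 some $\lambda>0$ all eigenvalues of the normalized Levi form are greater than $\lambda$ at every boundary point. For $t\ge0$ let $\bar\partial$ be the maximal (distributional) Cauchy–Riemann operator between the spaces $L^2_{0,q}(\Omega,e^{-t|x|^2}dV)$, let $\bar\partial^*_t$ be its Hilbert space adjoint, $\|\cdot\|_t$ the norm, and $\sigma$ the surface measure on $b\Omega$. The Folland–Kohn basic estimate on $(0,q)$-forms with parameter $t$ asserts that there is $C>0$ with $$\int_{b\Omega}|f|^2e^{-t|x|^2}\,d\sigma\le C\big(\|\bar\partial f\|_t^2+\|\bar\partial^*_tf\|_t^2\big)$$ for all $(0,q)$-forms $f\in\operatorname{Dom}(\bar\partial)\cap\operatorname{Dom}(\bar\partial_t^*)$ that are continuous up to the boundary (so that the left-hand side is defined). Then: 1. $\Sigma$ is a domain that has a normalized, uniformly $C^\infty$ defining function. 2. $\Sigma$ is strictly pseudoconvex. 3. $\Sigma$ is not uniformly strictly pseudoconvex. More precisely, for every normalized $C^2$ defining function, the eigenvalues of the normalized Levi form at $(z,w)\in b\Sigma$ are $(1+4|z|^2)^{-3/2}$ and, if $n\ge2$, also $(1+4|z|^2)^{-1/2}$;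 so the smallest eigenvalue is $(1+4|z|^2)^{-3/2}$ (the only one if $n=1$), and it tends to $0$ as $|z|\to\infty$ along $b\Sigma$. 4. For every $1\le q\le n$ and every $t\ge0$ the Folland–Kohn basic estimate on $(0,q)$-forms fails on $\Sigma$. It fails even if only those $f\in\operatorname{Dom}(\bar\partial)\cap\operatorname{Dom}(\bar\partial^*_t)$ are considered that are restrictions of smooth compactly supported forms on $\mathbb C^{n+1}$. -/

import Mathlib

open MeasureTheory Filter Topology
open scoped ContDiff ENNReal ComplexConjugate

noncomputable section

/-- `ℂ^N` with its Hermitian (equivalently, real Euclidean) norm. -/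
abbrev CSpace (N : ℕ) : Type := EuclideanSpace ℂ (Fin N)

section Derivatives

variable {N : ℕ}

/-- `∂f/∂z_j = (1/2)(∂/∂x_j - i ∂/∂y_j) f`. -/
def dz (j : Fin N) (f : CSpace N → ℂ) (p : CSpace N) : ℂ :=
  (1 / 2) * (fderiv ℝ f p (EuclideanSpace.single j 1)
    - Complex.I * fderiv ℝ f p (EuclideanSpace.single j Complex.I))

/-- `∂f/∂z̄_j = (1/2)(∂/∂x_j + i ∂/∂y_j) f`. -/
def dzbar (j : Fin N) (f : CSpace N → ℂ) (p : CSpace N) : ℂ :=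
  (1 / 2) * (fderiv ℝ f p (EuclideanSpace.single j 1)
    + Complex.I * fderiv ℝ f p (EuclideanSpace.single j Complex.I))

end Derivatives

section DefiningFunctions

variable {N : ℕ}

/-- `ρ` is a `C^m` defining function for `Ω` on the open neighbourhood `U` of the boundary. -/
structure IsDefiningFunction (m : WithTop ℕ∞) (Ω U : Set (CSpace N)) (ρ : CSpace N → ℝ) :
    Prop where
  isOpen : IsOpen U
  frontier_subset : frontier Ω ⊆ U
  contDiffOn : ContDiffOn ℝ m ρ U
  mem_iff : ∀ x ∈ U, x ∈ Ω ↔ ρ x < 0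
  fderiv_ne_zero : ∀ p ∈ frontier Ω, fderiv ℝ ρ p ≠ 0

/-- `|dρ| = 1` on the boundary. -/
def IsNormalizedOn (Ω : Set (CSpace N)) (ρ : CSpace N → ℝ) : Prop :=
  ∀ p ∈ frontier Ω, ‖fderiv ℝ ρ p‖ = 1

/-- `ρ` is a uniformly `C^m` defining function for `Ω` on `U`: the distance from `bΩ` to `bU` is
positive, the `C^m(U)` norm of `ρ` is finite and `|∇ρ|` is bounded below on `U`. -/
structure IsUniformDefiningFunction (m : ℕ) (Ω U : Set (CSpace N)) (ρ : CSpace N → ℝ) :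
    Prop extends IsDefiningFunction m Ω U ρ where
  dist_pos : ∃ δ > 0, ∀ p ∈ frontier Ω, ∀ x ∈ frontier U, δ ≤ dist p x
  bounded : ∀ k ≤ m, ∃ C : ℝ, ∀ x ∈ U, ‖iteratedFDeriv ℝ k ρ x‖ ≤ C
  grad_bounded_below : ∃ c > 0, ∀ x ∈ U, c ≤ ‖fderiv ℝ ρ x‖

/-- Uniformly `C^∞`: uniformly `C^m` on the same `U` for all `m`. -/
def IsUniformlySmoothDefiningFunction (Ω U : Set (CSpace N)) (ρ : CSpace N → ℝ) : Prop :=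
  ∀ m : ℕ, IsUniformDefiningFunction m Ω U ρ

end DefiningFunctions

section Levi

variable {N : ℕ}

/-- The space `T^{1,0}_p(bΩ)`, for `bΩ = {ρ = 0}`: the vectors `L = ∑ L_j ∂/∂z_j` with
`∂ρ(L) = 0`. -/
def tangent10 (ρ : CSpace N → ℝ) (p : CSpace N) : Set (CSpace N) :=
  {L | ∑ j, dz j (fun x => (ρ x : ℂ)) p * L j = 0}

/-- The complex Hessian `∑ ρ_{j k̄} L_j conj(M_k)`. -/
def leviForm (ρ : CSpace N → ℝ) (p L M : CSpace N) : ℂ :=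
  ∑ j, ∑ k, dz j (dzbar k (fun x => (ρ x : ℂ))) p * L j * conj (M k)

/-- The eigenvalues at `p` of the Levi form of `ρ`, i.e. of the restriction of the complex Hessian
to `T^{1,0}_p`, with respect to the Hermitian metric in which the `∂/∂z_j` are orthonormal. -/
def leviEigenvalues (ρ : CSpace N → ℝ) (p : CSpace N) : Set ℝ :=
  {μ | ∃ L ∈ tangent10 ρ p, L ≠ 0 ∧
    ∀ M ∈ tangent10 ρ p, leviForm ρ p L M = (μ : ℂ) * inner ℂ M L}

/-- All eigenvalues of the Levi form are positive at every boundary point. -/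
def StrictlyPseudoconvex (Ω : Set (CSpace N)) : Prop :=
  ∃ U ρ, IsDefiningFunction 2 Ω U ρ ∧ ∀ p ∈ frontier Ω, ∀ μ ∈ leviEigenvalues ρ p, 0 < μ

/-- All eigenvalues of the normalized Levi form exceed some `lam > 0` independent of the boundary
point. -/
def UniformlyStrictlyPseudoconvex (Ω : Set (CSpace N)) : Prop :=
  ∃ U ρ, IsDefiningFunction 2 Ω U ρ ∧ IsNormalizedOn Ω ρ ∧
    ∃ lam > 0, ∀ p ∈ frontier Ω, ∀ μ ∈ leviEigenvalues ρ p, lam < μ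

end Levi

section Dbar

/-- The fibre `Λ^{0,q}` of the `(0,q)`-forms on `ℂ^N`; the `dz̄_J`, `J` a `q`-element (increasing)
multi-index, form an orthonormal basis. -/
abbrev Forms (N q : ℕ) : Type := EuclideanSpace ℂ {J : Finset (Fin N) // J.card = q}

variable {N : ℕ}

/-- The coefficient of `dz̄_K` in `dz̄_k ∧ dz̄_J`. -/
def wedgeSign (k : Fin N) (J K : Finset (Fin N)) : ℂ :=
  if k ∉ J ∧ insert k J = K then (-1) ^ (J.filter (· < k)).card else 0

/-- The measure `e^{-t|z|^2} dV` on `Ω`. -/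
def weightedVolume (Ω : Set (CSpace N)) (t : ℝ) : Measure (CSpace N) :=
  (volume.restrict Ω).withDensity fun x => ENNReal.ofReal (Real.exp (-t * ‖x‖ ^ 2))

/-- The measure `e^{-t|z|^2} dσ` on `bΩ`, with `dσ` the `(2N-1)`-dimensional surface area. -/
def weightedSurface (Ω : Set (CSpace N)) (t : ℝ) : Measure (CSpace N) :=
  ((Measure.euclideanHausdorffMeasure (2 * N - 1)).restrict (frontier Ω)).withDensity
    fun x => ENNReal.ofReal (Real.exp (-t * ‖x‖ ^ 2))

/-- `f` lies in the domain of the maximal (distributional) extension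
`∂̄ : L²_{0,p}(Ω, e^{-t|z|²}) → L²_{0,q}(Ω, e^{-t|z|²})` (`q = p + 1`) and `∂̄ f = u`. Here
`(∂̄f)_K = ∑_{J,k} ε^K_{kJ} ∂f_J/∂z̄_k`, tested against `φ ∈ C_c^∞(Ω)`. -/
def IsDbar {p q : ℕ} (Ω : Set (CSpace N)) (t : ℝ) (f : CSpace N → Forms N p)
    (u : CSpace N → Forms N q) : Prop :=
  MemLp f 2 (weightedVolume Ω t) ∧ MemLp u 2 (weightedVolume Ω t) ∧
    ∀ (φ : CSpace N → ℂ), ContDiff ℝ ∞ φ → HasCompactSupport φ → tsupport φ ⊆ Ω →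
      ∀ K : {K : Finset (Fin N) // K.card = q},
        ∫ x in Ω, u x K * φ x =
          -∫ x in Ω, ∑ J : {J : Finset (Fin N) // J.card = p}, ∑ k : Fin N,
            wedgeSign k J.1 K.1 * f x J * dzbar k φ x

/-- `f` lies in the domain of the Hilbert space adjoint
`∂̄*_t : L²_{0,q}(Ω, e^{-t|z|²}) → L²_{0,p}(Ω, e^{-t|z|²})` (`q = p + 1`) of `∂̄`, and
`∂̄*_t f = v`. -/
def IsDbarStar {p q : ℕ} (Ω : Set (CSpace N)) (t : ℝ) (f : CSpace N → Forms N q)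
    (v : CSpace N → Forms N p) : Prop :=
  MemLp f 2 (weightedVolume Ω t) ∧ MemLp v 2 (weightedVolume Ω t) ∧
    ∀ (g : CSpace N → Forms N p) (u : CSpace N → Forms N q), IsDbar Ω t g u →
      ∫ x, inner ℂ (f x) (u x) ∂weightedVolume Ω t =
        ∫ x, inner ℂ (v x) (g x) ∂weightedVolume Ω t

/-- The basic estimate
`∫_{bΩ} |f|² e^{-t|z|²} dσ ≤ C (‖∂̄f‖_t² + ‖∂̄*_t f‖_t²)` for the `(0,q)`-forms `f` of the class
`S` in `Dom(∂̄) ∩ Dom(∂̄*_t)`, where `q ≥ 1`. -/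
def BasicEstimateOn {q : ℕ} (S : Set (CSpace N → Forms N q)) (Ω : Set (CSpace N)) (t : ℝ) : Prop :=
  ∃ C : ℝ, 0 < C ∧ ∀ f ∈ S, ∀ (u : CSpace N → Forms N (q + 1)) (v : CSpace N → Forms N (q - 1)),
    IsDbar Ω t f u → IsDbarStar Ω t f v →
      ∫⁻ x, ‖f x‖ₑ ^ 2 ∂weightedSurface Ω t ≤
        ENNReal.ofReal C * (∫⁻ x, ‖u x‖ₑ ^ 2 ∂weightedVolume Ω t
          + ∫⁻ x, ‖v x‖ₑ ^ 2 ∂weightedVolume Ω t)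

/-- The Folland-Kohn basic estimate on `(0,q)`-forms with weight parameter `t`, for all
`f ∈ Dom(∂̄) ∩ Dom(∂̄*_t)` whose boundary values exist classically. -/
def FollandKohnBasicEstimate (q : ℕ) (Ω : Set (CSpace N)) (t : ℝ) : Prop :=
  BasicEstimateOn {f : CSpace N → Forms N q | ContinuousOn f (closure Ω)} Ω t

end Dbar

section Siegel

/-- `|z|²` for `p = (z, w) ∈ ℂ^n × ℂ`. -/
def zNormSq {n : ℕ} (p : CSpace (n + 1)) : ℝ := ∑ i : Fin n, ‖p i.castSucc‖ ^ 2

/-- The Siegel upper half space `{(z, w) ∈ ℂ^n × ℂ : Im w > |z|²}`. -/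
def siegel (n : ℕ) : Set (CSpace (n + 1)) := {p | zNormSq p < (p (Fin.last n)).im}

end Siegel

end

/-!
Let `r = |z|² - Im w`. Dividing `r` by its own gradient length `√(1 + 4|z|²)` normalizes it and
keeps all derivatives bounded near `bΣ`. On the complex tangent space the Levi form of any defining
function is a positive multiple of that of `r`, which is the identity form in `z`; for a normalized
one the factor is `s = (1 + 4|z|²)^(-1/2)`. The tangential directions orthogonal to `z` have no
`w`-component and give the eigenvalue `s`, whereas lifting the direction of `z` to a tangent vector
multiplies its squared length by `s⁻²` and gives the eigenvalue `s³`.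

Contracting `∂r` into compactly supported `(0, q + 1)`-forms produces forms in the domain of
`∂̄*_t`. Near the boundary point `(R e, i R²)` take as coefficient a cutoff at scale `ε` in
Heisenberg-translated coordinates times `exp(i ω / ε²)`, where `ω` is the translated last
coordinate. For small `ε` the energy of the resulting form is of order `R²` and its boundary mass
of order `R³`, up to a common factor depending on `ε` and the weight, so `R → ∞` defeats every
constant.
-/

noncomputable section

section SiegelGeometry

variable {n : ℕ}

/-- The complex-linear projection `(z, w) ↦ (z, 0)`. -/
def zPart (n : ℕ) : CSpace (n + 1) →L[ℂ] CSpace (n + 1) :=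
  .id ℂ _ - (EuclideanSpace.proj (Fin.last n)).smulRight (EuclideanSpace.single (Fin.last n) 1)

@[simp] theorem zPart_castSucc (p : CSpace (n + 1)) (i : Fin n) :
    zPart n p i.castSucc = p i.castSucc := by
  simp [zPart, (Fin.castSucc_lt_last i).ne]

@[simp] theorem zPart_last (p : CSpace (n + 1)) : zPart n p (Fin.last n) = 0 := by
  simp [zPart]

theorem norm_zPart_sq (p : CSpace (n + 1)) : ‖zPart n p‖ ^ 2 = zNormSq p := by
  simp [EuclideanSpace.norm_sq_eq, Fin.sum_univ_castSucc, zNormSq]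

theorem norm_sq_eq_zNormSq_add (p : CSpace (n + 1)) :
    ‖p‖ ^ 2 = zNormSq p + ‖p (Fin.last n)‖ ^ 2 := by
  simp [EuclideanSpace.norm_sq_eq, Fin.sum_univ_castSucc, zNormSq]

theorem zNormSq_nonneg (p : CSpace (n + 1)) : 0 ≤ zNormSq p :=
  Finset.sum_nonneg fun _ _ => by positivity

theorem zNormSq_le_norm_sq (p : CSpace (n + 1)) : zNormSq p ≤ ‖p‖ ^ 2 :=
  norm_sq_eq_zNormSq_add p ▸ le_add_of_nonneg_right (sq_nonneg _)

theorem inner_zPart_zPart {𝕜 : Type*} [RCLike 𝕜] [InnerProductSpace 𝕜 ℂ] (p v : CSpace (n + 1)) :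
    inner 𝕜 (zPart n p) (zPart n v) = inner 𝕜 (zPart n p) v := by
  simp [PiLp.inner_apply, Fin.sum_univ_castSucc]

/-- The unit vector in the direction of `Im w`. -/
def imVec (n : ℕ) : CSpace (n + 1) := EuclideanSpace.single (Fin.last n) Complex.I

theorem inner_imVec (v : CSpace (n + 1)) : inner ℝ (imVec n) v = (v (Fin.last n)).im := by
  simp [PiLp.inner_apply, Fin.sum_univ_castSucc, imVec, (Fin.castSucc_lt_last _).ne, Complex.inner]

@[simp] theorem zPart_imVec : zPart n (imVec n) = 0 := by
  ext k
  refine Fin.lastCases ?_ (fun i => ?_) k <;> simp [imVec, (Fin.castSucc_lt_last _).ne]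

theorem norm_imVec : ‖imVec n‖ = 1 := by simp [imVec]

theorem norm_smul_zPart_sub_smul_imVec_sq (a b : ℝ) (p : CSpace (n + 1)) :
    ‖a • zPart n p - b • imVec n‖ ^ 2 = a ^ 2 * zNormSq p + b ^ 2 := by
  have horth : inner ℝ (zPart n p) (imVec n) = 0 := by
    rw [real_inner_comm, inner_imVec, zPart_last, Complex.zero_im]
  simp only [norm_sub_sq_real, norm_smul, inner_smul_left, inner_smul_right, horth, mul_pow,
    norm_zPart_sq, norm_imVec, Real.norm_eq_abs, sq_abs]
  ring

/-- The standard defining function `|z|² - Im w` of the Siegel upper half space. -/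
def siegelFun (p : CSpace (n + 1)) : ℝ := zNormSq p - (p (Fin.last n)).im

/-- The gradient of `siegelFun`. -/
def siegelGrad (p : CSpace (n + 1)) : CSpace (n + 1) := (2 : ℝ) • zPart n p - imVec n

theorem mem_siegel_iff {p : CSpace (n + 1)} : p ∈ siegel n ↔ siegelFun p < 0 := by
  simp [siegel, siegelFun]

theorem siegel_eq_setOf_siegelFun_neg : siegel n = {p | siegelFun p < 0} :=
  Set.ext fun _ => mem_siegel_iff

theorem norm_siegelGrad_sq (p : CSpace (n + 1)) : ‖siegelGrad p‖ ^ 2 = 1 + 4 * zNormSq p := by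
  rw [siegelGrad, ← one_smul ℝ (imVec n), norm_smul_zPart_sub_smul_imVec_sq]
  ring

theorem siegelFun_eq (p : CSpace (n + 1)) :
    siegelFun p = ‖zPart n p‖ ^ 2 - innerSL ℝ (imVec n) p := by
  rw [siegelFun, norm_zPart_sq, innerSL_apply_apply, inner_imVec]

theorem siegelFun_add (p v : CSpace (n + 1)) :
    siegelFun (p + v) = siegelFun p + inner ℝ (siegelGrad p) v + zNormSq v := by
  simp only [siegelFun_eq, siegelGrad, map_add, norm_add_sq_real, inner_sub_left, inner_smul_left,
    inner_zPart_zPart, norm_zPart_sq, innerSL_apply_apply, conj_trivial]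
  ring

theorem siegelFun_add_smul_imVec (p : CSpace (n + 1)) (s : ℝ) :
    siegelFun (p + s • imVec n) = siegelFun p - s := by
  simp [siegelFun_eq, inner_add_right, inner_smul_right, norm_imVec]
  ring

theorem contDiff_siegelFun {m : WithTop ℕ∞} : ContDiff ℝ m (siegelFun (n := n)) := by
  rw [funext siegelFun_eq]
  exact (((zPart n).restrictScalars ℝ).contDiff.norm_sq ℝ).sub (innerSL ℝ (imVec n)).contDiff

theorem hasFDerivAt_zNormSq (p : CSpace (n + 1)) :
    HasFDerivAt zNormSq (innerSL ℝ ((2 : ℝ) • zPart n p)) p := by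
  rw [← funext norm_zPart_sq]
  refine (((zPart n).restrictScalars ℝ).hasFDerivAt.norm_sq (x := p)).congr_fderiv ?_
  ext v
  simp [inner_zPart_zPart, two_smul]

theorem hasFDerivAt_siegelFun (p : CSpace (n + 1)) :
    HasFDerivAt siegelFun (innerSL ℝ (siegelGrad p)) p := by
  have him : HasFDerivAt (fun p : CSpace (n + 1) => (p (Fin.last n)).im) (innerSL ℝ (imVec n)) p :=
    (innerSL ℝ (imVec n)).hasFDerivAt.congr_of_eventuallyEq
      (.of_forall fun v => (inner_imVec v).symm)
  rw [siegelGrad, map_sub]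
  exact (hasFDerivAt_zNormSq p).sub him

theorem isOpen_siegel : IsOpen (siegel n) := by
  rw [siegel_eq_setOf_siegelFun_neg]
  exact isOpen_lt (contDiff_siegelFun (m := 0)).continuous continuous_const

theorem mem_frontier_siegel_iff {p : CSpace (n + 1)} :
    p ∈ frontier (siegel n) ↔ siegelFun p = 0 := by
  refine ⟨fun hp => ?_, fun hp => ?_⟩
  · rw [siegel_eq_setOf_siegelFun_neg] at hp
    exact frontier_lt_subset_eq (contDiff_siegelFun (m := 0)).continuous continuous_const hp
  · rw [isOpen_siegel.frontier_eq]
    refine ⟨?_, fun h => (mem_siegel_iff.1 h).ne hp⟩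
    have htend : Tendsto (fun s : ℝ => p + s • imVec n) (𝓝[>] 0) (𝓝 p) :=
      tendsto_nhdsWithin_of_tendsto_nhds (Continuous.tendsto' (by fun_prop) _ _ (by simp))
    refine mem_closure_of_tendsto htend ?_
    filter_upwards [self_mem_nhdsWithin] with s (hs : 0 < s)
    rw [mem_siegel_iff, siegelFun_add_smul_imVec, hp]
    linarith

theorem convexOn_siegelFun : ConvexOn ℝ Set.univ (siegelFun (n := n)) := by
  rw [funext siegelFun_eq]
  exact (((convexOn_univ_norm (E := CSpace (n + 1))).comp_linearMap
    ((zPart n).restrictScalars ℝ).toLinearMap).pow (fun _ _ => norm_nonneg _) 2).sub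
    ((innerSL ℝ (imVec n)).toLinearMap.concaveOn convex_univ)

theorem isConnected_siegel : IsConnected (siegel n) := by
  refine ⟨⟨imVec n, by simp [siegel, zNormSq, imVec, (Fin.castSucc_lt_last _).ne]⟩, ?_⟩
  have hconv := (convexOn_siegelFun (n := n)).convex_lt 0
  simp only [Set.mem_univ, true_and] at hconv
  rw [siegel_eq_setOf_siegelFun_neg]
  exact hconv.isPreconnected

end SiegelGeometry

section BoundedDerivatives

universe u

variable {E : Type u} {F : Type*} [NormedAddCommGroup E] [NormedSpace ℝ E]
  [NormedAddCommGroup F] [NormedSpace ℝ F]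

theorem exists_bound_iteratedFDeriv_comp {U : Set E} (hU : IsOpen U) {Y : E → F} {K : Set F}
    (hK : IsCompact K) (hY : Set.MapsTo Y U K) {P : F → E →L[ℝ] F} (hP : ContDiff ℝ ∞ P)
    (hD : ∀ x ∈ U, HasFDerivAt Y (P (Y x)) x) (k : ℕ) :
    ∀ {G : Type u} [NormedAddCommGroup G] [NormedSpace ℝ G] (Q : F → G), ContDiff ℝ ∞ Q →
      ∃ C : ℝ, ∀ x ∈ U, ‖iteratedFDeriv ℝ k (Q ∘ Y) x‖ ≤ C := by
  induction k with
  | zero =>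
    intro G _ _ Q hQ
    obtain ⟨C, hC⟩ := hK.exists_bound_of_continuousOn hQ.continuous.continuousOn
    exact ⟨C, fun x hx => by simpa using hC _ (hY hx)⟩
  | succ k ih =>
    intro G _ _ Q hQ
    obtain ⟨C, hC⟩ := ih (fun y => (fderiv ℝ Q y).comp (P y))
      ((hQ.fderiv_right (m := ∞) (by simp)).clm_comp hP)
    refine ⟨C, fun x hx => ?_⟩
    have hderiv : fderiv ℝ (Q ∘ Y) =ᶠ[𝓝 x] (fun y => (fderiv ℝ Q y).comp (P y)) ∘ Y := by
      filter_upwards [hU.mem_nhds hx] with y hy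
      exact (((hQ.differentiable (by simp)) (Y y)).hasFDerivAt.comp y (hD y hy)).fderiv
    rw [← norm_iteratedFDeriv_fderiv, (hderiv.iteratedFDeriv ℝ k).eq_of_nhds]
    exact hC x hx

end BoundedDerivatives

section NormalizedDefiningFunction

variable {n : ℕ}

/-- The normalizing factor `(1 + 4|z|²)^{-1/2}`, the reciprocal of the length of `siegelGrad`. -/
def siegelScale (p : CSpace (n + 1)) : ℝ := (√(1 + 4 * zNormSq p))⁻¹

theorem siegelScale_pos (p : CSpace (n + 1)) : 0 < siegelScale p := by
  have := zNormSq_nonneg p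
  unfold siegelScale
  positivity

theorem siegelScale_sq_mul (p : CSpace (n + 1)) : siegelScale p ^ 2 * (1 + 4 * zNormSq p) = 1 := by
  have := zNormSq_nonneg p
  rw [siegelScale, inv_pow, Real.sq_sqrt (by positivity), inv_mul_cancel₀ (by positivity)]

theorem siegelScale_eq_inv_norm (p : CSpace (n + 1)) : siegelScale p = ‖siegelGrad p‖⁻¹ := by
  rw [siegelScale, ← norm_siegelGrad_sq, Real.sqrt_sq (norm_nonneg _)]

theorem siegelScale_le_one (p : CSpace (n + 1)) : siegelScale p ≤ 1 :=
  inv_le_one_of_one_le₀ (Real.one_le_sqrt.2 (by linarith [zNormSq_nonneg p]))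

theorem hasFDerivAt_siegelScale (p : CSpace (n + 1)) :
    HasFDerivAt siegelScale ((-4 * siegelScale p ^ 3) • innerSL ℝ (zPart n p)) p := by
  have hz := zNormSq_nonneg p
  have hscale : HasDerivAt (fun s : ℝ => (√(1 + 4 * s))⁻¹) (-2 * siegelScale p ^ 3)
      (zNormSq p) := by
    have haff : HasDerivAt (fun s : ℝ => 1 + 4 * s) 4 (zNormSq p) := by
      simpa using ((hasDerivAt_id (zNormSq p)).const_mul 4).const_add 1
    refine ((haff.sqrt (by positivity)).inv (by positivity)).congr_deriv ?_
    unfold siegelScale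
    field_simp
    ring
  refine (hscale.comp_hasFDerivAt p (hasFDerivAt_zNormSq p)).congr_fderiv ?_
  rw [map_smul, smul_smul]
  ring_nf

/-- A normalized defining function of the Siegel upper half space. -/
def siegelNormalized (p : CSpace (n + 1)) : ℝ := siegelFun p * siegelScale p

/-- The gradient of `siegelNormalized`. -/
def siegelNormalizedGrad (p : CSpace (n + 1)) : CSpace (n + 1) :=
  (2 * siegelScale p * (1 - 2 * siegelNormalized p * siegelScale p)) • zPart n p
    - siegelScale p • imVec n

theorem hasFDerivAt_siegelNormalized (p : CSpace (n + 1)) :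
    HasFDerivAt siegelNormalized (innerSL ℝ (siegelNormalizedGrad p)) p := by
  refine ((hasFDerivAt_siegelFun p).mul (hasFDerivAt_siegelScale p)).congr_fderiv ?_
  ext v
  simp [siegelNormalizedGrad, siegelGrad, siegelNormalized]
  ring

theorem norm_fderiv_siegelNormalized_sq (p : CSpace (n + 1)) :
    ‖fderiv ℝ siegelNormalized p‖ ^ 2 =
      (2 * siegelScale p * (1 - 2 * siegelNormalized p * siegelScale p)) ^ 2 * zNormSq p
        + siegelScale p ^ 2 := by
  rw [(hasFDerivAt_siegelNormalized p).fderiv, innerSL_apply_norm, siegelNormalizedGrad,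
    norm_smul_zPart_sub_smul_imVec_sq]

theorem siegelNormalized_neg_iff {p : CSpace (n + 1)} : siegelNormalized p < 0 ↔ p ∈ siegel n := by
  rw [siegelNormalized, mul_neg_iff, mem_siegel_iff]
  simp [siegelScale_pos p, (siegelScale_pos p).not_gt]

theorem siegelNormalized_eq_zero_iff {p : CSpace (n + 1)} :
    siegelNormalized p = 0 ↔ p ∈ frontier (siegel n) := by
  simp [siegelNormalized, (siegelScale_pos p).ne', mem_frontier_siegel_iff]

theorem contDiff_siegelNormalized : ContDiff ℝ ∞ (siegelNormalized (n := n)) := by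
  refine contDiff_siegelFun.mul ?_
  simp only [funext fun p => siegelScale.eq_1 (n := n) p, ← norm_zPart_sq]
  have hsq : ContDiff ℝ ∞ fun p : CSpace (n + 1) => 1 + 4 * ‖zPart n p‖ ^ 2 :=
    contDiff_const.add
      (contDiff_const.mul (((zPart n).restrictScalars ℝ).contDiff.norm_sq ℝ))
  exact (hsq.sqrt fun p => by positivity).inv fun p => by positivity

/-- The bounded quantities in terms of which the derivatives of `siegelNormalized` are
polynomial. -/
def siegelJet (p : CSpace (n + 1)) : ℝ × CSpace (n + 1) × ℝ :=
  (siegelScale p, siegelScale p • zPart n p, siegelNormalized p)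

/-- The polynomial vector field `P` with `D siegelJet = P ∘ siegelJet`. -/
def siegelJetField (y : ℝ × CSpace (n + 1) × ℝ) :
    CSpace (n + 1) →L[ℝ] ℝ × CSpace (n + 1) × ℝ :=
  ((-4 * y.1 ^ 2) • innerSL ℝ y.2.1).prod
    ((y.1 • (zPart n).restrictScalars ℝ - (4 * y.1) • (innerSL ℝ y.2.1).smulRight y.2.1).prod
      ((2 - 4 * y.2.2 * y.1) • innerSL ℝ y.2.1 - y.1 • innerSL ℝ (imVec n)))

theorem hasFDerivAt_siegelJet (p : CSpace (n + 1)) :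
    HasFDerivAt siegelJet (siegelJetField (siegelJet p)) p := by
  have hscale := hasFDerivAt_siegelScale p
  have hsmul := hscale.smul ((zPart n).restrictScalars ℝ).hasFDerivAt
  refine (hscale.prodMk (hsmul.prodMk (hasFDerivAt_siegelNormalized p))).congr_fderiv ?_
  ext v : 1
  refine Prod.ext ?_ (Prod.ext ?_ ?_)
  · simp [siegelJetField, siegelJet]
    ring
  · simp [siegelJetField, siegelJet, smul_smul]
    module
  · simp [siegelJetField, siegelJet, siegelNormalizedGrad]
    ring

theorem contDiff_siegelJetField : ContDiff ℝ ∞ (siegelJetField (n := n)) := by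
  rw [contDiff_clm_apply_iff]
  intro v
  simp only [siegelJetField, ContinuousLinearMap.prod_apply, smul_apply,
    sub_apply, ContinuousLinearMap.smulRight_apply, innerSL_apply_apply]
  have hinner : ContDiff ℝ ∞ fun y : ℝ × CSpace (n + 1) × ℝ => inner ℝ y.2.1 v :=
    (contDiff_fst.comp contDiff_snd).inner ℝ contDiff_const
  fun_prop

theorem siegelJet_mem_closedBall {p : CSpace (n + 1)} (hp : |siegelNormalized p| < 1 / 4) :
    siegelJet p ∈ Metric.closedBall (0 : ℝ × CSpace (n + 1) × ℝ) 1 := by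
  have hscale := siegelScale_sq_mul p
  have hz : ‖siegelScale p • zPart n p‖ ≤ 1 := by
    rw [← sq_le_one_iff₀ (norm_nonneg _), norm_smul, mul_pow, norm_zPart_sq, Real.norm_eq_abs,
      sq_abs]
    nlinarith [sq_nonneg (siegelScale p), zNormSq_nonneg p]
  rw [mem_closedBall_zero_iff, Prod.norm_def, Prod.norm_def]
  refine max_le ?_ (max_le hz (hp.le.trans (by norm_num)))
  exact (Real.norm_of_nonneg (siegelScale_pos p).le).trans_le (siegelScale_le_one p)

theorem abs_siegelNormalized_add_sub_le {p v : CSpace (n + 1)} (hv : siegelFun (p + v) = 0) :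
    |siegelNormalized p| ≤ ‖v‖ + ‖v‖ ^ 2 := by
  have hexpand : siegelFun p = -(inner ℝ (siegelGrad p) v + zNormSq v) := by
    linarith [siegelFun_add p v]
  have hgrad : 0 < ‖siegelGrad p‖ := inv_pos.1 (siegelScale_eq_inv_norm p ▸ siegelScale_pos p)
  rw [siegelNormalized, abs_mul, abs_of_pos (siegelScale_pos p)]
  calc |siegelFun p| * siegelScale p
      ≤ (‖siegelGrad p‖ * ‖v‖ + ‖v‖ ^ 2) * siegelScale p := by
        rw [hexpand, abs_neg]
        refine mul_le_mul_of_nonneg_right ?_ (siegelScale_pos p).le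
        refine (abs_add_le _ _).trans (add_le_add (abs_real_inner_le_norm _ _) ?_)
        exact (abs_of_nonneg (zNormSq_nonneg v)).trans_le (zNormSq_le_norm_sq v)
    _ = ‖v‖ + ‖v‖ ^ 2 * siegelScale p := by
        rw [siegelScale_eq_inv_norm]
        field_simp
    _ ≤ ‖v‖ + ‖v‖ ^ 2 :=
        add_le_add_right (mul_le_of_le_one_right (sq_nonneg _) (siegelScale_le_one p)) _

theorem le_dist_of_mem_frontier_siegel {p x : CSpace (n + 1)} (hp : p ∈ frontier (siegel n))
    (hx : 1 / 4 ≤ |siegelNormalized x|) : 1 / 5 ≤ dist p x := by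
  have hle := abs_siegelNormalized_add_sub_le (p := x) (v := p - x)
    (by rwa [add_sub_cancel, ← mem_frontier_siegel_iff])
  rw [dist_eq_norm]
  by_contra! hlt
  nlinarith [norm_nonneg (p - x)]

theorem isNormalizedOn_siegelNormalized : IsNormalizedOn (siegel n) siegelNormalized := by
  intro p hp
  rw [← sq_eq_sq₀ (norm_nonneg _) zero_le_one, norm_fderiv_siegelNormalized_sq,
    siegelNormalized_eq_zero_iff.2 hp]
  linarith [siegelScale_sq_mul p]

theorem half_le_norm_fderiv_siegelNormalized {p : CSpace (n + 1)}
    (hp : |siegelNormalized p| < 1 / 4) : 1 / 2 ≤ ‖fderiv ℝ siegelNormalized p‖ := by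
  refine le_of_sq_le_sq ?_ (norm_nonneg _)
  have hfactor : 1 / 2 ≤ 1 - 2 * siegelNormalized p * siegelScale p := by
    nlinarith [siegelScale_pos p, siegelScale_le_one p, abs_lt.1 hp]
  have hz : 0 ≤ siegelScale p ^ 2 * zNormSq p := mul_nonneg (sq_nonneg _) (zNormSq_nonneg p)
  calc (1 / 2 : ℝ) ^ 2 ≤ 4 * (siegelScale p ^ 2 * zNormSq p) * (1 / 2) ^ 2 + siegelScale p ^ 2 := by
        nlinarith [siegelScale_sq_mul p, sq_nonneg (siegelScale p)]
    _ ≤ 4 * (siegelScale p ^ 2 * zNormSq p)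
          * (1 - 2 * siegelNormalized p * siegelScale p) ^ 2 + siegelScale p ^ 2 := by gcongr
    _ = ‖fderiv ℝ siegelNormalized p‖ ^ 2 := by
        rw [norm_fderiv_siegelNormalized_sq]
        ring

theorem isOpen_setOf_abs_siegelNormalized_lt (c : ℝ) :
    IsOpen {p : CSpace (n + 1) | |siegelNormalized p| < c} :=
  isOpen_lt contDiff_siegelNormalized.continuous.abs continuous_const

theorem isDefiningFunction_siegelNormalized {c : ℝ} (hc : 0 < c) (m : ℕ) :
    IsDefiningFunction m (siegel n) {p | |siegelNormalized p| < c} siegelNormalized where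
  isOpen := isOpen_setOf_abs_siegelNormalized_lt c
  frontier_subset p hp := by simpa [siegelNormalized_eq_zero_iff.2 hp] using hc
  contDiffOn := (contDiff_siegelNormalized.of_le (by exact_mod_cast le_top)).contDiffOn
  mem_iff _ _ := siegelNormalized_neg_iff.symm
  fderiv_ne_zero p hp := norm_ne_zero_iff.1 (by simp [isNormalizedOn_siegelNormalized p hp])

theorem isUniformlySmoothDefiningFunction_siegelNormalized :
    IsUniformlySmoothDefiningFunction (siegel n) {p | |siegelNormalized p| < 1 / 4}
      siegelNormalized := fun m =>
  { isDefiningFunction_siegelNormalized (by norm_num) m with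
    dist_pos := ⟨1 / 5, by norm_num, fun p hp x hx =>
      le_dist_of_mem_frontier_siegel hp
        (not_lt.1 ((isOpen_setOf_abs_siegelNormalized_lt _).frontier_eq ▸ hx).2)⟩
    bounded := fun k _ => exists_bound_iteratedFDeriv_comp (isOpen_setOf_abs_siegelNormalized_lt _)
      (isCompact_closedBall _ _) (fun _ => siegelJet_mem_closedBall) contDiff_siegelJetField
      (fun x _ => hasFDerivAt_siegelJet x) k _ (contDiff_snd.comp contDiff_snd)
    grad_bounded_below := ⟨1 / 2, by norm_num, fun _ =>
      half_le_norm_fderiv_siegelNormalized⟩ }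

end NormalizedDefiningFunction

section DefiningFunctionGermComparison

variable {E : Type*} [NormedAddCommGroup E] [NormedSpace ℝ E] {f g : E → ℝ} {p : E}

theorem fderiv_nonpos_of_eventually_neg (hf : DifferentiableAt ℝ f p)
    (hg : DifferentiableAt ℝ g p) (hfp : f p = 0) (hgp : g p = 0)
    (hneg : ∀ᶠ x in 𝓝 p, g x < 0 → f x < 0) {v : E} (hv : fderiv ℝ g p v < 0) :
    fderiv ℝ f p v ≤ 0 := by
  have hline : Tendsto (fun s : ℝ => p + s • v) (𝓝[>] 0) (𝓝 p) :=
    tendsto_nhdsWithin_of_tendsto_nhds (Continuous.tendsto' (by fun_prop) _ _ (by simp))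
  have hslope {h : E → ℝ} (hh : DifferentiableAt ℝ h p) (hhp : h p = 0) :
      Tendsto (fun s : ℝ => s⁻¹ * h (p + s • v)) (𝓝[>] 0) (𝓝 (fderiv ℝ h p v)) := by
    simpa [hhp] using
      (hh.hasFDerivAt.hasLineDerivAt v).tendsto_slope_zero_right
  refine le_of_tendsto (hslope hf hfp) ?_
  filter_upwards [self_mem_nhdsWithin, (hslope hg hgp).eventually_lt_const hv,
    hline.eventually hneg] with s (hs : 0 < s) hgs himp
  have hgs' : g (p + s • v) < 0 := neg_of_mul_neg_right hgs (inv_pos.2 hs).le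
  exact (mul_neg_of_pos_of_neg (inv_pos.2 hs) (himp hgs')).le

theorem exists_fderiv_eq_smul_of_eventually_neg (hf : DifferentiableAt ℝ f p)
    (hg : DifferentiableAt ℝ g p) (hfp : f p = 0) (hgp : g p = 0)
    (hneg : ∀ᶠ x in 𝓝 p, g x < 0 → f x < 0) (hdf : fderiv ℝ f p ≠ 0) (hdg : fderiv ℝ g p ≠ 0) :
    ∃ c : ℝ, 0 < c ∧ fderiv ℝ f p = c • fderiv ℝ g p := by
  obtain ⟨w, hw⟩ : ∃ w, fderiv ℝ g p w = 1 := by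
    obtain ⟨w, hw⟩ := DFunLike.ne_iff.1 hdg
    exact ⟨(fderiv ℝ g p w)⁻¹ • w, by simpa using inv_mul_cancel₀ hw⟩
  have hker : ∀ v, fderiv ℝ g p v = 0 → fderiv ℝ f p v = 0 := by
    intro v hv
    have hle (t : ℝ) : -fderiv ℝ f p w + t * fderiv ℝ f p v ≤ 0 := by
      have hdir := fderiv_nonpos_of_eventually_neg hf hg hfp hgp hneg (v := -w + t • v)
        (by simp [hw, hv])
      simpa using hdir
    by_contra hne
    have := hle ((fderiv ℝ f p w + 1) / fderiv ℝ f p v)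
    rw [div_mul_cancel₀ _ hne] at this
    linarith
  have heq : fderiv ℝ f p = fderiv ℝ f p w • fderiv ℝ g p := by
    ext v
    have := hker (v - fderiv ℝ g p v • w) (by simp [hw])
    rw [map_sub, map_smul, smul_eq_mul, sub_eq_zero] at this
    rw [this, smul_apply, smul_eq_mul, mul_comm]
  have hnonneg : 0 ≤ fderiv ℝ f p w := by
    simpa using fderiv_nonpos_of_eventually_neg hf hg hfp hgp hneg (v := -w) (by simp [hw])
  refine ⟨fderiv ℝ f p w, hnonneg.lt_of_ne fun h => hdf ?_, heq⟩
  rw [heq, ← h, zero_smul]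

theorem hasDerivAt_comp_parabola (hf : ContDiffAt ℝ 2 f p) (v u : E) :
    ∀ᶠ s : ℝ in 𝓝 0, HasDerivAt (fun s : ℝ => f (p + s • v + s ^ 2 • u))
      (fderiv ℝ f (p + s • v + s ^ 2 • u) (v + (2 * s) • u)) s := by
  have hcurve : Tendsto (fun s : ℝ => p + s • v + s ^ 2 • u) (𝓝 0) (𝓝 p) :=
    Continuous.tendsto' (by fun_prop) _ _ (by simp)
  filter_upwards [hcurve.eventually (hf.eventually (by simp))] with s hs
  refine (hs.differentiableAt (by norm_num)).hasFDerivAt.comp_hasDerivAt s ?_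
  simpa using (((hasDerivAt_id s).smul_const v).const_add p).fun_add
    ((hasDerivAt_pow 2 s).smul_const u)

theorem deriv_deriv_comp_parabola (hf : ContDiffAt ℝ 2 f p) (v u : E) :
    deriv (deriv fun s : ℝ => f (p + s • v + s ^ 2 • u)) 0 =
      fderiv ℝ (fderiv ℝ f) p v v + 2 * fderiv ℝ f p u := by
  have hderiv : deriv (fun s : ℝ => f (p + s • v + s ^ 2 • u)) =ᶠ[𝓝 0]
      fun s => fderiv ℝ f (p + s • v + s ^ 2 • u) (v + (2 * s) • u) :=
    (hasDerivAt_comp_parabola hf v u).mono fun _ h => h.deriv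
  have hcurve : HasDerivAt (fun s : ℝ => p + s • v + s ^ 2 • u) v 0 := by
    simpa using (((hasDerivAt_id (0 : ℝ)).smul_const v).const_add p).fun_add
      ((hasDerivAt_pow 2 (0 : ℝ)).smul_const u)
  have hdf : HasFDerivAt (fderiv ℝ f) (fderiv ℝ (fderiv ℝ f) p) p :=
    ((hf.fderiv_right (m := 1) (by norm_num)).differentiableAt (by norm_num)).hasFDerivAt
  have hdfcurve : HasDerivAt (fun s : ℝ => fderiv ℝ f (p + s • v + s ^ 2 • u))
      (fderiv ℝ (fderiv ℝ f) p v) 0 :=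
    hdf.comp_hasDerivAt_of_eq 0 hcurve (by simp)
  have hvel : HasDerivAt (fun s : ℝ => v + (2 * s) • u) ((2 : ℝ) • u) 0 := by
    simpa using (((hasDerivAt_id (0 : ℝ)).const_mul 2).smul_const u).const_add v
  have hsecond : HasDerivAt (fun s : ℝ => fderiv ℝ f (p + s • v + s ^ 2 • u) (v + (2 * s) • u))
      (fderiv ℝ (fderiv ℝ f) p v v + 2 * fderiv ℝ f p u) 0 := by
    refine (hdfcurve.clm_apply hvel).congr_deriv ?_
    simp
  rw [hderiv.deriv_eq, hsecond.deriv]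

theorem smul_fderiv_fderiv_le_of_eventually_neg (hf : ContDiffAt ℝ 2 f p)
    (hg : ContDiffAt ℝ 2 g p) (hfp : f p = 0) (hgp : g p = 0)
    (hneg : ∀ᶠ x in 𝓝 p, f x < 0 → g x < 0) (hdg : fderiv ℝ g p ≠ 0) {c : ℝ} (hc : 0 < c)
    (hfg : fderiv ℝ f p = c • fderiv ℝ g p) {v : E} (hv : fderiv ℝ g p v = 0) :
    c * fderiv ℝ (fderiv ℝ g) p v v ≤ fderiv ℝ (fderiv ℝ f) p v v := by
  by_contra! hlt
  obtain ⟨a, haf, hag⟩ : ∃ a, fderiv ℝ (fderiv ℝ f) p v v + c * a < 0 ∧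
      0 < fderiv ℝ (fderiv ℝ g) p v v + a := by
    obtain ⟨m, hfm, hmg⟩ := exists_between ((div_lt_iff₀' hc).2 hlt)
    refine ⟨-m, ?_, by linarith⟩
    linarith [(div_lt_iff₀' hc).1 hfm]
  obtain ⟨u, hu⟩ : ∃ u, 2 * fderiv ℝ g p u = a := by
    obtain ⟨w, hw⟩ := DFunLike.ne_iff.1 hdg
    refine ⟨(a / 2 / fderiv ℝ g p w) • w, ?_⟩
    rw [map_smul, smul_eq_mul, div_mul_cancel₀ _ hw]
    ring
  let γ (s : ℝ) : E := p + s • v + s ^ 2 • u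
  have hγ0 : γ 0 = p := by simp [γ]
  have hγ : Continuous γ := by fun_prop
  have hcrit {h : E → ℝ} (hh : ContDiffAt ℝ 2 h p) (hhv : fderiv ℝ h p v = 0) :
      deriv (fun s => h (γ s)) 0 = 0 := by
    rw [(hasDerivAt_comp_parabola hh v u).self_of_nhds.deriv]
    simpa using hhv
  have hcont {h : E → ℝ} (hh : ContDiffAt ℝ 2 h p) : ContinuousAt (fun s => h (γ s)) 0 :=
    ContinuousAt.comp (by simpa [hγ0] using hh.continuousAt) hγ.continuousAt
  have hf'' : deriv (deriv fun s => f (γ s)) 0 < 0 := by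
    rw [deriv_deriv_comp_parabola hf, hfg, smul_apply, smul_eq_mul, mul_left_comm, hu]
    exact haf
  have hg'' : 0 < deriv (deriv fun s => g (γ s)) 0 := by
    rwa [deriv_deriv_comp_parabola hg, hu]
  have hmax := isLocalMax_of_deriv_deriv_neg hf'' (hcrit hf (by simp [hfg, hv])) (hcont hf)
  have hmin := isLocalMin_of_deriv_deriv_pos hg'' (hcrit hg hv) (hcont hg)
  have hzero : (fun s => f (γ s)) =ᶠ[𝓝 0] 0 := by
    filter_upwards [hmax, hmin, (hγ.tendsto' 0 p hγ0).eventually hneg] with s hfs hgs himp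
    simp only [hγ0, hfp, hgp] at hfs hgs
    exact hfs.antisymm (not_lt.1 fun h => hgs.not_gt (himp h))
  rw [hzero.deriv.deriv_eq] at hf''
  simp at hf''

theorem exists_fderiv_fderiv_eq_of_eventually_neg_iff (hf : ContDiffAt ℝ 2 f p)
    (hg : ContDiffAt ℝ 2 g p) (hfp : f p = 0) (hgp : g p = 0)
    (hneg : ∀ᶠ x in 𝓝 p, f x < 0 ↔ g x < 0) (hdf : fderiv ℝ f p ≠ 0) (hdg : fderiv ℝ g p ≠ 0) :
    ∃ c : ℝ, 0 < c ∧ fderiv ℝ f p = c • fderiv ℝ g p ∧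
      ∀ v u, fderiv ℝ g p v = 0 → fderiv ℝ g p u = 0 →
        fderiv ℝ (fderiv ℝ f) p v u = c * fderiv ℝ (fderiv ℝ g) p v u := by
  obtain ⟨c, hc, hfg⟩ := exists_fderiv_eq_smul_of_eventually_neg
    (hf.differentiableAt (by norm_num)) (hg.differentiableAt (by norm_num)) hfp hgp
    (hneg.mono fun _ h => h.2) hdf hdg
  have hgf : fderiv ℝ g p = c⁻¹ • fderiv ℝ f p := by rw [hfg, inv_smul_smul₀ hc.ne']
  have hdiag (v : E) (hv : fderiv ℝ g p v = 0) :
      fderiv ℝ (fderiv ℝ f) p v v = c * fderiv ℝ (fderiv ℝ g) p v v := by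
    refine le_antisymm ?_ (smul_fderiv_fderiv_le_of_eventually_neg hf hg hfp hgp
      (hneg.mono fun _ h => h.1) hdg hc hfg hv)
    exact (inv_mul_le_iff₀ hc).1 (smul_fderiv_fderiv_le_of_eventually_neg hg hf hgp hfp
      (hneg.mono fun _ h => h.2) hdf (inv_pos.2 hc) hgf (by simp [hfg, hv]))
  refine ⟨c, hc, hfg, fun v u hv hu => ?_⟩
  have hsum := hdiag (v + u) (by rw [map_add, hv, hu, add_zero])
  have hsymm {h : E → ℝ} (hh : ContDiffAt ℝ 2 h p) :
      fderiv ℝ (fderiv ℝ h) p u v = fderiv ℝ (fderiv ℝ h) p v u :=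
    hh.isSymmSndFDerivAt (by simp) u v
  simp only [map_add, add_apply, hdiag v hv, hdiag u hu, hsymm hf, hsymm hg] at hsum
  linarith

end DefiningFunctionGermComparison

section ComplexHessian

variable {N : ℕ}

theorem sum_re_smul_add_im_smul {F : Type*} [AddCommGroup F] [Module ℝ F]
    (D : CSpace N →ₗ[ℝ] F) (v : CSpace N) :
    D v = ∑ j, ((v j).re • D (EuclideanSpace.single j 1) +
      (v j).im • D (EuclideanSpace.single j Complex.I)) := by
  have hv : v = ∑ j, ((v j).re • EuclideanSpace.single j (1 : ℂ) +
      (v j).im • EuclideanSpace.single j Complex.I) := by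
    ext i
    simp [Finset.sum_add_distrib, Pi.single_apply, Complex.re_add_im]
  conv_lhs => rw [hv]
  simp only [map_sum, map_add, map_smul]

theorem sum_dz_mul (f : CSpace N → ℂ) (p v : CSpace N) :
    ∑ j, dz j f p * v j =
      (1 / 2) * (fderiv ℝ f p v - Complex.I * fderiv ℝ f p (Complex.I • v)) := by
  have hexpand := sum_re_smul_add_im_smul (fderiv ℝ f p).toLinearMap
  simp only [ContinuousLinearMap.coe_coe] at hexpand
  rw [hexpand v, hexpand (Complex.I • v), Finset.mul_sum, ← Finset.sum_sub_distrib, Finset.mul_sum]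
  refine Finset.sum_congr rfl fun j _ => ?_
  have hv : ((v j).re + (v j).im * Complex.I : ℂ) = v j := Complex.re_add_im (v j)
  simp only [dz, PiLp.smul_apply, smul_eq_mul, Complex.I_mul_re, Complex.I_mul_im,
    Complex.real_smul, Complex.ofReal_neg]
  linear_combination (-(1 / 2 : ℂ) * (fderiv ℝ f p (EuclideanSpace.single j 1)
    - Complex.I * fderiv ℝ f p (EuclideanSpace.single j Complex.I))) * hv
    - (1 / 2 : ℂ) * (v j).im * fderiv ℝ f p (EuclideanSpace.single j Complex.I) * Complex.I_mul_I

theorem sum_dzbar_mul_conj (f : CSpace N → ℂ) (p v : CSpace N) :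
    ∑ j, dzbar j f p * conj (v j) =
      (1 / 2) * (fderiv ℝ f p v + Complex.I * fderiv ℝ f p (Complex.I • v)) := by
  have hexpand := sum_re_smul_add_im_smul (fderiv ℝ f p).toLinearMap
  simp only [ContinuousLinearMap.coe_coe] at hexpand
  rw [hexpand v, hexpand (Complex.I • v), Finset.mul_sum, ← Finset.sum_add_distrib, Finset.mul_sum]
  refine Finset.sum_congr rfl fun j _ => ?_
  have hv : conj (v j) = (v j).re - (v j).im * Complex.I := by
    apply Complex.ext <;> simp
  simp only [dzbar, PiLp.smul_apply, smul_eq_mul, Complex.I_mul_re, Complex.I_mul_im,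
    Complex.real_smul, Complex.ofReal_neg]
  linear_combination (1 / 2 : ℂ) * (fderiv ℝ f p (EuclideanSpace.single j 1)
    + Complex.I * fderiv ℝ f p (EuclideanSpace.single j Complex.I)) * hv
    - (1 / 2 : ℂ) * (v j).im * fderiv ℝ f p (EuclideanSpace.single j Complex.I) * Complex.I_mul_I

theorem fderiv_ofReal_apply {ρ : CSpace N → ℝ} {p : CSpace N} (h : DifferentiableAt ℝ ρ p)
    (v : CSpace N) : fderiv ℝ (fun x => (ρ x : ℂ)) p v = fderiv ℝ ρ p v := by
  have hcomp : HasFDerivAt (fun x => (ρ x : ℂ)) (Complex.ofRealCLM.comp (fderiv ℝ ρ p)) p :=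
    Complex.ofRealCLM.hasFDerivAt.comp p h.hasFDerivAt
  simp [hcomp.fderiv]

theorem mem_tangent10_iff {ρ : CSpace N → ℝ} {p : CSpace N} (h : DifferentiableAt ℝ ρ p)
    {L : CSpace N} :
    L ∈ tangent10 ρ p ↔ fderiv ℝ ρ p L = 0 ∧ fderiv ℝ ρ p (Complex.I • L) = 0 := by
  rw [tangent10, Set.mem_ofPred_eq, sum_dz_mul, fderiv_ofReal_apply h, fderiv_ofReal_apply h,
    mul_eq_zero_iff_left (by norm_num), Complex.ext_iff]
  simp

theorem leviForm_eq {ρ : CSpace N → ℝ} {p : CSpace N} (h : ContDiffAt ℝ 2 ρ p) (L M : CSpace N) :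
    leviForm ρ p L M = (1 / 4) *
      (fderiv ℝ (fderiv ℝ ρ) p L M + fderiv ℝ (fderiv ℝ ρ) p (Complex.I • L) (Complex.I • M)
        + Complex.I * (fderiv ℝ (fderiv ℝ ρ) p L (Complex.I • M)
          - fderiv ℝ (fderiv ℝ ρ) p (Complex.I • L) M)) := by
  have hdiff : HasFDerivAt (fderiv ℝ ρ) (fderiv ℝ (fderiv ℝ ρ) p) p :=
    ((h.fderiv_right (m := 1) (by norm_num)).differentiableAt (by norm_num)).hasFDerivAt
  have hdir (v : CSpace N) : HasFDerivAt (fun x => (fderiv ℝ ρ x v : ℂ))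
      (Complex.ofRealCLM.comp ((fderiv ℝ (fderiv ℝ ρ) p).flip v)) p :=
    Complex.ofRealCLM.hasFDerivAt.comp p <|
      (hdiff.clm_apply (hasFDerivAt_const v p)).congr_fderiv (by ext; simp)
  have hpair (v u : CSpace N) := ((hdir v).add ((hdir u).const_mul Complex.I)).const_mul (1 / 2 : ℂ)
  have hρ : ∀ᶠ x in 𝓝 p, DifferentiableAt ℝ ρ x :=
    (h.eventually (by simp)).mono fun x hx => hx.differentiableAt (by norm_num)
  have hdzbar (k : Fin N) : DifferentiableAt ℝ (dzbar k fun x => (ρ x : ℂ)) p := by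
    refine (hpair (EuclideanSpace.single k 1)
      (EuclideanSpace.single k Complex.I)).differentiableAt.congr_of_eventuallyEq ?_
    filter_upwards [hρ] with x hx
    simp [dzbar, fderiv_ofReal_apply hx]
  have hsum : (fun x => ∑ k, dzbar k (fun x => (ρ x : ℂ)) x * conj (M k)) =ᶠ[𝓝 p] fun x =>
      (1 / 2) * ((fderiv ℝ ρ x M : ℂ) + Complex.I * (fderiv ℝ ρ x (Complex.I • M) : ℂ)) := by
    filter_upwards [hρ] with x hx
    rw [sum_dzbar_mul_conj, fderiv_ofReal_apply hx, fderiv_ofReal_apply hx]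
  have hfderiv (v : CSpace N) : ∑ k, fderiv ℝ (dzbar k fun x => (ρ x : ℂ)) p v * conj (M k) =
      (1 / 2) * (fderiv ℝ (fderiv ℝ ρ) p v M +
        Complex.I * fderiv ℝ (fderiv ℝ ρ) p v (Complex.I • M)) := by
    have hlin := HasFDerivAt.fun_sum (u := Finset.univ) fun k _ =>
      (hdzbar k).hasFDerivAt.mul_const (conj (M k))
    simpa [mul_comm, mul_add] using DFunLike.congr_fun
      (hlin.fderiv.symm.trans (hsum.fderiv_eq.trans (hpair M (Complex.I • M)).fderiv)) v
  have hswap : leviForm ρ p L M =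
      ∑ k, (∑ j, dz j (dzbar k fun x => (ρ x : ℂ)) p * L j) * conj (M k) := by
    simp only [leviForm, Finset.sum_mul]
    exact Finset.sum_comm
  simp only [hswap, sum_dz_mul, mul_assoc, ← Finset.mul_sum, sub_mul, Finset.sum_sub_distrib,
    hfderiv]
  linear_combination (-(1 / 4 : ℂ) * fderiv ℝ (fderiv ℝ ρ) p (Complex.I • L) (Complex.I • M)) *
    Complex.I_mul_I

end ComplexHessian

section LeviComparison

variable {N : ℕ} {m : WithTop ℕ∞} {Ω U V : Set (CSpace N)} {ρ r : CSpace N → ℝ} {p : CSpace N}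

theorem IsDefiningFunction.contDiffAt (h : IsDefiningFunction m Ω U ρ) (hp : p ∈ frontier Ω) :
    ContDiffAt ℝ m ρ p :=
  h.contDiffOn.contDiffAt (h.isOpen.mem_nhds (h.frontier_subset hp))

theorem IsDefiningFunction.eventually_mem_iff (h : IsDefiningFunction m Ω U ρ)
    (hp : p ∈ frontier Ω) : ∀ᶠ x in 𝓝 p, x ∈ Ω ↔ ρ x < 0 := by
  filter_upwards [h.isOpen.mem_nhds (h.frontier_subset hp)] with x hx using h.mem_iff x hx

theorem IsDefiningFunction.eq_zero (h : IsDefiningFunction m Ω U ρ) (hp : p ∈ frontier Ω) :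
    ρ p = 0 := by
  have hcont : ContinuousAt ρ p := (h.contDiffAt hp).continuousAt
  have hmem := h.eventually_mem_iff hp
  have hin : ∃ᶠ x in 𝓝 p, x ∈ Ω := mem_closure_iff_frequently.1 hp.1
  refine le_antisymm (le_of_tendsto_of_frequently hcont ?_) (not_lt.1 fun hlt => hp.2 ?_)
  · exact (hin.and_eventually hmem).mono fun x hx => (hx.2.1 hx.1).le
  · rw [mem_interior_iff_mem_nhds]
    filter_upwards [hmem, hcont.eventually_lt_const hlt] with x hx hneg using hx.2 hneg

theorem IsDefiningFunction.exists_fderiv_fderiv_eq (hρ : IsDefiningFunction 2 Ω U ρ)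
    (hr : IsDefiningFunction 2 Ω V r) (hp : p ∈ frontier Ω) :
    ∃ c : ℝ, 0 < c ∧ fderiv ℝ ρ p = c • fderiv ℝ r p ∧
      ∀ v u, fderiv ℝ r p v = 0 → fderiv ℝ r p u = 0 →
        fderiv ℝ (fderiv ℝ ρ) p v u = c * fderiv ℝ (fderiv ℝ r) p v u :=
  exists_fderiv_fderiv_eq_of_eventually_neg_iff (hρ.contDiffAt hp) (hr.contDiffAt hp)
    (hρ.eq_zero hp) (hr.eq_zero hp)
    (by filter_upwards [hρ.eventually_mem_iff hp, hr.eventually_mem_iff hp] with x h₁ h₂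
        using h₁.symm.trans h₂)
    (hρ.fderiv_ne_zero p hp) (hr.fderiv_ne_zero p hp)

theorem leviEigenvalues_eq_image {c : ℝ} (hc : c ≠ 0) (htan : tangent10 ρ p = tangent10 r p)
    (hlevi : ∀ L ∈ tangent10 r p, ∀ M ∈ tangent10 r p, leviForm ρ p L M = c * leviForm r p L M) :
    leviEigenvalues ρ p = (c * ·) '' leviEigenvalues r p := by
  have hc' : (c : ℂ) ≠ 0 := Complex.ofReal_ne_zero.2 hc
  ext μ
  simp only [leviEigenvalues, htan, Set.mem_ofPred_eq, Set.mem_image]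
  constructor
  · rintro ⟨L, hL, hL0, h⟩
    refine ⟨c⁻¹ * μ, ⟨L, hL, hL0, fun M hM => ?_⟩, mul_inv_cancel_left₀ hc μ⟩
    have hM' := (hlevi L hL M hM).symm.trans (h M hM)
    rw [← mul_right_inj' hc', hM', Complex.ofReal_mul, Complex.ofReal_inv, ← mul_assoc,
      mul_inv_cancel_left₀ hc']
  · rintro ⟨ν, ⟨L, hL, hL0, h⟩, rfl⟩
    refine ⟨L, hL, hL0, fun M hM => ?_⟩
    rw [hlevi L hL M hM, h M hM, Complex.ofReal_mul, mul_assoc]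

theorem IsDefiningFunction.leviEigenvalues_eq (hρ : IsDefiningFunction 2 Ω U ρ)
    (hr : IsDefiningFunction 2 Ω V r) (hp : p ∈ frontier Ω) :
    leviEigenvalues ρ p = (‖fderiv ℝ ρ p‖ / ‖fderiv ℝ r p‖ * ·) '' leviEigenvalues r p := by
  obtain ⟨c, hc, hfderiv, hhess⟩ := hρ.exists_fderiv_fderiv_eq hr hp
  have hρp := hρ.contDiffAt hp
  have hrp := hr.contDiffAt hp
  have hratio : ‖fderiv ℝ ρ p‖ / ‖fderiv ℝ r p‖ = c := by
    rw [hfderiv, norm_smul, Real.norm_of_nonneg hc.le,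
      mul_div_cancel_right₀ _ (norm_ne_zero_iff.2 (hr.fderiv_ne_zero p hp))]
  rw [hratio]
  refine leviEigenvalues_eq_image hc.ne' ?_ fun L hL M hM => ?_
  · ext L
    simp [mem_tangent10_iff (hρp.differentiableAt (by norm_num)),
      mem_tangent10_iff (hrp.differentiableAt (by norm_num)), hfderiv, hc.ne']
  · rw [mem_tangent10_iff (hrp.differentiableAt (by norm_num))] at hL hM
    simp only [leviForm_eq hρp, leviForm_eq hrp, hhess _ _ hL.1 hM.1, hhess _ _ hL.2 hM.2,
      hhess _ _ hL.1 hM.2, hhess _ _ hL.2 hM.1, Complex.ofReal_mul]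
    ring

end LeviComparison

section RankOnePerturbation

variable {E : Type*} [NormedAddCommGroup E] [InnerProductSpace ℂ E]

theorem two_le_finrank_of_inner_eq_zero [FiniteDimensional ℂ E] {u L : E} (hu : u ≠ 0) (hL : L ≠ 0)
    (h : inner ℂ u L = 0) : 2 ≤ Module.finrank ℂ E := by
  have hind : LinearIndependent ℂ ![u, L] := by
    refine linearIndependent_of_ne_zero_of_inner_eq_zero (by simp [Fin.forall_fin_two, hu, hL]) ?_
    simp [Pairwise, Fin.forall_fin_two, h, inner_eq_zero_symm.1 h]
  simpa using hind.fintype_card_le_finrank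

theorem exists_ne_zero_inner_eq_zero (h : 2 ≤ Module.finrank ℂ E) (u : E) :
    ∃ L : E, L ≠ 0 ∧ inner ℂ u L = 0 := by
  have hne : (ℂ ∙ u)ᗮ ≠ ⊥ := by
    rw [Ne, Submodule.orthogonal_eq_bot_iff]
    intro htop
    have hle := finrank_span_le_card (R := ℂ) ({u} : Set E)
    rw [htop, finrank_top, Set.toFinset_singleton, Finset.card_singleton] at hle
    omega
  obtain ⟨L, hL, hL0⟩ := Submodule.exists_mem_ne_zero_of_ne_bot hne
  exact ⟨L, hL0, Submodule.mem_orthogonal_singleton_iff_inner_right.1 hL⟩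

theorem setOf_eigenvalue_sub_smul_inner [FiniteDimensional ℂ E] [Nontrivial E] (a : ℝ) (u : E) :
    {μ : ℝ | ∃ L : E, L ≠ 0 ∧ L - (a * inner ℂ u L) • u = (μ : ℂ) • L} =
      {1 - a * ‖u‖ ^ 2} ∪ {μ | 2 ≤ Module.finrank ℂ E ∧ μ = 1} := by
  ext μ
  simp only [Set.mem_ofPred_eq, Set.mem_union, Set.mem_singleton_iff]
  constructor
  · rintro ⟨L, hL, heq⟩
    by_cases hu : u = 0
    · left
      have : (1 : ℂ) • L = (μ : ℂ) • L := by simpa [hu] using heq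
      simpa [hu] using (Complex.ofReal_eq_one.1 (smul_left_injective ℂ hL this).symm)
    by_cases hort : inner ℂ u L = 0
    · right
      have : (1 : ℂ) • L = (μ : ℂ) • L := by simpa [hort] using heq
      exact ⟨two_le_finrank_of_inner_eq_zero hu hL hort,
        Complex.ofReal_eq_one.1 (smul_left_injective ℂ hL this).symm⟩
    · left
      have hinner := congrArg (inner ℂ u) heq
      rw [inner_sub_right, inner_smul_right, inner_smul_right, inner_self_eq_norm_sq_to_K] at hinner
      refine Complex.ofReal_injective (mul_right_cancel₀ hort (hinner.symm.trans ?_))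
      push_cast [Complex.coe_algebraMap]
      ring
  · rintro (rfl | ⟨hfin, rfl⟩)
    · by_cases hu : u = 0
      · obtain ⟨L, hL⟩ := exists_ne (0 : E)
        exact ⟨L, hL, by simp [hu]⟩
      · refine ⟨u, hu, ?_⟩
        rw [inner_self_eq_norm_sq_to_K]
        push_cast [Complex.coe_algebraMap]
        module
    · obtain ⟨L, hL, hort⟩ := exists_ne_zero_inner_eq_zero hfin u
      exact ⟨L, hL, by simp [hort]⟩

end RankOnePerturbation

section SiegelLeviForm

variable {n N : ℕ} {p : CSpace (n + 1)}

theorem re_inner_eq_real_inner (v u : CSpace N) : (inner ℂ v u).re = inner ℝ v u := by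
  simp [PiLp.inner_apply, Complex.inner]

theorem real_inner_I_smul_right (v u : CSpace N) :
    inner ℝ v (Complex.I • u) = -(inner ℂ v u).im := by
  rw [← re_inner_eq_real_inner, inner_smul_right, Complex.I_mul_re]

theorem tangent10_eq_orthogonal {ρ : CSpace N → ℝ} {p G : CSpace N}
    (h : HasFDerivAt ρ (innerSL ℝ G) p) : tangent10 ρ p = ((ℂ ∙ G)ᗮ : Submodule ℂ (CSpace N)) := by
  ext L
  rw [mem_tangent10_iff h.differentiableAt, SetLike.mem_coe,
    Submodule.mem_orthogonal_singleton_iff_inner_right, h.fderiv, innerSL_apply_apply,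
    innerSL_apply_apply, real_inner_I_smul_right, ← re_inner_eq_real_inner, neg_eq_zero,
    Complex.ext_iff, Complex.zero_re, Complex.zero_im]

theorem isDefiningFunction_siegelFun :
    IsDefiningFunction 2 (siegel n) Set.univ siegelFun where
  isOpen := isOpen_univ
  frontier_subset := Set.subset_univ _
  contDiffOn := contDiff_siegelFun.contDiffOn
  mem_iff _ _ := mem_siegel_iff
  fderiv_ne_zero p _ := by
    rw [(hasFDerivAt_siegelFun p).fderiv, ← norm_ne_zero_iff, innerSL_apply_norm,
      ← pow_ne_zero_iff two_ne_zero, norm_siegelGrad_sq]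
    have := zNormSq_nonneg p
    positivity

theorem fderiv_fderiv_siegelFun (v u : CSpace (n + 1)) :
    fderiv ℝ (fderiv ℝ siegelFun) p v u = 2 * inner ℝ (zPart n v) u := by
  have hgrad : HasFDerivAt siegelGrad ((2 : ℝ) • (zPart n).restrictScalars ℝ) p :=
    (((zPart n).restrictScalars ℝ).hasFDerivAt.const_smul (2 : ℝ)).sub_const (imVec n)
  have hcomp : HasFDerivAt (fun p => innerSL ℝ (siegelGrad p)) _ p :=
    (innerSL ℝ).hasFDerivAt.comp p hgrad
  rw [funext fun p => (hasFDerivAt_siegelFun p).fderiv, hcomp.fderiv]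
  exact real_inner_smul_left (zPart n v) u 2

theorem leviForm_siegelFun (L M : CSpace (n + 1)) :
    leviForm siegelFun p L M = inner ℂ M (zPart n L) := by
  rw [leviForm_eq contDiff_siegelFun.contDiffAt]
  simp only [fderiv_fderiv_siegelFun, map_smul, real_inner_I_smul_right]
  simp only [← re_inner_eq_real_inner, inner_smul_left]
  rw [← inner_conj_symm M]
  apply Complex.ext <;> simp [-inner_conj_symm] <;> ring

theorem zPart_eq_sub_inner_smul_imVec (L : CSpace (n + 1)) :
    zPart n L = L - inner ℂ (imVec n) L • imVec n := by
  ext k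
  refine Fin.lastCases ?_ (fun i => ?_) k <;>
    simp [imVec, EuclideanSpace.inner_single_left, (Fin.castSucc_lt_last _).ne, mul_right_comm]

theorem inner_siegelGrad_imVec : inner ℂ (siegelGrad p) (imVec n) = -1 := by
  simp [siegelGrad, imVec, EuclideanSpace.inner_single_right]

theorem siegelGrad_ne_zero : siegelGrad p ≠ 0 := fun h => by
  simpa [h] using inner_siegelGrad_imVec (p := p)

theorem one_sub_norm_orthogonalProjection_imVec_sq :
    1 - ‖(ℂ ∙ siegelGrad p)ᗮ.orthogonalProjectionOnto (imVec n)‖ ^ 2 = siegelScale p ^ 2 := by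
  have hpyth := Submodule.norm_sq_eq_add_norm_sq_projection (imVec n) (ℂ ∙ siegelGrad p)
  have hproj : ‖(ℂ ∙ siegelGrad p).orthogonalProjectionOnto (imVec n)‖ = siegelScale p := by
    have := norm_ne_zero_iff.2 (siegelGrad_ne_zero (p := p))
    rw [← Submodule.norm_coe, Submodule.coe_orthogonalProjectionOnto_apply,
      Submodule.starProjection_singleton, inner_siegelGrad_imVec, siegelScale_eq_inv_norm,
      norm_smul]
    simp only [norm_div, norm_neg, norm_one, RCLike.norm_ofReal, abs_pow, abs_norm]
    field_simp
  rw [norm_imVec, one_pow, hproj] at hpyth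
  linarith

theorem leviEigenvalues_siegelFun (hn : 1 ≤ n) :
    leviEigenvalues siegelFun p = {siegelScale p ^ 2} ∪ {μ | 2 ≤ n ∧ μ = 1} := by
  let T : Submodule ℂ (CSpace (n + 1)) := (ℂ ∙ siegelGrad p)ᗮ
  let u : T := T.orthogonalProjectionOnto (imVec n)
  have hfin : Module.finrank ℂ T = n := by
    have : Fact (Module.finrank ℂ (CSpace (n + 1)) = n + 1) := ⟨by simp⟩
    exact Submodule.finrank_orthogonal_span_singleton siegelGrad_ne_zero
  have : Nontrivial T := Module.nontrivial_of_finrank_pos (R := ℂ) (by omega)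
  have hlevi (L M : T) :
      leviForm siegelFun p L M = inner ℂ M (L - (((1 : ℝ) : ℂ) * inner ℂ u L) • u) := by
    rw [leviForm_siegelFun, zPart_eq_sub_inner_smul_imVec, inner_sub_right, inner_sub_right,
      inner_smul_right, inner_smul_right, Complex.ofReal_one, one_mul,
      Submodule.inner_orthogonalProjectionOnto_eq_of_mem_right,
      Submodule.inner_orthogonalProjectionOnto_eq_of_mem_left, Submodule.coe_inner]
  have heigen (μ : ℝ) (L : T) : (∀ M ∈ T, leviForm siegelFun p L M = μ * inner ℂ M L) ↔
      L - (((1 : ℝ) : ℂ) * inner ℂ u L) • u = (μ : ℂ) • L := by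
    refine ⟨fun h => ext_inner_left ℂ fun M => ?_, fun h M hM => ?_⟩
    · rw [← hlevi, h M M.2, inner_smul_right, Submodule.coe_inner]
    · rw [hlevi L ⟨M, hM⟩, h, inner_smul_right, Submodule.coe_inner]
  have hset := setOf_eigenvalue_sub_smul_inner 1 u
  rw [hfin, one_mul, one_sub_norm_orthogonalProjection_imVec_sq] at hset
  rw [← hset, leviEigenvalues, tangent10_eq_orthogonal (hasFDerivAt_siegelFun p)]
  ext μ
  constructor
  · rintro ⟨L, hL, hL0, h⟩
    exact ⟨⟨L, hL⟩, by simpa using hL0, (heigen μ ⟨L, hL⟩).1 h⟩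
  · rintro ⟨L, hL0, h⟩
    exact ⟨L, L.2, by simpa using hL0, (heigen μ L).2 h⟩

end SiegelLeviForm

section SiegelLeviEigenvalues

variable {n : ℕ} {p : CSpace (n + 1)} {U : Set (CSpace (n + 1))} {ρ : CSpace (n + 1) → ℝ}

theorem siegelScale_eq_rpow : siegelScale p = (1 + 4 * zNormSq p) ^ (-(1 / 2) : ℝ) := by
  have := zNormSq_nonneg p
  rw [Real.rpow_neg (by positivity), ← Real.sqrt_eq_rpow, siegelScale]

theorem siegelScale_cube_eq_rpow :
    siegelScale p ^ 3 = (1 + 4 * zNormSq p) ^ (-(3 / 2) : ℝ) := by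
  have := zNormSq_nonneg p
  rw [siegelScale_eq_rpow, ← Real.rpow_natCast, ← Real.rpow_mul (by positivity)]
  norm_num

theorem leviEigenvalues_siegel (hn : 1 ≤ n) (h : IsDefiningFunction 2 (siegel n) U ρ)
    (hρ : IsNormalizedOn (siegel n) ρ) (hp : p ∈ frontier (siegel n)) :
    leviEigenvalues ρ p = {siegelScale p ^ 3} ∪ {μ | 2 ≤ n ∧ μ = siegelScale p} := by
  rw [h.leviEigenvalues_eq isDefiningFunction_siegelFun hp, hρ p hp,
    (hasFDerivAt_siegelFun p).fderiv, innerSL_apply_norm, one_div, ← siegelScale_eq_inv_norm,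
    leviEigenvalues_siegelFun hn, Set.image_union, Set.image_singleton, ← pow_succ']
  congr 1
  ext μ
  constructor
  · rintro ⟨_, ⟨hn2, rfl⟩, rfl⟩
    exact ⟨hn2, mul_one _⟩
  · rintro ⟨hn2, rfl⟩
    exact ⟨1, ⟨hn2, rfl⟩, mul_one _⟩

theorem isLeast_leviEigenvalues_siegel (hn : 1 ≤ n) (h : IsDefiningFunction 2 (siegel n) U ρ)
    (hρ : IsNormalizedOn (siegel n) ρ) (hp : p ∈ frontier (siegel n)) :
    IsLeast (leviEigenvalues ρ p) (siegelScale p ^ 3) := by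
  rw [leviEigenvalues_siegel hn h hρ hp]
  refine ⟨Or.inl rfl, ?_⟩
  rintro μ (rfl | ⟨-, rfl⟩)
  · exact le_rfl
  · exact pow_le_of_le_one (siegelScale_pos p).le (siegelScale_le_one p) three_ne_zero

theorem strictlyPseudoconvex_siegel (hn : 1 ≤ n) : StrictlyPseudoconvex (siegel n) := by
  have h := isDefiningFunction_siegelNormalized (n := n) one_pos 2
  refine ⟨_, _, h, fun p hp μ hμ => (pow_pos (siegelScale_pos p) 3).trans_le ?_⟩
  exact (isLeast_leviEigenvalues_siegel hn h isNormalizedOn_siegelNormalized hp).2 hμ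

theorem exists_mem_frontier_siegel_zNormSq_eq (hn : 1 ≤ n) {s : ℝ} (hs : 0 ≤ s) :
    ∃ p ∈ frontier (siegel n), zNormSq p = s := by
  obtain ⟨i⟩ : Nonempty (Fin n) := ⟨⟨0, hn⟩⟩
  let z : CSpace (n + 1) := EuclideanSpace.single i.castSucc (√s : ℂ)
  have hz : zNormSq z = s := by
    have hnorm := norm_sq_eq_zNormSq_add z
    simpa [z, (Fin.castSucc_lt_last _).ne', Real.sq_sqrt hs] using hnorm.symm
  have hfun : siegelFun z = s := by
    rw [siegelFun, hz]
    simp [z, (Fin.castSucc_lt_last _).ne']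
  refine ⟨z + s • imVec n, ?_, ?_⟩
  · rw [mem_frontier_siegel_iff, siegelFun_add_smul_imVec, hfun, sub_self]
  · rw [← norm_zPart_sq, map_add, ContinuousLinearMap.map_smul_of_tower, zPart_imVec, smul_zero,
      add_zero, norm_zPart_sq, hz]

theorem tendsto_one_add_four_mul_rpow_neg :
    Tendsto (fun x : ℝ => (1 + 4 * x) ^ (-(3 / 2) : ℝ)) atTop (𝓝 0) :=
  (tendsto_rpow_neg_atTop (by norm_num)).comp
    (tendsto_atTop_add_const_left _ _ (tendsto_id.const_mul_atTop (by norm_num)))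

theorem not_uniformlyStrictlyPseudoconvex_siegel (hn : 1 ≤ n) :
    ¬ UniformlyStrictlyPseudoconvex (siegel n) := by
  rintro ⟨U, ρ, h, hρ, lam, hlam, hall⟩
  obtain ⟨s, hs, hs0⟩ := ((tendsto_one_add_four_mul_rpow_neg.eventually_lt_const hlam).and
    (eventually_ge_atTop 0)).exists
  obtain ⟨p, hp, rfl⟩ := exists_mem_frontier_siegel_zNormSq_eq hn hs0
  rw [← siegelScale_cube_eq_rpow] at hs
  exact hs.not_gt (hall p hp _ (isLeast_leviEigenvalues_siegel hn h hρ hp).1)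

theorem tendsto_sInf_leviEigenvalues_siegel (hn : 1 ≤ n)
    (h : IsDefiningFunction 2 (siegel n) U ρ) (hρ : IsNormalizedOn (siegel n) ρ) :
    Tendsto (fun p : frontier (siegel n) => sInf (leviEigenvalues ρ p.1))
      (comap (fun p : frontier (siegel n) => zNormSq p.1) atTop) (𝓝 0) := by
  refine (tendsto_one_add_four_mul_rpow_neg.comp tendsto_comap).congr fun p => ?_
  rw [(isLeast_leviEigenvalues_siegel hn h hρ p.2).csInf_eq, Function.comp_apply,
    siegelScale_cube_eq_rpow]

end SiegelLeviEigenvalues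

section WirtingerCalculus

variable {N : ℕ} {f g : CSpace N → ℂ} {p : CSpace N}

theorem dz_eq_of_hasFDerivAt {f' : CSpace N →L[ℝ] ℂ} (h : HasFDerivAt f f' p) (j : Fin N) :
    dz j f p = (1 / 2) * (f' (EuclideanSpace.single j 1)
      - Complex.I * f' (EuclideanSpace.single j Complex.I)) := by
  rw [dz, h.fderiv]

theorem dzbar_eq_of_hasFDerivAt {f' : CSpace N →L[ℝ] ℂ} (h : HasFDerivAt f f' p) (j : Fin N) :
    dzbar j f p = (1 / 2) * (f' (EuclideanSpace.single j 1)
      + Complex.I * f' (EuclideanSpace.single j Complex.I)) := by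
  rw [dzbar, h.fderiv]

theorem single_I_eq_smul (j : Fin N) :
    (EuclideanSpace.single j Complex.I : CSpace N) = Complex.I • EuclideanSpace.single j 1 := by
  ext k
  by_cases h : k = j <;> simp [h]

theorem dz_eq_of_hasFDerivAt_complex {f' : CSpace N →L[ℂ] ℂ} (h : HasFDerivAt f f' p)
    (j : Fin N) : dz j f p = f' (EuclideanSpace.single j 1) := by
  rw [dz_eq_of_hasFDerivAt (h.restrictScalars ℝ), single_I_eq_smul]
  simp only [ContinuousLinearMap.coe_restrictScalars', map_smul, smul_eq_mul]
  linear_combination (-(1 / 2 : ℂ) * f' (EuclideanSpace.single j 1)) * Complex.I_mul_I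

theorem dzbar_eq_zero_of_hasFDerivAt_complex {f' : CSpace N →L[ℂ] ℂ} (h : HasFDerivAt f f' p)
    (j : Fin N) : dzbar j f p = 0 := by
  rw [dzbar_eq_of_hasFDerivAt (h.restrictScalars ℝ), single_I_eq_smul]
  simp only [ContinuousLinearMap.coe_restrictScalars', map_smul, smul_eq_mul]
  linear_combination (1 / 2 : ℂ) * f' (EuclideanSpace.single j 1) * Complex.I_mul_I

theorem dz_eq_zero_of_hasFDerivAt_conj {f' : CSpace N →L[ℝ] ℂ} (h : HasFDerivAt f f' p)
    (hf' : ∀ w, f' (Complex.I • w) = -(Complex.I * f' w)) (j : Fin N) : dz j f p = 0 := by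
  rw [dz_eq_of_hasFDerivAt h, single_I_eq_smul, hf']
  linear_combination (1 / 2 : ℂ) * f' (EuclideanSpace.single j 1) * Complex.I_mul_I

theorem dzbar_eq_of_hasFDerivAt_conj {f' : CSpace N →L[ℝ] ℂ} (h : HasFDerivAt f f' p)
    (hf' : ∀ w, f' (Complex.I • w) = -(Complex.I * f' w)) (j : Fin N) :
    dzbar j f p = f' (EuclideanSpace.single j 1) := by
  rw [dzbar_eq_of_hasFDerivAt h, single_I_eq_smul, hf']
  linear_combination (-(1 / 2 : ℂ) * f' (EuclideanSpace.single j 1)) * Complex.I_mul_I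

theorem dz_mul (hf : DifferentiableAt ℝ f p) (hg : DifferentiableAt ℝ g p) (j : Fin N) :
    dz j (fun x => f x * g x) p = dz j f p * g p + f p * dz j g p := by
  rw [dz_eq_of_hasFDerivAt (hf.hasFDerivAt.fun_mul hg.hasFDerivAt), dz, dz]
  simp only [add_apply, smul_apply, smul_eq_mul]
  ring

theorem dzbar_mul (hf : DifferentiableAt ℝ f p) (hg : DifferentiableAt ℝ g p) (j : Fin N) :
    dzbar j (fun x => f x * g x) p = dzbar j f p * g p + f p * dzbar j g p := by
  rw [dzbar_eq_of_hasFDerivAt (hf.hasFDerivAt.fun_mul hg.hasFDerivAt), dzbar, dzbar]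
  simp only [add_apply, smul_apply, smul_eq_mul]
  ring

theorem dzbar_conj (hf : DifferentiableAt ℝ f p) (j : Fin N) :
    dzbar j (fun x => conj (f x)) p = conj (dz j f p) := by
  have h := (Complex.conjCLE : ℂ →L[ℝ] ℂ).hasFDerivAt.comp p hf.hasFDerivAt
  rw [dzbar_eq_of_hasFDerivAt (f := fun x => conj (f x)) h, dz]
  simp [Complex.conj_ofNat]

theorem dzbar_ofReal {r : CSpace N → ℝ} (hr : DifferentiableAt ℝ r p) (j : Fin N) :
    dzbar j (fun x => (r x : ℂ)) p = conj (dz j (fun x => (r x : ℂ)) p) := by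
  simpa only [Complex.conj_ofReal] using
    dzbar_conj (f := fun x => (r x : ℂ)) (Complex.ofRealCLM.differentiableAt.comp p hr) j

theorem dz_ofReal_comp {r : CSpace N → ℝ} (hr : DifferentiableAt ℝ r p) {θ : ℝ → ℝ}
    (hθ : DifferentiableAt ℝ θ (r p)) (j : Fin N) :
    dz j (fun x => (θ (r x) : ℂ)) p = deriv θ (r p) * dz j (fun x => (r x : ℂ)) p := by
  have h : HasFDerivAt (fun x => θ (r x)) (deriv θ (r p) • fderiv ℝ r p) p :=
    hθ.hasDerivAt.comp_hasFDerivAt p hr.hasFDerivAt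
  simp only [dz, fderiv_ofReal_apply h.differentiableAt, fderiv_ofReal_apply hr, h.fderiv,
    smul_apply, smul_eq_mul, Complex.ofReal_mul]
  ring

theorem real_inner_single (p : CSpace N) (j : Fin N) (a : ℂ) :
    inner ℝ p (EuclideanSpace.single j a) = (conj (p j) * a).re := by
  rw [← re_inner_eq_real_inner, EuclideanSpace.inner_single_right]
  simp [mul_comm]

theorem dz_norm_sq (j : Fin N) (p : CSpace N) :
    dz j (fun x => ((‖x‖ ^ 2 : ℝ) : ℂ)) p = conj (p j) := by
  have h : HasFDerivAt (fun x : CSpace N => ‖x‖ ^ 2) _ p := (hasFDerivAt_id p).norm_sq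
  simp only [dz, fderiv_ofReal_apply h.differentiableAt]
  rw [h.fderiv]
  apply Complex.ext <;> simp [real_inner_single]

theorem dzbar_weight (t : ℝ) (j : Fin N) (p : CSpace N) :
    dzbar j (fun x => (Real.exp (-t * ‖x‖ ^ 2) : ℂ)) p =
      -t * p j * Real.exp (-t * ‖p‖ ^ 2) := by
  have hnorm : DifferentiableAt ℝ (fun x : CSpace N => ‖x‖ ^ 2) p :=
    (hasFDerivAt_id p).norm_sq.differentiableAt
  have hexp : HasDerivAt (fun s : ℝ => Real.exp (-t * s)) (Real.exp (-t * ‖p‖ ^ 2) * -t)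
      (‖p‖ ^ 2) := by
    simpa using ((hasDerivAt_id (‖p‖ ^ 2)).const_mul (-t)).exp
  rw [dzbar_ofReal (r := fun x => Real.exp (-t * ‖x‖ ^ 2)) (by fun_prop),
    dz_ofReal_comp hnorm (θ := fun s => Real.exp (-t * s)) hexp.differentiableAt, dz_norm_sq,
    hexp.deriv]
  simp only [map_mul, Complex.conj_ofReal, Complex.conj_conj, Complex.ofReal_mul,
    Complex.ofReal_neg, map_neg]
  ring

theorem contDiff_dz {m n : WithTop ℕ∞} (hf : ContDiff ℝ n f) (hmn : m + 1 ≤ n) (j : Fin N) :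
    ContDiff ℝ m (dz j f) := by
  have h := hf.fderiv_right hmn
  exact contDiff_const.mul ((h.clm_apply contDiff_const).sub
    (contDiff_const.mul (h.clm_apply contDiff_const)))

theorem contDiff_dzbar {m n : WithTop ℕ∞} (hf : ContDiff ℝ n f) (hmn : m + 1 ≤ n) (j : Fin N) :
    ContDiff ℝ m (dzbar j f) := by
  have h := hf.fderiv_right hmn
  exact contDiff_const.mul ((h.clm_apply contDiff_const).add
    (contDiff_const.mul (h.clm_apply contDiff_const)))

theorem dz_eq_zero_of_notMem_tsupport (hp : p ∉ tsupport f) (j : Fin N) : dz j f p = 0 := by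
  have : fderiv ℝ f p = 0 := Function.notMem_support.1 fun h => hp (support_fderiv_subset ℝ h)
  simp [dz, this]

theorem dzbar_eq_zero_of_notMem_tsupport (hp : p ∉ tsupport f) (j : Fin N) :
    dzbar j f p = 0 := by
  have : fderiv ℝ f p = 0 := Function.notMem_support.1 fun h => hp (support_fderiv_subset ℝ h)
  simp [dzbar, this]

theorem norm_half_add_le {a b : ℂ} {c : ℝ} (ha : ‖a‖ ≤ c) (hb : ‖b‖ ≤ c) :
    ‖(1 / 2) * (a + Complex.I * b)‖ ≤ c := by
  have h := norm_add_le a (Complex.I * b)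
  rw [norm_mul, Complex.norm_I, one_mul] at h
  rw [norm_mul, show ‖(1 / 2 : ℂ)‖ = 1 / 2 by simp]
  linarith

theorem norm_dz_le {c : ℝ} {j : Fin N}
    (hc : ∀ a : ℂ, ‖a‖ = 1 → ‖fderiv ℝ f p (EuclideanSpace.single j a)‖ ≤ c) :
    ‖dz j f p‖ ≤ c := by
  simpa only [dz, mul_neg, ← sub_eq_add_neg] using
    norm_half_add_le (hc 1 (by simp)) ((norm_neg _).trans_le (hc Complex.I (by simp)))

theorem norm_dzbar_le {c : ℝ} {j : Fin N}
    (hc : ∀ a : ℂ, ‖a‖ = 1 → ‖fderiv ℝ f p (EuclideanSpace.single j a)‖ ≤ c) :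
    ‖dzbar j f p‖ ≤ c :=
  norm_half_add_le (hc 1 (by simp)) (hc Complex.I (by simp))

theorem integral_dzbar_mul {φ : CSpace N → ℂ} (hf : ContDiff ℝ 1 f) (hφ : ContDiff ℝ 1 φ)
    (hc : HasCompactSupport φ) (k : Fin N) :
    ∫ x, dzbar k f x * φ x = -∫ x, f x * dzbar k φ x := by
  have hf' (v : CSpace N) : Integrable fun x => fderiv ℝ f x v * φ x :=
    (((hf.fderiv_right (m := 0) (by simp)).clm_apply contDiff_const).continuous.mul
      hφ.continuous).integrable_of_hasCompactSupport hc.mul_left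
  have hφ' (v : CSpace N) : Integrable fun x => f x * fderiv ℝ φ x v :=
    (hf.continuous.mul ((hφ.fderiv_right (m := 0) (by simp)).clm_apply
      contDiff_const).continuous).integrable_of_hasCompactSupport (hc.fderiv_apply ℝ v).mul_left
  have hfφ : Integrable fun x => f x * φ x :=
    (hf.continuous.mul hφ.continuous).integrable_of_hasCompactSupport hc.mul_left
  have hparts (v : CSpace N) : ∫ x, fderiv ℝ f x v * φ x = -∫ x, f x * fderiv ℝ φ x v :=
    neg_eq_iff_eq_neg.1 (integral_mul_fderiv_eq_neg_fderiv_mul_of_integrable (hf' v) (hφ' v) hfφ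
      (fun x _ => hf.differentiable one_ne_zero x)
      (fun x _ => hφ.differentiable one_ne_zero x)).symm
  simp only [dzbar, mul_add, add_mul, mul_left_comm (f _), mul_assoc]
  rw [integral_add ((hf' _).const_mul _) (((hf' _).const_mul _).const_mul _),
    integral_add ((hφ' _).const_mul _) (((hφ' _).const_mul _).const_mul _)]
  simp only [integral_const_mul, hparts]
  ring

end WirtingerCalculus

section WeightedMeasure

variable {N : ℕ} {Ω : Set (CSpace N)} {t : ℝ}

theorem weightedVolume_le (ht : 0 ≤ t) : weightedVolume Ω t ≤ volume := by
  refine le_trans ?_ (Measure.restrict_le_self (s := Ω))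
  refine (withDensity_mono (g := 1) (Eventually.of_forall fun x => ?_)).trans_eq withDensity_one
  rw [Pi.one_apply, ENNReal.ofReal_le_one, Real.exp_le_one_iff]
  exact mul_nonpos_of_nonpos_of_nonneg (neg_nonpos.2 ht) (sq_nonneg _)

theorem ae_mem_weightedVolume (hΩ : MeasurableSet Ω) : ∀ᵐ x ∂weightedVolume Ω t, x ∈ Ω :=
  (withDensity_absolutelyContinuous _ _).ae_le (ae_restrict_mem hΩ)

theorem integral_weightedVolume (Ω : Set (CSpace N)) (t : ℝ) (F : CSpace N → ℂ) :
    ∫ x, F x ∂weightedVolume Ω t = ∫ x in Ω, F x * (Real.exp (-t * ‖x‖ ^ 2) : ℝ) := by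
  rw [weightedVolume, integral_withDensity_eq_integral_toReal_smul (by fun_prop)
    (Eventually.of_forall fun x => ENNReal.ofReal_lt_top)]
  refine integral_congr_ae (Eventually.of_forall fun x => ?_)
  beta_reduce
  rw [ENNReal.toReal_ofReal (Real.exp_pos _).le, Complex.real_smul, mul_comm]

theorem memLp_weightedVolume {E : Type*} [NormedAddCommGroup E] (ht : 0 ≤ t) {f : CSpace N → E}
    (hf : Continuous f) (hc : HasCompactSupport f) : MemLp f 2 (weightedVolume Ω t) :=
  (hf.memLp_of_hasCompactSupport hc).mono_measure (weightedVolume_le ht)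

/-- `∂/∂z_k - t z̄_k`, which is minus the formal adjoint of `∂/∂z̄_k` with respect to the weight
`e^{-t|z|²}`. -/
def weightedDz (t : ℝ) (k : Fin N) (F : CSpace N → ℂ) (x : CSpace N) : ℂ :=
  dz k F x - t * conj (x k) * F x

variable {F : CSpace N → ℂ}

theorem continuous_weightedDz (t : ℝ) (k : Fin N) (hF : ContDiff ℝ 1 F) :
    Continuous (weightedDz t k F) :=
  (contDiff_dz hF (m := 0) (by simp) k).continuous.sub
    ((continuous_const.mul (by fun_prop)).mul hF.continuous)

theorem weightedDz_eq_zero_of_notMem_tsupport (t : ℝ) (k : Fin N) {x : CSpace N}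
    (hx : x ∉ tsupport F) : weightedDz t k F x = 0 := by
  rw [weightedDz, dz_eq_zero_of_notMem_tsupport hx, image_eq_zero_of_notMem_tsupport hx, mul_zero,
    sub_zero]

theorem dzbar_conj_mul_weight (t : ℝ) (k : Fin N) {x : CSpace N} (hF : DifferentiableAt ℝ F x) :
    dzbar k (fun y => conj (F y) * (Real.exp (-t * ‖y‖ ^ 2) : ℝ)) x =
      conj (weightedDz t k F x) * (Real.exp (-t * ‖x‖ ^ 2) : ℝ) := by
  have hconj : DifferentiableAt ℝ (fun y => conj (F y)) x :=
    (Complex.conjCLE : ℂ →L[ℝ] ℂ).differentiableAt.comp x hF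
  have hweight : DifferentiableAt ℝ (fun y : CSpace N => (Real.exp (-t * ‖y‖ ^ 2) : ℂ)) x :=
    Complex.ofRealCLM.differentiableAt.comp x
      (((hasFDerivAt_id x).norm_sq.differentiableAt.const_mul (-t)).exp)
  rw [dzbar_mul hconj hweight, dzbar_conj hF, dzbar_weight]
  simp only [weightedDz, map_sub, map_mul, Complex.conj_conj, Complex.conj_ofReal]
  ring

end WeightedMeasure

section Contraction

variable {N p q : ℕ}

/-- The increasing multi-indices of length `q`. -/
abbrev MultiIndex (N q : ℕ) : Type := {J : Finset (Fin N) // J.card = q}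

theorem conj_wedgeSign (k : Fin N) (J K : Finset (Fin N)) :
    conj (wedgeSign k J K) = wedgeSign k J K := by
  unfold wedgeSign
  split_ifs <;> simp

/-- Exterior multiplication `v ↦ (∑ a_k dz̄_k) ∧ v` of `(0,p)`-forms, with values in the
`(0,q)`-forms (it is zero unless `q = p + 1`). -/
def wedge (q : ℕ) : CSpace N →L[ℂ] Forms N p →L[ℂ] Forms N q :=
  (LinearMap.mk₂ ℂ (fun (a : CSpace N) (v : Forms N p) => (WithLp.toLp 2 fun K : MultiIndex N q =>
      ∑ J : MultiIndex N p, ∑ k, wedgeSign k J.1 K.1 * (a k * v J) : Forms N q))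
    (fun _ _ _ => by ext K; simp [add_mul, mul_add, Finset.sum_add_distrib])
    (fun _ _ _ => by ext K; simp [Finset.mul_sum, mul_left_comm, mul_assoc])
    (fun _ _ _ => by ext K; simp [mul_add, Finset.sum_add_distrib])
    (fun _ _ _ => by ext K; simp [Finset.mul_sum, mul_left_comm])).toContinuousBilinearMap

theorem wedge_apply (a : CSpace N) (v : Forms N p) (K : MultiIndex N q) :
    wedge q a v K = ∑ J : MultiIndex N p, ∑ k, wedgeSign k J.1 K.1 * (a k * v J) :=
  rfl

/-- Contraction of `(0,q)`-forms with the vector `∑ a_k ∂/∂z̄_k`, with values in the `(0,p)`-forms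
(it is zero unless `q = p + 1`). -/
def contract (p : ℕ) : CSpace N →L[ℂ] Forms N q →L[ℂ] Forms N p :=
  (LinearMap.mk₂ ℂ (fun (a : CSpace N) (v : Forms N q) => (WithLp.toLp 2 fun J : MultiIndex N p =>
      ∑ K : MultiIndex N q, ∑ k, wedgeSign k J.1 K.1 * (a k * v K) : Forms N p))
    (fun _ _ _ => by ext K; simp [add_mul, mul_add, Finset.sum_add_distrib])
    (fun _ _ _ => by ext K; simp [Finset.mul_sum, mul_left_comm, mul_assoc])
    (fun _ _ _ => by ext K; simp [mul_add, Finset.sum_add_distrib])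
    (fun _ _ _ => by ext K; simp [Finset.mul_sum, mul_left_comm])).toContinuousBilinearMap

theorem contract_apply (a : CSpace N) (v : Forms N q) (J : MultiIndex N p) :
    contract p a v J = ∑ K : MultiIndex N q, ∑ k, wedgeSign k J.1 K.1 * (a k * v K) :=
  rfl

end Contraction

section SmoothForms

variable {N p q : ℕ} {t : ℝ} {x : CSpace N}

/-- The vector of the derivatives `∂g/∂z_k`. -/
def gradZ (g : CSpace N → ℂ) (x : CSpace N) : CSpace N := WithLp.toLp 2 fun k => dz k g x

/-- The vector of the derivatives `∂g/∂z̄_k`. -/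
def gradZbar (g : CSpace N → ℂ) (x : CSpace N) : CSpace N := WithLp.toLp 2 fun k => dzbar k g x

/-- The pointwise `∂̄` of a smooth form. -/
def dbarForm (q : ℕ) (f : CSpace N → Forms N p) (x : CSpace N) : Forms N q :=
  WithLp.toLp 2 fun K => ∑ J : MultiIndex N p, ∑ k,
    wedgeSign k J.1 K.1 * dzbar k (fun y => f y J) x

/-- The formal adjoint of `∂̄` with respect to the weight `e^{-t|z|²}`. -/
def dbarStarForm (p : ℕ) (t : ℝ) (f : CSpace N → Forms N q) (x : CSpace N) : Forms N p :=
  WithLp.toLp 2 fun J => -∑ K : MultiIndex N q, ∑ k,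
    wedgeSign k J.1 K.1 * weightedDz t k (fun y => f y K) x

theorem contDiff_coord {m : WithTop ℕ∞} {f : CSpace N → Forms N p} (hf : ContDiff ℝ m f)
    (J : MultiIndex N p) : ContDiff ℝ m fun y => f y J :=
  ((EuclideanSpace.proj J : Forms N p →L[ℂ] ℂ).restrictScalars ℝ).contDiff.comp hf

theorem tsupport_coord_subset (f : CSpace N → Forms N p) (J : MultiIndex N p) :
    tsupport (fun y => f y J) ⊆ tsupport f :=
  closure_mono fun x hx h => hx (by simp [h])

theorem hasCompactSupport_coord {f : CSpace N → Forms N p} (hc : HasCompactSupport f)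
    (J : MultiIndex N p) : HasCompactSupport fun y => f y J :=
  hc.mono' ((subset_tsupport _).trans (tsupport_coord_subset f J))

theorem continuous_toLp_forms {f : CSpace N → MultiIndex N p → ℂ}
    (hf : ∀ J, Continuous fun x => f x J) :
    Continuous fun x => (WithLp.toLp 2 (f x) : Forms N p) :=
  (PiLp.continuous_toLp 2 _).comp (continuous_pi hf)

theorem continuous_dbarForm {f : CSpace N → Forms N p} (hf : ContDiff ℝ 1 f) :
    Continuous (dbarForm q f) :=
  continuous_toLp_forms fun _ => continuous_finsetSum _ fun J _ => continuous_finsetSum _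
    fun k _ => continuous_const.mul
      (contDiff_dzbar (contDiff_coord hf J) (m := 0) (by simp) k).continuous

theorem continuous_dbarStarForm {f : CSpace N → Forms N q} (t : ℝ) (hf : ContDiff ℝ 1 f) :
    Continuous (dbarStarForm p t f) :=
  continuous_toLp_forms fun _ => Continuous.neg <| continuous_finsetSum _ fun K _ =>
    continuous_finsetSum _ fun k _ => continuous_const.mul
      (continuous_weightedDz t k (contDiff_coord hf K))

theorem dbarForm_eq_zero_of_notMem_tsupport {f : CSpace N → Forms N p} (hx : x ∉ tsupport f) :
    dbarForm q f x = 0 := by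
  ext K
  simp only [dbarForm, PiLp.zero_apply]
  refine Finset.sum_eq_zero fun J _ => Finset.sum_eq_zero fun k _ => ?_
  rw [dzbar_eq_zero_of_notMem_tsupport fun h => hx (tsupport_coord_subset f J h), mul_zero]

theorem dbarStarForm_eq_zero_of_notMem_tsupport {f : CSpace N → Forms N q}
    (hx : x ∉ tsupport f) : dbarStarForm p t f x = 0 := by
  ext J
  simp only [dbarStarForm, PiLp.zero_apply, neg_eq_zero]
  refine Finset.sum_eq_zero fun K _ => Finset.sum_eq_zero fun k _ => ?_
  rw [weightedDz_eq_zero_of_notMem_tsupport t k fun h => hx (tsupport_coord_subset f K h),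
    mul_zero]

theorem memLp_dbarForm {Ω : Set (CSpace N)} (ht : 0 ≤ t) {f : CSpace N → Forms N p}
    (hf : ContDiff ℝ 1 f) (hc : HasCompactSupport f) :
    MemLp (dbarForm q f) 2 (weightedVolume Ω t) :=
  memLp_weightedVolume ht (continuous_dbarForm hf)
    (HasCompactSupport.intro hc fun _ => dbarForm_eq_zero_of_notMem_tsupport)

theorem memLp_dbarStarForm {Ω : Set (CSpace N)} (ht : 0 ≤ t) {f : CSpace N → Forms N q}
    (hf : ContDiff ℝ 1 f) (hc : HasCompactSupport f) :
    MemLp (dbarStarForm p t f) 2 (weightedVolume Ω t) :=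
  memLp_weightedVolume ht (continuous_dbarStarForm t hf)
    (HasCompactSupport.intro hc fun _ => dbarStarForm_eq_zero_of_notMem_tsupport)

theorem dbarForm_smul {g : CSpace N → ℂ} {f : CSpace N → Forms N p}
    (hg : DifferentiableAt ℝ g x) (hf : ∀ J, DifferentiableAt ℝ (fun y => f y J) x) :
    dbarForm q (fun y => g y • f y) x = wedge q (gradZbar g x) (f x) + g x • dbarForm q f x := by
  ext K
  simp only [dbarForm, PiLp.smul_apply, PiLp.add_apply, smul_eq_mul, wedge_apply, gradZbar,
    Finset.mul_sum, ← Finset.sum_add_distrib]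
  refine Finset.sum_congr rfl fun J _ => Finset.sum_congr rfl fun k _ => ?_
  rw [dzbar_mul hg (hf J)]
  ring

theorem dbarStarForm_smul {g : CSpace N → ℂ} {f : CSpace N → Forms N q}
    (hg : DifferentiableAt ℝ g x) (hf : ∀ J, DifferentiableAt ℝ (fun y => f y J) x) :
    dbarStarForm p t (fun y => g y • f y) x =
      g x • dbarStarForm p t f x - contract p (gradZ g x) (f x) := by
  ext J
  simp only [dbarStarForm, PiLp.smul_apply, PiLp.sub_apply, smul_eq_mul, contract_apply, gradZ,
    mul_neg, Finset.mul_sum, ← neg_add', neg_inj, ← Finset.sum_add_distrib]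
  refine Finset.sum_congr rfl fun K _ => Finset.sum_congr rfl fun k _ => ?_
  rw [weightedDz, weightedDz, dz_mul hg (hf K)]
  ring

theorem isDbar_dbarForm {Ω : Set (CSpace N)} (ht : 0 ≤ t) {f : CSpace N → Forms N p}
    (hf : ContDiff ℝ 1 f) (hc : HasCompactSupport f) : IsDbar Ω t f (dbarForm q f) := by
  refine ⟨memLp_weightedVolume ht hf.continuous hc, memLp_dbarForm ht hf hc, ?_⟩
  intro φ hφ hφc hφΩ K
  replace hφ : ContDiff ℝ 1 φ := hφ.of_le (by exact_mod_cast le_top)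
  rw [setIntegral_eq_integral_of_forall_compl_eq_zero fun x hx => by
      rw [image_eq_zero_of_notMem_tsupport fun h => hx (hφΩ h), mul_zero],
    setIntegral_eq_integral_of_forall_compl_eq_zero fun x hx =>
      Finset.sum_eq_zero fun J _ => Finset.sum_eq_zero fun k _ => by
        rw [dzbar_eq_zero_of_notMem_tsupport fun h => hx (hφΩ h), mul_zero]]
  have hfφ (J : MultiIndex N p) (k : Fin N) :
      Integrable fun x => wedgeSign k J.1 K.1 * (dzbar k (fun y => f y J) x * φ x) :=
    (((contDiff_dzbar (contDiff_coord hf J) (m := 0) (by simp) k).continuous.mul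
      hφ.continuous).integrable_of_hasCompactSupport hφc.mul_left).const_mul _
  have hfφ' (J : MultiIndex N p) (k : Fin N) :
      Integrable fun x => wedgeSign k J.1 K.1 * (f x J * dzbar k φ x) :=
    (((contDiff_coord hf J).continuous.mul (contDiff_dzbar hφ (m := 0) (by simp)
      k).continuous).integrable_of_hasCompactSupport
        (hasCompactSupport_coord hc J).mul_right).const_mul _
  simp only [dbarForm, Finset.sum_mul, mul_assoc]
  rw [integral_finsetSum _ fun J _ => integrable_finsetSum _ fun k _ => hfφ J k,
    integral_finsetSum _ fun J _ => integrable_finsetSum _ fun k _ => hfφ' J k,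
    ← Finset.sum_neg_distrib]
  refine Finset.sum_congr rfl fun J _ => ?_
  rw [integral_finsetSum _ fun k _ => hfφ J k, integral_finsetSum _ fun k _ => hfφ' J k,
    ← Finset.sum_neg_distrib]
  refine Finset.sum_congr rfl fun k _ => ?_
  rw [integral_const_mul, integral_const_mul, integral_dzbar_mul (contDiff_coord hf J) hφ hφc,
    mul_neg]

end SmoothForms

section AdjointDomain

variable {N p q : ℕ} {t : ℝ} {Ω : Set (CSpace N)}

theorem integral_mul_conj_of_isDbar {g : CSpace N → Forms N p} {u : CSpace N → Forms N q}
    (hgu : IsDbar Ω t g u) {F : CSpace N → ℂ} (hF : ContDiff ℝ ∞ F) (hc : HasCompactSupport F)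
    (hFΩ : tsupport F ⊆ Ω) (K : MultiIndex N q) :
    ∫ x, u x K * conj (F x) ∂weightedVolume Ω t =
      -∫ x, ∑ J : MultiIndex N p, ∑ k,
        wedgeSign k J.1 K.1 * (g x J * conj (weightedDz t k F x)) ∂weightedVolume Ω t := by
  have hweight : ContDiff ℝ ∞ fun x : CSpace N => (Real.exp (-t * ‖x‖ ^ 2) : ℂ) :=
    Complex.ofRealCLM.contDiff.comp
      (Real.contDiff_exp.comp (contDiff_const.mul (contDiff_id.norm_sq ℝ)))
  have hsupport : tsupport (fun x => conj (F x) * (Real.exp (-t * ‖x‖ ^ 2) : ℂ)) ⊆ tsupport F :=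
    closure_mono fun x (hx : _ ≠ _) (h : F x = 0) => hx (by simp [h])
  have htest := hgu.2.2 (fun x => conj (F x) * (Real.exp (-t * ‖x‖ ^ 2) : ℝ))
    (((Complex.conjCLE : ℂ →L[ℝ] ℂ).contDiff.comp hF).mul hweight)
    (hc.comp_left (g := fun z : ℂ => conj z) (map_zero _)).mul_right
    (hsupport.trans hFΩ) K
  rw [integral_weightedVolume, integral_weightedVolume]
  simp only [← mul_assoc] at htest ⊢
  rw [htest]
  congr 1
  refine integral_congr_ae (Eventually.of_forall fun x => ?_)
  simp only [Finset.sum_mul]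
  refine Finset.sum_congr rfl fun J _ => Finset.sum_congr rfl fun k _ => ?_
  rw [dzbar_conj_mul_weight t k (hF.differentiable (by simp) x)]
  ring

theorem integral_inner_of_isDbar (ht : 0 ≤ t) {g : CSpace N → Forms N p}
    {u : CSpace N → Forms N q} (hgu : IsDbar Ω t g u) {f : CSpace N → Forms N q}
    (hf : ContDiff ℝ ∞ f) (hc : HasCompactSupport f) (hfΩ : tsupport f ⊆ Ω) :
    ∫ x, inner ℂ (f x) (u x) ∂weightedVolume Ω t =
      ∫ x, inner ℂ (dbarStarForm p t f x) (g x) ∂weightedVolume Ω t := by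
  have hconj {h : CSpace N → ℂ} (hcont : Continuous h) (hcomp : HasCompactSupport h) :
      MemLp (fun x => conj (h x)) 2 (weightedVolume Ω t) :=
    memLp_weightedVolume ht (Complex.continuous_conj.comp hcont) (hcomp.comp_left (map_zero _))
  have hcoord (K : MultiIndex N q) : ContDiff ℝ 1 fun x => f x K :=
    (contDiff_coord hf K).of_le (by exact_mod_cast le_top)
  have huf (K : MultiIndex N q) :
      Integrable (fun x => u x K * conj (f x K)) (weightedVolume Ω t) :=
    (hgu.2.1.eval_piLp K).integrable_mul
      (hconj (hcoord K).continuous (hasCompactSupport_coord hc K))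
  have hgf (K : MultiIndex N q) : Integrable (fun x => ∑ J : MultiIndex N p, ∑ k,
      wedgeSign k J.1 K.1 * (g x J * conj (weightedDz t k (fun y => f y K) x)))
      (weightedVolume Ω t) :=
    integrable_finsetSum _ fun J _ => integrable_finsetSum _ fun k _ =>
      ((hgu.1.eval_piLp J).integrable_mul <| hconj (continuous_weightedDz t k (hcoord K)) <|
        HasCompactSupport.intro (hasCompactSupport_coord hc K) fun _ =>
          weightedDz_eq_zero_of_notMem_tsupport t k).const_mul _
  have hcomp (K : MultiIndex N q) := integral_mul_conj_of_isDbar hgu (contDiff_coord hf K)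
    (hasCompactSupport_coord hc K) ((tsupport_coord_subset f K).trans hfΩ) K
  simp only [PiLp.inner_apply, RCLike.inner_apply]
  rw [integral_finsetSum _ fun K _ => huf K]
  simp only [hcomp]
  rw [Finset.sum_neg_distrib, ← integral_finsetSum _ fun K _ => hgf K, ← integral_neg]
  refine integral_congr_ae (Eventually.of_forall fun x => ?_)
  simp only [dbarStarForm, map_neg, map_sum, map_mul, conj_wedgeSign, mul_neg, Finset.mul_sum,
    Finset.sum_neg_distrib, mul_left_comm]
  rw [Finset.sum_comm]

/-- A smooth cutoff of the negative half line: it vanishes for `s ≥ -1/(m+1)` and equals `1` for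
`s ≤ -2/(m+1)`. Composed with a defining function it localizes to the interior of the domain. -/
def negCutoff (m : ℕ) (s : ℝ) : ℝ := Real.smoothTransition (-(m + 1) * s - 1)

theorem contDiff_negCutoff (m : ℕ) : ContDiff ℝ ∞ (negCutoff m) :=
  Real.smoothTransition.contDiff.comp ((contDiff_const.mul contDiff_id).sub contDiff_const)

theorem norm_ofReal_negCutoff_le (m : ℕ) (s : ℝ) : ‖(negCutoff m s : ℂ)‖ ≤ 1 := by
  rw [Complex.norm_real, negCutoff, Real.norm_of_nonneg (Real.smoothTransition.nonneg _)]
  exact Real.smoothTransition.le_one _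

theorem tsupport_negCutoff_comp_subset {r : CSpace N → ℝ} (hr : Continuous r) (m : ℕ) :
    tsupport (fun x => negCutoff m (r x)) ⊆ {x | r x < 0} := by
  have hm : (0 : ℝ) < m + 1 := by positivity
  have hsub : tsupport (fun x => negCutoff m (r x)) ⊆ {x | (m + 1) * r x ≤ -1} := by
    refine closure_minimal (fun x hx => ?_) (isClosed_le (by fun_prop) continuous_const)
    by_contra hx'
    have hlt : -1 < (m + 1) * r x := not_le.1 hx'
    exact hx (Real.smoothTransition.zero_of_nonpos (by linarith))
  intro x hx
  have h : (m + 1) * r x ≤ -1 := hsub hx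
  exact neg_of_mul_neg_right (h.trans_lt (by norm_num)) hm.le

theorem tendsto_integral_negCutoff_mul {r : CSpace N → ℝ} (hr : Continuous r)
    {μ : Measure (CSpace N)} (hμ : ∀ᵐ x ∂μ, r x < 0) {G : CSpace N → ℂ} (hG : Integrable G μ) :
    Tendsto (fun m : ℕ => ∫ x, negCutoff m (r x) * G x ∂μ) atTop (𝓝 (∫ x, G x ∂μ)) := by
  refine tendsto_integral_of_dominated_convergence (fun x => ‖G x‖) (fun m => ?_) hG.norm
    (fun m => Eventually.of_forall fun x => ?_) ?_
  · exact (Complex.continuous_ofReal.comp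
      ((contDiff_negCutoff m).continuous.comp hr)).aestronglyMeasurable.mul hG.1
  · rw [norm_mul]
    exact mul_le_of_le_one_left (norm_nonneg _) (norm_ofReal_negCutoff_le _ _)
  · filter_upwards [hμ] with x hx
    refine tendsto_const_nhds.congr' ?_
    obtain ⟨M, hM⟩ := exists_nat_gt (2 / (-r x))
    filter_upwards [eventually_ge_atTop M] with m hm
    have hmr : 2 ≤ (m : ℝ) * (-r x) :=
      ((div_lt_iff₀ (neg_pos.2 hx)).1 (hM.trans_le (by exact_mod_cast hm))).le
    have : negCutoff m (r x) = 1 := Real.smoothTransition.one_of_one_le (by linarith)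
    rw [this, Complex.ofReal_one, one_mul]

theorem dbarStarForm_negCutoff_smul {r : CSpace N → ℝ} {f : CSpace N → Forms N q} {x : CSpace N}
    (hr : DifferentiableAt ℝ r x) (hf : ∀ K, DifferentiableAt ℝ (fun y => f y K) x)
    (htan : contract p (gradZ (fun y => (r y : ℂ)) x) (f x) = 0) (m : ℕ) :
    dbarStarForm p t (fun y => (negCutoff m (r y) : ℂ) • f y) x =
      (negCutoff m (r x) : ℂ) • dbarStarForm p t f x := by
  have hcut : DifferentiableAt ℝ (negCutoff m) (r x) :=
    (contDiff_negCutoff m).differentiable (by simp) _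
  have hgrad : gradZ (fun y => (negCutoff m (r y) : ℂ)) x =
      ((deriv (negCutoff m) (r x) : ℝ) : ℂ) • gradZ (fun y => (r y : ℂ)) x := by
    ext k
    exact dz_ofReal_comp hr hcut k
  have hcomp : DifferentiableAt ℝ (fun y => (negCutoff m (r y) : ℂ)) x :=
    Complex.ofRealCLM.differentiableAt.comp x (hcut.comp x hr)
  rw [dbarStarForm_smul hcomp hf, hgrad, map_smul, smul_apply, htan, smul_zero, sub_zero]

theorem integral_negCutoff_mul_inner_of_isDbar {r : CSpace N → ℝ} (hr : ContDiff ℝ ∞ r)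
    (hΩ : Ω = {x | r x < 0}) (ht : 0 ≤ t) {f : CSpace N → Forms N q} (hf : ContDiff ℝ ∞ f)
    (hc : HasCompactSupport f)
    (htan : ∀ x, contract p (gradZ (fun y => (r y : ℂ)) x) (f x) = 0) {g : CSpace N → Forms N p}
    {u : CSpace N → Forms N q} (hgu : IsDbar Ω t g u) (m : ℕ) :
    ∫ x, negCutoff m (r x) * inner ℂ (f x) (u x) ∂weightedVolume Ω t =
      ∫ x, negCutoff m (r x) * inner ℂ (dbarStarForm p t f x) (g x) ∂weightedVolume Ω t := by
  have hcut : ContDiff ℝ ∞ fun x => (negCutoff m (r x) : ℂ) :=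
    Complex.ofRealCLM.contDiff.comp ((contDiff_negCutoff m).comp hr)
  have hsupport : tsupport (fun x => (negCutoff m (r x) : ℂ) • f x) ⊆ Ω := by
    rw [hΩ]
    refine (closure_mono ?_).trans (tsupport_negCutoff_comp_subset hr.continuous m)
    exact fun x (hx : _ ≠ _) (h : negCutoff m (r x) = 0) => hx (by simp [h])
  have hsmul : ContDiff ℝ ∞ fun x => (negCutoff m (r x) : ℂ) • f x := hcut.smul hf
  have hcs : HasCompactSupport fun x => (negCutoff m (r x) : ℂ) • f x :=
    hc.mono fun x (hx : _ ≠ _) (h : f x = 0) => hx (by simp [h])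
  have h := integral_inner_of_isDbar ht hgu hsmul hcs hsupport
  have hstar (x : CSpace N) := dbarStarForm_negCutoff_smul (t := t)
    (hr.differentiable (by simp) x) (fun K => (contDiff_coord hf K).differentiable (by simp) x)
    (htan x) m
  simpa only [hstar, inner_smul_left, Complex.conj_ofReal] using h

theorem isDbarStar_dbarStarForm {r : CSpace N → ℝ} (hr : ContDiff ℝ ∞ r)
    (hΩ : Ω = {x | r x < 0}) (ht : 0 ≤ t) {f : CSpace N → Forms N q} (hf : ContDiff ℝ ∞ f)
    (hc : HasCompactSupport f)
    (htan : ∀ x, contract p (gradZ (fun y => (r y : ℂ)) x) (f x) = 0) :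
    IsDbarStar Ω t f (dbarStarForm p t f) := by
  have hfL : MemLp f 2 (weightedVolume Ω t) := memLp_weightedVolume ht hf.continuous hc
  have hvL : MemLp (dbarStarForm p t f) 2 (weightedVolume Ω t) :=
    memLp_dbarStarForm ht (hf.of_le (by exact_mod_cast le_top)) hc
  refine ⟨hfL, hvL, fun g u hgu => ?_⟩
  have hneg : ∀ᵐ x ∂weightedVolume Ω t, r x < 0 := by
    subst hΩ
    exact ae_mem_weightedVolume (isOpen_lt hr.continuous continuous_const).measurableSet
  have hlim {v : ℕ} {a b : CSpace N → Forms N v} (ha : MemLp a 2 (weightedVolume Ω t))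
      (hb : MemLp b 2 (weightedVolume Ω t)) :=
    tendsto_integral_negCutoff_mul hr.continuous hneg <|
      (ha.norm.integrable_mul hb.norm).mono' (ha.1.inner hb.1)
        (Eventually.of_forall fun x => norm_inner_le_norm _ _)
  have hcut := integral_negCutoff_mul_inner_of_isDbar hr hΩ ht hf hc htan hgu
  exact tendsto_nhds_unique (hlim hfL hgu.2.1) (by simpa only [hcut] using hlim hvL hgu.1)

end AdjointDomain

section ContractionAlgebra

variable {N p q r : ℕ}

theorem card_filter_insert_lt {k m : Fin N} {K : Finset (Fin N)} (hk : k ∉ K) :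
    ((insert k K).filter (· < m)).card = (K.filter (· < m)).card + if k < m then 1 else 0 := by
  rw [Finset.filter_insert]
  split_ifs with h
  · rw [Finset.card_insert_of_notMem (by simp [hk])]
  · rw [add_zero]

theorem wedgeSign_insert {k : Fin N} {J : Finset (Fin N)} (hk : k ∉ J) :
    wedgeSign k J (insert k J) = (-1) ^ (J.filter (· < k)).card :=
  if_pos ⟨hk, rfl⟩

theorem wedgeSign_of_mem {k : Fin N} {J : Finset (Fin N)} (hk : k ∈ J) (K : Finset (Fin N)) :
    wedgeSign k J K = 0 :=
  if_neg fun h => h.1 hk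

theorem wedgeSign_of_insert_ne {k : Fin N} {J K : Finset (Fin N)} (h : insert k J ≠ K) :
    wedgeSign k J K = 0 :=
  if_neg fun h' => h h'.2

theorem wedgeSign_mul_wedgeSign_anticomm (k m : Fin N) (K L : Finset (Fin N)) :
    wedgeSign k K (insert k K) * wedgeSign m (insert k K) L =
      -(wedgeSign m K (insert m K) * wedgeSign k (insert m K) L) := by
  by_cases hk : k ∈ K
  · rw [wedgeSign_of_mem hk, wedgeSign_of_mem (Finset.mem_insert_of_mem hk), zero_mul, mul_zero,
      neg_zero]
  by_cases hm : m ∈ K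
  · rw [wedgeSign_of_mem hm, wedgeSign_of_mem (Finset.mem_insert_of_mem hm), zero_mul, mul_zero,
      neg_zero]
  obtain rfl | hkm := eq_or_ne k m
  · rw [wedgeSign_of_mem (Finset.mem_insert_self k K), mul_zero, neg_zero]
  by_cases hL : insert m (insert k K) = L
  · have hmk : m ∉ insert k K := by simp [hm, hkm.symm]
    have hkm' : k ∉ insert m K := by simp [hk, hkm]
    rw [← hL, wedgeSign_insert hk, wedgeSign_insert hm, wedgeSign_insert hmk,
      Finset.insert_comm m k K, wedgeSign_insert hkm', card_filter_insert_lt hk,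
      card_filter_insert_lt hm]
    rcases hkm.lt_or_gt with h | h <;> simp only [h, h.not_gt, if_true, if_false] <;> ring
  · have hL' : insert k (insert m K) ≠ L := by rwa [Finset.insert_comm]
    rw [wedgeSign_of_insert_ne hL, wedgeSign_of_insert_ne hL', mul_zero, mul_zero, neg_zero]

theorem sum_wedgeSign_mul (k : Fin N) (K : MultiIndex N p) (c : Finset (Fin N) → ℂ) :
    ∑ J : MultiIndex N (p + 1), wedgeSign k K.1 J.1 * c J.1 =
      wedgeSign k K.1 (insert k K.1) * c (insert k K.1) := by
  by_cases hk : k ∈ K.1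
  · simp only [wedgeSign_of_mem hk, zero_mul, Finset.sum_const_zero]
  · have hcard : (insert k K.1).card = p + 1 := by rw [Finset.card_insert_of_notMem hk, K.2]
    refine Finset.sum_eq_single (⟨insert k K.1, hcard⟩ : MultiIndex N (p + 1)) ?_
      (fun h => absurd (Finset.mem_univ _) h)
    intro J _ hJ
    rw [wedgeSign_of_insert_ne fun h => hJ (Subtype.ext h.symm), zero_mul]

theorem contract_eq_zero (hq : q ≠ p + 1) (a : CSpace N) (v : Forms N q) : contract p a v = 0 := by
  ext J
  rw [contract_apply, PiLp.zero_apply]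
  refine Finset.sum_eq_zero fun K _ => Finset.sum_eq_zero fun k _ => ?_
  rw [wedgeSign, if_neg, zero_mul]
  rintro ⟨hk, hK⟩
  exact hq (by rw [← K.2, ← hK, Finset.card_insert_of_notMem hk, J.2])

theorem contract_contract_succ_apply (a : CSpace N) (v : Forms N r) (J : MultiIndex N p) :
    contract p a (contract (p + 1) a v) J = ∑ L : MultiIndex N r, ∑ k, ∑ m, (a k * a m * v L) *
      (wedgeSign k J.1 (insert k J.1) * wedgeSign m (insert k J.1) L.1) := by
  have hsum (L : MultiIndex N r) (k m : Fin N) := sum_wedgeSign_mul k J (wedgeSign m · L.1)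
  simp only [contract_apply, ← hsum, Finset.mul_sum]
  rw [Finset.sum_comm]
  simp only [Finset.sum_comm (s := (Finset.univ : Finset (MultiIndex N (p + 1))))
    (t := (Finset.univ : Finset (MultiIndex N r)))]
  rw [Finset.sum_comm]
  refine Finset.sum_congr rfl fun L _ => Finset.sum_congr rfl fun k _ => ?_
  rw [Finset.sum_comm]
  refine Finset.sum_congr rfl fun m _ => Finset.sum_congr rfl fun K _ => ?_
  ring

theorem contract_contract (a : CSpace N) (v : Forms N r) :
    contract p a (contract q a v) = 0 := by
  obtain rfl | hq := eq_or_ne q (p + 1)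
  · ext J
    rw [contract_contract_succ_apply, PiLp.zero_apply]
    refine Finset.sum_eq_zero fun L _ => self_eq_neg.1 ?_
    conv_rhs => rw [Finset.sum_comm]
    simp only [← Finset.sum_neg_distrib]
    refine Finset.sum_congr rfl fun k _ => Finset.sum_congr rfl fun m _ => ?_
    rw [wedgeSign_mul_wedgeSign_anticomm]
    ring
  · exact contract_eq_zero hq a _

theorem norm_le_norm_contract_single (a : CSpace N) (K : MultiIndex N (q + 1)) {m : Fin N}
    (hm : m ∈ K.1) : ‖a m‖ ≤ ‖contract q a (EuclideanSpace.single K 1)‖ := by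
  have hcard : (K.1.erase m).card = q := by
    rw [Finset.card_erase_of_mem hm, K.2, add_tsub_cancel_right]
  have hsign : ‖wedgeSign m (K.1.erase m) K.1‖ = 1 := by
    rw [wedgeSign, if_pos ⟨Finset.notMem_erase m K.1, Finset.insert_erase hm⟩]
    simp
  have hcoef : contract q a (EuclideanSpace.single K 1) ⟨K.1.erase m, hcard⟩ =
      wedgeSign m (K.1.erase m) K.1 * a m := by
    rw [contract_apply, Finset.sum_eq_single K (fun L _ hL => by simp [hL]) (by simp),
      Finset.sum_eq_single m (fun k _ hk => ?_) (by simp)]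
    · simp
    · refine mul_eq_zero_of_left (wedgeSign_of_insert_ne fun h => ?_) _
      have hmk : m ∈ insert k (K.1.erase m) := by rwa [h]
      simp [hk.symm] at hmk
  refine le_trans (le_of_eq ?_) (PiLp.norm_apply_le _ ⟨K.1.erase m, hcard⟩)
  rw [hcoef, norm_mul, hsign, one_mul]

end ContractionAlgebra

section TangentialForms

/-- Complex conjugation of the coordinates. -/
def conjVec {N : ℕ} : CSpace N ≃ₗᵢ[ℝ] CSpace N :=
  LinearIsometryEquiv.piLpCongrRight 2 fun _ => Complex.conjLIE

theorem conjVec_apply {N : ℕ} (x : CSpace N) (k : Fin N) : conjVec x k = conj (x k) :=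
  rfl

theorem conjVec_I_smul {N : ℕ} (x : CSpace N) :
    conjVec (Complex.I • x) = -(Complex.I • conjVec x) := by
  ext k
  simp [conjVec_apply]

theorem gradZ_ofReal_of_hasFDerivAt {N : ℕ} {r : CSpace N → ℝ} {G x : CSpace N}
    (h : HasFDerivAt r (innerSL ℝ G) x) :
    gradZ (fun y => (r y : ℂ)) x = (1 / 2 : ℝ) • conjVec G := by
  ext k
  simp only [gradZ, dz]
  rw [fderiv_ofReal_apply h.differentiableAt, fderiv_ofReal_apply h.differentiableAt,
    h.fderiv, innerSL_apply_apply, innerSL_apply_apply, real_inner_single, real_inner_single]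
  apply Complex.ext <;> simp [conjVec_apply]

variable {n p q r : ℕ}

/-- The vector of the derivatives `∂r/∂z_k` of `r = |z|² - Im w`. -/
def siegelNormal (x : CSpace (n + 1)) : CSpace (n + 1) := (1 / 2 : ℝ) • conjVec (siegelGrad x)

theorem siegelNormal_castSucc (x : CSpace (n + 1)) (l : Fin n) :
    siegelNormal x l.castSucc = conj (x l.castSucc) := by
  simp [siegelNormal, conjVec_apply, siegelGrad, imVec, (Fin.castSucc_lt_last l).ne]

theorem siegelNormal_last (x : CSpace (n + 1)) :
    siegelNormal x (Fin.last n) = Complex.I / 2 := by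
  simp [siegelNormal, conjVec_apply, siegelGrad, imVec]
  ring

theorem gradZ_siegelFun (x : CSpace (n + 1)) :
    gradZ (fun y => (siegelFun y : ℂ)) x = siegelNormal x :=
  gradZ_ofReal_of_hasFDerivAt (hasFDerivAt_siegelFun x)

theorem norm_siegelNormal_sq (x : CSpace (n + 1)) :
    ‖siegelNormal x‖ ^ 2 = 1 / 4 + zNormSq x := by
  rw [siegelNormal, norm_smul, mul_pow, LinearIsometryEquiv.norm_map, norm_siegelGrad_sq]
  norm_num
  ring

/-- The conjugate-linear part of the affine map `siegelNormal`. -/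
def siegelNormalDeriv (n : ℕ) : CSpace (n + 1) →L[ℝ] CSpace (n + 1) :=
  conjVec.toContinuousLinearEquiv.toContinuousLinearMap ∘L (zPart n).restrictScalars ℝ

theorem siegelNormalDeriv_I_smul (w : CSpace (n + 1)) :
    siegelNormalDeriv n (Complex.I • w) = -(Complex.I • siegelNormalDeriv n w) := by
  simp [siegelNormalDeriv, conjVec_I_smul]

theorem siegelNormal_eq (x : CSpace (n + 1)) :
    siegelNormal x = siegelNormalDeriv n x - (1 / 2 : ℝ) • conjVec (imVec n) := by
  simp [siegelNormal, siegelGrad, siegelNormalDeriv, smul_sub, smul_smul]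

theorem hasFDerivAt_siegelNormal (x : CSpace (n + 1)) :
    HasFDerivAt siegelNormal (siegelNormalDeriv n) x :=
  ((siegelNormalDeriv n).hasFDerivAt.sub_const _).congr_of_eventuallyEq
    (Eventually.of_forall siegelNormal_eq)

theorem contDiff_siegelNormal {m : WithTop ℕ∞} : ContDiff ℝ m (siegelNormal (n := n)) := by
  rw [funext siegelNormal_eq]
  exact (siegelNormalDeriv n).contDiff.sub contDiff_const

/-- The forms `g (∂r ⌟ e)`, with `e` a constant form, which lie in the domain of the
adjoint of `∂̄` because contracting twice with `∂r` gives zero. -/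
def tangForm (q : ℕ) (e : Forms (n + 1) r) (g : CSpace (n + 1) → ℂ) (x : CSpace (n + 1)) :
    Forms (n + 1) q :=
  g x • contract q (siegelNormal x) e

variable {e : Forms (n + 1) r} {g : CSpace (n + 1) → ℂ} {x : CSpace (n + 1)}

theorem hasFDerivAt_contract_siegelNormal_apply (e : Forms (n + 1) r) (x : CSpace (n + 1))
    (J : MultiIndex (n + 1) q) :
    HasFDerivAt (fun y => contract q (siegelNormal y) e J)
      (((EuclideanSpace.proj J ∘L (contract q).flip e).restrictScalars ℝ) ∘L
        siegelNormalDeriv n) x :=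
  ((EuclideanSpace.proj J ∘L (contract q).flip e).restrictScalars ℝ).hasFDerivAt.comp x
    (hasFDerivAt_siegelNormal x)

theorem dz_contract_siegelNormal (e : Forms (n + 1) r) (J : MultiIndex (n + 1) q)
    (k : Fin (n + 1)) (x : CSpace (n + 1)) :
    dz k (fun y => contract q (siegelNormal y) e J) x = 0 :=
  dz_eq_zero_of_hasFDerivAt_conj (hasFDerivAt_contract_siegelNormal_apply e x J)
    (fun w => by simp [siegelNormalDeriv_I_smul]) k

theorem dzbar_contract_siegelNormal (e : Forms (n + 1) r) (J : MultiIndex (n + 1) q)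
    (k : Fin (n + 1)) (x : CSpace (n + 1)) :
    dzbar k (fun y => contract q (siegelNormal y) e J) x =
      contract q (siegelNormalDeriv n (EuclideanSpace.single k 1)) e J :=
  dzbar_eq_of_hasFDerivAt_conj (hasFDerivAt_contract_siegelNormal_apply e x J)
    (fun w => by simp [siegelNormalDeriv_I_smul]) k

theorem dbarForm_contract_siegelNormal (e : Forms (n + 1) r) (x : CSpace (n + 1)) :
    dbarForm p (fun y => contract q (siegelNormal y) e) x =
      dbarForm p (fun y => contract q (siegelNormal y) e) 0 := by
  simp only [dbarForm, dzbar_contract_siegelNormal]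

theorem dbarStarForm_contract_siegelNormal (t : ℝ) (e : Forms (n + 1) r) (x : CSpace (n + 1)) :
    dbarStarForm p t (fun y => contract q (siegelNormal y) e) x =
      contract p ((t : ℂ) • conjVec x) (contract q (siegelNormal x) e) := by
  ext J
  simp only [dbarStarForm, weightedDz, dz_contract_siegelNormal, contract_apply (p := p),
    PiLp.smul_apply, conjVec_apply, smul_eq_mul, zero_sub, mul_neg, Finset.sum_neg_distrib, neg_neg]

theorem contDiff_tangForm {m : WithTop ℕ∞} (hg : ContDiff ℝ m g) :
    ContDiff ℝ m (tangForm q e g) :=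
  hg.smul ((((contract q).flip e).restrictScalars ℝ).contDiff.comp contDiff_siegelNormal)

theorem hasCompactSupport_tangForm (hc : HasCompactSupport g) :
    HasCompactSupport (tangForm q e g) :=
  hc.mono fun x (hx : _ ≠ _) (h : g x = 0) => hx (by simp [tangForm, h])

theorem isDbarStar_tangForm {t : ℝ} (ht : 0 ≤ t) (hg : ContDiff ℝ ∞ g)
    (hc : HasCompactSupport g) :
    IsDbarStar (siegel n) t (tangForm q e g) (dbarStarForm p t (tangForm q e g)) := by
  refine isDbarStar_dbarStarForm contDiff_siegelFun siegel_eq_setOf_siegelFun_neg ht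
    (contDiff_tangForm hg) (hasCompactSupport_tangForm hc) fun x => ?_
  rw [gradZ_siegelFun, tangForm, map_smul, contract_contract, smul_zero]

/-- The holomorphic gradient of `g` corrected by the multiple of `∂r` that makes its last component
vanish. -/
def tangGradZ (g : CSpace (n + 1) → ℂ) (x : CSpace (n + 1)) : CSpace (n + 1) :=
  gradZ g x + (2 * Complex.I * dz (Fin.last n) g x) • siegelNormal x

theorem tangGradZ_last (g : CSpace (n + 1) → ℂ) (x : CSpace (n + 1)) :
    tangGradZ g x (Fin.last n) = 0 := by
  simp only [tangGradZ, PiLp.add_apply, PiLp.smul_apply, smul_eq_mul, siegelNormal_last, gradZ]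
  linear_combination dz (Fin.last n) g x * Complex.I_mul_I

theorem tangGradZ_castSucc (g : CSpace (n + 1) → ℂ) (x : CSpace (n + 1)) (l : Fin n) :
    tangGradZ g x l.castSucc =
      dz l.castSucc g x + 2 * Complex.I * conj (x l.castSucc) * dz (Fin.last n) g x := by
  simp only [tangGradZ, PiLp.add_apply, PiLp.smul_apply, smul_eq_mul, siegelNormal_castSucc, gradZ]
  ring

theorem differentiableAt_contract_siegelNormal_apply (e : Forms (n + 1) r) (x : CSpace (n + 1))
    (J : MultiIndex (n + 1) q) :
    DifferentiableAt ℝ (fun y => contract q (siegelNormal y) e J) x :=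
  (hasFDerivAt_contract_siegelNormal_apply e x J).differentiableAt

theorem dbarForm_tangForm (hg : DifferentiableAt ℝ g x) :
    dbarForm p (tangForm q e g) x = wedge p (gradZbar g x) (contract q (siegelNormal x) e) +
      g x • dbarForm p (fun y => contract q (siegelNormal y) e) 0 := by
  rw [← dbarForm_contract_siegelNormal e x]
  exact dbarForm_smul hg (differentiableAt_contract_siegelNormal_apply e x)

theorem dbarStarForm_tangForm (t : ℝ) (hg : DifferentiableAt ℝ g x) :
    dbarStarForm p t (tangForm q e g) x =
      contract p ((g x * t) • conjVec x - tangGradZ g x) (contract q (siegelNormal x) e) := by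
  have h : dbarStarForm p t (tangForm q e g) x = _ :=
    dbarStarForm_smul hg (differentiableAt_contract_siegelNormal_apply e x)
  rw [h, dbarStarForm_contract_siegelNormal, tangGradZ]
  simp only [map_sub, map_add, map_smul, sub_apply, add_apply, smul_apply, contract_contract,
    smul_zero, add_zero, smul_smul]

theorem exists_norm_dbarForm_tangForm_le (p q : ℕ) (e : Forms (n + 1) r) :
    ∃ C, 0 ≤ C ∧ ∀ (g : CSpace (n + 1) → ℂ) (x : CSpace (n + 1)), DifferentiableAt ℝ g x →
      ‖dbarForm p (tangForm q e g) x‖ ≤ C * (‖gradZbar g x‖ * ‖siegelNormal x‖ + ‖g x‖) := by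
  refine ⟨‖wedge (N := n + 1) (p := q) p‖ * ‖(contract (N := n + 1) q).flip e‖ +
    ‖dbarForm p (fun y => contract q (siegelNormal y) e) 0‖, by positivity, fun g x hg => ?_⟩
  have hv : ‖contract q (siegelNormal x) e‖ ≤ ‖(contract q).flip e‖ * ‖siegelNormal x‖ :=
    ((contract q).flip e).le_opNorm _
  have hpos : 0 ≤ ‖wedge (N := n + 1) (p := q) p‖ * ‖(contract (N := n + 1) q).flip e‖ * ‖g x‖ +
    ‖dbarForm p (fun y => contract q (siegelNormal y) e) 0‖ *
      (‖gradZbar g x‖ * ‖siegelNormal x‖) := by positivity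
  rw [dbarForm_tangForm hg]
  calc _ ≤ ‖wedge (N := n + 1) (p := q) p‖ * ‖gradZbar g x‖ * ‖contract q (siegelNormal x) e‖ +
        ‖g x‖ * ‖dbarForm p (fun y => contract q (siegelNormal y) e) 0‖ :=
      norm_add_le_of_le ((wedge p).le_opNorm₂ _ _) (norm_smul_le _ _)
    _ ≤ ‖wedge (N := n + 1) (p := q) p‖ * ‖gradZbar g x‖ *
        (‖(contract q).flip e‖ * ‖siegelNormal x‖) +
        ‖g x‖ * ‖dbarForm p (fun y => contract q (siegelNormal y) e) 0‖ := by gcongr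
    _ ≤ _ := by linear_combination hpos

theorem exists_norm_dbarStarForm_tangForm_le (p q : ℕ) (e : Forms (n + 1) r) :
    ∃ C, 0 ≤ C ∧ ∀ (t : ℝ) (g : CSpace (n + 1) → ℂ) (x : CSpace (n + 1)), 0 ≤ t →
      DifferentiableAt ℝ g x → ‖dbarStarForm p t (tangForm q e g) x‖ ≤
        C * ((t * ‖x‖ * ‖g x‖ + ‖tangGradZ g x‖) * ‖siegelNormal x‖) := by
  refine ⟨‖contract (N := n + 1) (q := q) p‖ * ‖(contract (N := n + 1) q).flip e‖, by positivity,
    fun t g x ht hg => ?_⟩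
  have hv : ‖contract q (siegelNormal x) e‖ ≤ ‖(contract q).flip e‖ * ‖siegelNormal x‖ :=
    ((contract q).flip e).le_opNorm _
  have hvec : ‖(g x * t) • conjVec x - tangGradZ g x‖ ≤ t * ‖x‖ * ‖g x‖ + ‖tangGradZ g x‖ := by
    refine (norm_sub_le _ _).trans_eq ?_
    rw [norm_smul, norm_mul, Complex.norm_real, Real.norm_of_nonneg ht,
      LinearIsometryEquiv.norm_map]
    ring
  rw [dbarStarForm_tangForm t hg]
  calc _ ≤ ‖contract (N := n + 1) (q := q) p‖ * ‖(g x * t) • conjVec x - tangGradZ g x‖ *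
        ‖contract q (siegelNormal x) e‖ := (contract p).le_opNorm₂ _ _
    _ ≤ ‖contract (N := n + 1) (q := q) p‖ * (t * ‖x‖ * ‖g x‖ + ‖tangGradZ g x‖) *
        (‖(contract q).flip e‖ * ‖siegelNormal x‖) := by gcongr
    _ = _ := by ring

end TangentialForms

section TestFunctions

variable {n : ℕ}

/-- The linear part `(z, w) ↦ (z / ε, w - 2i R z_{i₀})` of `heisMap`. -/
def heisLin (i₀ : Fin n) (R ε : ℝ) : CSpace (n + 1) →L[ℂ] CSpace (n + 1) :=
  (ε : ℂ)⁻¹ • zPart n +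
    ContinuousLinearMap.smulRight
      (EuclideanSpace.proj (Fin.last n) - (2 * Complex.I * R) • EuclideanSpace.proj i₀.castSucc)
      (EuclideanSpace.single (Fin.last n) 1)

theorem heisLin_last (i₀ : Fin n) (R ε : ℝ) (v : CSpace (n + 1)) :
    heisLin i₀ R ε v (Fin.last n) = v (Fin.last n) - 2 * Complex.I * R * v i₀.castSucc := by
  simp [heisLin]

theorem zPart_heisLin (i₀ : Fin n) (R ε : ℝ) (v : CSpace (n + 1)) :
    zPart n (heisLin i₀ R ε v) = (ε : ℂ)⁻¹ • zPart n v := by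
  ext k
  refine Fin.lastCases ?_ (fun l => ?_) k <;> simp [heisLin, (Fin.castSucc_lt_last _).ne]

theorem heisLin_single_last (i₀ : Fin n) (R ε : ℝ) (a : ℂ) :
    heisLin i₀ R ε (EuclideanSpace.single (Fin.last n) a) =
      EuclideanSpace.single (Fin.last n) a := by
  ext k
  refine Fin.lastCases ?_ (fun l => ?_) k <;> simp [heisLin, (Fin.castSucc_lt_last _).ne]

theorem norm_le_norm_zPart_add (x : CSpace (n + 1)) :
    ‖x‖ ≤ ‖zPart n x‖ + ‖x (Fin.last n)‖ := by
  refine le_of_sq_le_sq ?_ (by positivity)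
  rw [norm_sq_eq_zNormSq_add, ← norm_zPart_sq, add_sq]
  have : 0 ≤ 2 * ‖zPart n x‖ * ‖x (Fin.last n)‖ := by positivity
  linarith

theorem norm_zPart_le (x : CSpace (n + 1)) : ‖zPart n x‖ ≤ ‖x‖ :=
  le_of_sq_le_sq (norm_zPart_sq x ▸ zNormSq_le_norm_sq x) (norm_nonneg _)

theorem norm_heisLin_le (i₀ : Fin n) {R ε : ℝ} (hR : 0 ≤ R) (hε : 0 < ε)
    (hRε : (1 + 2 * R) * ε ≤ 2) (v : CSpace (n + 1)) : ‖heisLin i₀ R ε v‖ ≤ 3 / ε * ‖v‖ := by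
  have hz : ‖zPart n (heisLin i₀ R ε v)‖ ≤ ε⁻¹ * ‖v‖ := by
    rw [zPart_heisLin, norm_smul, norm_inv, Complex.norm_real, Real.norm_of_nonneg hε.le]
    gcongr
    exact norm_zPart_le v
  have hw : ‖heisLin i₀ R ε v (Fin.last n)‖ ≤ (1 + 2 * R) * ‖v‖ := by
    have h2R : ‖2 * Complex.I * (R : ℂ)‖ = 2 * R := by simp [abs_of_nonneg hR]
    calc _ ≤ ‖v (Fin.last n)‖ + 2 * R * ‖v i₀.castSucc‖ := by
          rw [heisLin_last, ← h2R, ← norm_mul]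
          exact norm_sub_le _ _
      _ ≤ ‖v‖ + 2 * R * ‖v‖ := by gcongr <;> exact PiLp.norm_apply_le v _
      _ = (1 + 2 * R) * ‖v‖ := by ring
  calc _ ≤ ε⁻¹ * ‖v‖ + (1 + 2 * R) * ‖v‖ :=
        (norm_le_norm_zPart_add _).trans (add_le_add hz hw)
    _ ≤ ε⁻¹ * ‖v‖ + 2 / ε * ‖v‖ := by
        gcongr
        exact (le_div_iff₀ hε).2 hRε
    _ = 3 / ε * ‖v‖ := by ring

/-- The Heisenberg translation moving the boundary point `(R e_{i₀}, i R²)` to the origin, followed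
by the dilation of the `z`-variables by `1/ε`. -/
def heisMap (i₀ : Fin n) (R ε : ℝ) (x : CSpace (n + 1)) : CSpace (n + 1) :=
  heisLin i₀ R ε (x - (EuclideanSpace.single i₀.castSucc (R : ℂ) +
    EuclideanSpace.single (Fin.last n) (Complex.I * R ^ 2)))

theorem heisMap_last (i₀ : Fin n) (R ε : ℝ) (x : CSpace (n + 1)) :
    heisMap i₀ R ε x (Fin.last n) =
      x (Fin.last n) - 2 * Complex.I * R * x i₀.castSucc + Complex.I * R ^ 2 := by
  simp only [heisMap, heisLin_last, PiLp.sub_apply, PiLp.add_apply, PiLp.single_apply,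
    (Fin.castSucc_lt_last i₀).ne, (Fin.castSucc_lt_last i₀).ne', if_true, if_false]
  ring

theorem zPart_heisMap (i₀ : Fin n) (R ε : ℝ) (x : CSpace (n + 1)) :
    zPart n (heisMap i₀ R ε x) =
      (ε : ℂ)⁻¹ • (zPart n x - EuclideanSpace.single i₀.castSucc (R : ℂ)) := by
  rw [heisMap, zPart_heisLin]
  congr 1
  ext k
  refine Fin.lastCases ?_ (fun l => ?_) k <;>
    simp [(Fin.castSucc_lt_last _).ne, (Fin.castSucc_lt_last _).ne']

theorem heisMap_castSucc (i₀ : Fin n) (R ε : ℝ) (x : CSpace (n + 1)) (l : Fin n) :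
    heisMap i₀ R ε x l.castSucc = (ε : ℂ)⁻¹ * (x l.castSucc - if l = i₀ then (R : ℂ) else 0) := by
  rw [← zPart_castSucc, zPart_heisMap]
  simp

theorem norm_zPart_sub_single (i₀ : Fin n) (R : ℝ) {ε : ℝ} (hε : 0 < ε) (x : CSpace (n + 1)) :
    ‖zPart n x - EuclideanSpace.single i₀.castSucc (R : ℂ)‖ = ε * ‖zPart n (heisMap i₀ R ε x)‖ := by
  rw [zPart_heisMap, norm_smul, norm_inv, Complex.norm_real, Real.norm_of_nonneg hε.le,
    mul_inv_cancel_left₀ hε.ne']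

theorem sq_mul_zNormSq_heisMap (i₀ : Fin n) (R : ℝ) {ε : ℝ} (hε : 0 < ε) (x : CSpace (n + 1)) :
    ε ^ 2 * zNormSq (heisMap i₀ R ε x) = zNormSq x - 2 * R * (x i₀.castSucc).re + R ^ 2 := by
  rw [← norm_zPart_sq, ← mul_pow, ← norm_zPart_sub_single i₀ R hε, norm_sub_sq_real,
    real_inner_single, norm_zPart_sq, PiLp.norm_single]
  simp only [zPart_castSucc, Complex.mul_re, Complex.conj_re, Complex.ofReal_re, Complex.conj_im,
    Complex.ofReal_im, mul_zero, sub_zero, Complex.norm_real, Real.norm_eq_abs, sq_abs]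
  ring

theorem heisMap_last_im (i₀ : Fin n) (R : ℝ) {ε : ℝ} (hε : 0 < ε) (x : CSpace (n + 1)) :
    (heisMap i₀ R ε x (Fin.last n)).im = ε ^ 2 * zNormSq (heisMap i₀ R ε x) - siegelFun x := by
  rw [sq_mul_zNormSq_heisMap i₀ R hε, heisMap_last, siegelFun]
  simp only [← Complex.ofReal_pow, Complex.add_im, Complex.sub_im, Complex.mul_im, Complex.mul_re,
    Complex.re_ofNat, Complex.I_re, Complex.im_ofNat, Complex.I_im, Complex.ofReal_re,
    Complex.ofReal_im]
  ring

theorem hasFDerivAt_heisMap (i₀ : Fin n) (R ε : ℝ) (x : CSpace (n + 1)) :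
    HasFDerivAt (heisMap i₀ R ε) (heisLin i₀ R ε) x := by
  have h := (heisLin i₀ R ε).hasFDerivAt.comp x ((hasFDerivAt_id x).sub_const
    (EuclideanSpace.single i₀.castSucc (R : ℂ) +
      EuclideanSpace.single (Fin.last n) (Complex.I * R ^ 2)))
  rwa [ContinuousLinearMap.comp_id] at h

theorem contDiff_heisMap (i₀ : Fin n) (R ε : ℝ) : ContDiff ℝ ∞ (heisMap i₀ R ε) :=
  ((heisLin i₀ R ε).restrictScalars ℝ).contDiff.comp (contDiff_id.sub contDiff_const)

theorem norm_zPart_le_of_norm_heisMap_le {i₀ : Fin n} {R ε c : ℝ} (hR : 0 ≤ R) (hε : 0 < ε)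
    {x : CSpace (n + 1)} (hx : ‖heisMap i₀ R ε x‖ ≤ c) : ‖zPart n x‖ ≤ R + c * ε := by
  have h : ‖zPart n x - EuclideanSpace.single i₀.castSucc (R : ℂ)‖ ≤ ε * c := by
    rw [norm_zPart_sub_single i₀ R hε]
    gcongr
    exact (norm_zPart_le _).trans hx
  have hsingle : ‖EuclideanSpace.single i₀.castSucc (R : ℂ)‖ = R := by simp [abs_of_nonneg hR]
  have := norm_sub_norm_le (zPart n x) (EuclideanSpace.single i₀.castSucc (R : ℂ))
  linarith

theorem norm_le_of_norm_heisMap_le {i₀ : Fin n} {R ε c : ℝ} (hR : 0 ≤ R) (hε : 0 < ε)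
    {x : CSpace (n + 1)} (hx : ‖heisMap i₀ R ε x‖ ≤ c) :
    ‖x‖ ≤ (R + c * ε) + (c + 2 * R * (R + c * ε) + R ^ 2) := by
  have hz := norm_zPart_le_of_norm_heisMap_le hR hε hx
  have hi : ‖x i₀.castSucc‖ ≤ R + c * ε := by
    rw [← zPart_castSucc]
    exact (PiLp.norm_apply_le _ _).trans hz
  have hw : x (Fin.last n) = heisMap i₀ R ε x (Fin.last n) + 2 * Complex.I * R * x i₀.castSucc -
      Complex.I * R ^ 2 := by
    rw [heisMap_last]
    ring
  have hlast : ‖x (Fin.last n)‖ ≤ c + 2 * R * ‖x i₀.castSucc‖ + R ^ 2 := by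
    rw [hw]
    refine norm_sub_le_of_le (norm_add_le_of_le ((PiLp.norm_apply_le _ _).trans hx) ?_) ?_ <;>
      simp [abs_of_nonneg hR]
  refine (norm_le_norm_zPart_add x).trans (add_le_add hz (hlast.trans ?_))
  gcongr

/-- A fixed smooth cutoff function, equal to `1` on the unit ball. -/
def heisBump (n : ℕ) : ContDiffBump (0 : CSpace (n + 1)) := ⟨1, 2, by norm_num, by norm_num⟩

theorem exists_forall_norm_fderiv_contDiffBump_le {E : Type*} [NormedAddCommGroup E]
    [NormedSpace ℝ E] [FiniteDimensional ℝ E] {c : E} (χ : ContDiffBump c) :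
    ∃ B, ∀ y, ‖fderiv ℝ χ y‖ ≤ B :=
  ((χ.contDiff (n := 1)).continuous_fderiv (by norm_num)).bounded_above_of_compact_support
    (χ.hasCompactSupport.fderiv ℝ)

/-- The cutoff factor `χ(ζ/ε, ω)` of the test function, where `(ζ, ω)` is the Heisenberg
translate of the variable. -/
def heisCutoff (i₀ : Fin n) (R ε : ℝ) (x : CSpace (n + 1)) : ℂ := heisBump n (heisMap i₀ R ε x)

/-- The holomorphic peaking factor `exp(i ω/ε²)` of the test function. -/
def heisPeak (i₀ : Fin n) (R ε : ℝ) (x : CSpace (n + 1)) : ℂ :=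
  Complex.exp (Complex.I / ε ^ 2 * heisMap i₀ R ε x (Fin.last n))

/-- The test function `χ(ζ/ε, ω) exp(i ω/ε²)`. -/
def heisTest (i₀ : Fin n) (R ε : ℝ) (x : CSpace (n + 1)) : ℂ :=
  heisCutoff i₀ R ε x * heisPeak i₀ R ε x

theorem norm_heisPeak (i₀ : Fin n) (R ε : ℝ) (x : CSpace (n + 1)) :
    ‖heisPeak i₀ R ε x‖ = Real.exp (-(heisMap i₀ R ε x (Fin.last n)).im / ε ^ 2) := by
  have hmul : Complex.I / (ε : ℂ) ^ 2 = ((ε ^ 2)⁻¹ : ℝ) * Complex.I := by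
    push_cast
    ring
  rw [heisPeak, Complex.norm_exp, hmul, mul_assoc, Complex.re_ofReal_mul, Complex.I_mul_re]
  congr 1
  ring

theorem hasFDerivAt_heisPeak (i₀ : Fin n) (R ε : ℝ) (x : CSpace (n + 1)) :
    HasFDerivAt (heisPeak i₀ R ε) (heisPeak i₀ R ε x • (Complex.I / (ε : ℂ) ^ 2) •
      (EuclideanSpace.proj (Fin.last n) : CSpace (n + 1) →L[ℂ] ℂ) ∘L heisLin i₀ R ε) x :=
  (((EuclideanSpace.proj (Fin.last n) : CSpace (n + 1) →L[ℂ] ℂ).hasFDerivAt.comp x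
    (hasFDerivAt_heisMap i₀ R ε x)).const_mul (Complex.I / (ε : ℂ) ^ 2)).cexp

theorem norm_heisCutoff_le_one (i₀ : Fin n) (R ε : ℝ) (x : CSpace (n + 1)) :
    ‖heisCutoff i₀ R ε x‖ ≤ 1 := by
  rw [heisCutoff, Complex.norm_real, Real.norm_of_nonneg (heisBump n).nonneg]
  exact (heisBump n).le_one

theorem norm_heisTest_le (i₀ : Fin n) (R ε : ℝ) (x : CSpace (n + 1)) :
    ‖heisTest i₀ R ε x‖ ≤ ‖heisPeak i₀ R ε x‖ := by
  rw [heisTest, norm_mul]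
  exact mul_le_of_le_one_left (norm_nonneg _) (norm_heisCutoff_le_one i₀ R ε x)

theorem contDiff_heisCutoff (i₀ : Fin n) (R ε : ℝ) : ContDiff ℝ ∞ (heisCutoff i₀ R ε) :=
  Complex.ofRealCLM.contDiff.comp ((heisBump n).contDiff.comp (contDiff_heisMap i₀ R ε))

theorem contDiff_heisTest (i₀ : Fin n) (R ε : ℝ) : ContDiff ℝ ∞ (heisTest i₀ R ε) :=
  (contDiff_heisCutoff i₀ R ε).mul (contDiff_const.mul
    (((EuclideanSpace.proj (Fin.last n) : CSpace (n + 1) →L[ℂ] ℂ).restrictScalars ℝ).contDiff.comp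
      (contDiff_heisMap i₀ R ε))).cexp

theorem tsupport_heisTest_subset (i₀ : Fin n) (R ε : ℝ) :
    tsupport (heisTest i₀ R ε) ⊆ {x | ‖heisMap i₀ R ε x‖ ≤ 2} := by
  refine closure_minimal (fun x hx => ?_)
    (isClosed_le (contDiff_heisMap i₀ R ε).continuous.norm continuous_const)
  by_contra hlt
  have h0 : heisBump n (heisMap i₀ R ε x) = 0 := by
    refine (heisBump n).zero_of_le_dist ?_
    rw [dist_zero_right]
    exact (not_le.1 hlt).le
  exact hx (by simp only [heisTest, heisCutoff, h0, Complex.ofReal_zero, zero_mul])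

theorem hasCompactSupport_heisTest (i₀ : Fin n) {R ε : ℝ} (hR : 0 ≤ R) (hε : 0 < ε) :
    HasCompactSupport (heisTest i₀ R ε) :=
  (isCompact_closedBall 0 _).of_isClosed_subset (isClosed_tsupport _) fun _ hx =>
    mem_closedBall_zero_iff.2
      (norm_le_of_norm_heisMap_le hR hε (tsupport_heisTest_subset i₀ R ε hx))

end TestFunctions

section GradientBounds

variable {N n : ℕ}

theorem norm_le_card_mul {v : CSpace N} {c : ℝ} (h : ∀ k, ‖v k‖ ≤ c) : ‖v‖ ≤ N * c := by
  calc ‖v‖ = ‖∑ k, EuclideanSpace.single k (v k)‖ := by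
        congr 1
        ext j
        simp
    _ ≤ ∑ _k : Fin N, c := norm_sum_le_of_le _ fun k _ => by simpa using h k
    _ = N * c := by simp

theorem norm_gradZ_le {f : CSpace N → ℂ} {x : CSpace N} : ‖gradZ f x‖ ≤ N * ‖fderiv ℝ f x‖ :=
  norm_le_card_mul fun _ => norm_dz_le fun a ha => by
    simpa [ha] using (fderiv ℝ f x).le_opNorm (EuclideanSpace.single _ a)

theorem norm_gradZbar_le {f : CSpace N → ℂ} {x : CSpace N} :
    ‖gradZbar f x‖ ≤ N * ‖fderiv ℝ f x‖ :=
  norm_le_card_mul fun _ => norm_dzbar_le fun a ha => by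
    simpa [ha] using (fderiv ℝ f x).le_opNorm (EuclideanSpace.single _ a)

theorem gradZbar_mul {f g : CSpace N → ℂ} {x : CSpace N} (hf : DifferentiableAt ℝ f x)
    (hg : DifferentiableAt ℝ g x) :
    gradZbar (fun y => f y * g y) x = g x • gradZbar f x + f x • gradZbar g x := by
  ext k
  simp only [gradZbar, dzbar_mul hf hg, PiLp.add_apply, PiLp.smul_apply, smul_eq_mul]
  ring

theorem tangGradZ_mul {f g : CSpace (n + 1) → ℂ} {x : CSpace (n + 1)}
    (hf : DifferentiableAt ℝ f x) (hg : DifferentiableAt ℝ g x) :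
    tangGradZ (fun y => f y * g y) x = g x • tangGradZ f x + f x • tangGradZ g x := by
  ext k
  simp only [tangGradZ, gradZ, dz_mul hf hg, PiLp.add_apply, PiLp.smul_apply, smul_eq_mul]
  ring

theorem norm_tangGradZ_le (f : CSpace (n + 1) → ℂ) (x : CSpace (n + 1)) :
    ‖tangGradZ f x‖ ≤ ‖gradZ f x‖ + 2 * ‖dz (Fin.last n) f x‖ * ‖siegelNormal x‖ := by
  refine (norm_add_le _ _).trans_eq ?_
  simp [norm_smul]

theorem norm_siegelNormal_le (x : CSpace (n + 1)) : ‖siegelNormal x‖ ≤ 1 / 2 + ‖zPart n x‖ := by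
  refine le_of_sq_le_sq ?_ (by positivity)
  rw [norm_siegelNormal_sq, ← norm_zPart_sq]
  linarith [norm_nonneg (zPart n x)]

end GradientBounds

section TestFunctionBounds

variable {n : ℕ} {i₀ : Fin n} {R ε B : ℝ} {x : CSpace (n + 1)}

theorem norm_siegelNormal_le_of_norm_heisMap_le (hR : 1 ≤ R) (hε : 0 < ε) (hRε : 4 * (R * ε) ≤ 1)
    (hx : ‖heisMap i₀ R ε x‖ ≤ 2) : ‖siegelNormal x‖ ≤ 2 * R := by
  have hz := norm_zPart_le_of_norm_heisMap_le (by linarith) hε hx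
  have hεR : ε ≤ R * ε := le_mul_of_one_le_left hε.le hR
  linarith [norm_siegelNormal_le x]

theorem norm_le_mul_sq_of_norm_heisMap_le (hR : 1 ≤ R) (hε : 0 < ε) (hRε : 4 * (R * ε) ≤ 1)
    (hx : ‖heisMap i₀ R ε x‖ ≤ 2) : ‖x‖ ≤ 9 * R ^ 2 := by
  have h := norm_le_of_norm_heisMap_le (by linarith) hε hx
  have hεR : ε ≤ R * ε := le_mul_of_one_le_left hε.le hR
  nlinarith

theorem differentiableAt_heisCutoff : DifferentiableAt ℝ (heisCutoff i₀ R ε) x :=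
  (contDiff_heisCutoff i₀ R ε).differentiable (by simp) x

theorem differentiableAt_heisPeak : DifferentiableAt ℝ (heisPeak i₀ R ε) x :=
  ((hasFDerivAt_heisPeak i₀ R ε x).restrictScalars ℝ).differentiableAt

theorem norm_fderiv_heisCutoff_apply_le (hB : ∀ y, ‖fderiv ℝ (heisBump n) y‖ ≤ B)
    (v : CSpace (n + 1)) : ‖fderiv ℝ (heisCutoff i₀ R ε) x v‖ ≤ B * ‖heisLin i₀ R ε v‖ := by
  have h : HasFDerivAt (fun y => heisBump n (heisMap i₀ R ε y))
      (fderiv ℝ (heisBump n) (heisMap i₀ R ε x) ∘L (heisLin i₀ R ε).restrictScalars ℝ) x :=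
    ((heisBump n).contDiff.differentiable one_ne_zero _).hasFDerivAt.comp x
      ((hasFDerivAt_heisMap i₀ R ε x).restrictScalars ℝ)
  change ‖fderiv ℝ (fun y => (heisBump n (heisMap i₀ R ε y) : ℂ)) x v‖ ≤ _
  rw [fderiv_ofReal_apply h.differentiableAt, h.fderiv, Complex.norm_real]
  exact ContinuousLinearMap.le_of_opNorm_le _ (hB _) _

theorem norm_fderiv_heisCutoff_le (hB : ∀ y, ‖fderiv ℝ (heisBump n) y‖ ≤ B) (hR : 0 ≤ R)
    (hε : 0 < ε) (hRε : (1 + 2 * R) * ε ≤ 2) :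
    ‖fderiv ℝ (heisCutoff i₀ R ε) x‖ ≤ B * (3 / ε) := by
  have hB0 : 0 ≤ B := (norm_nonneg _).trans (hB 0)
  refine ContinuousLinearMap.opNorm_le_bound _ (by positivity) fun v => ?_
  rw [mul_assoc]
  exact (norm_fderiv_heisCutoff_apply_le hB v).trans
    (mul_le_mul_of_nonneg_left (norm_heisLin_le i₀ hR hε hRε v) hB0)

theorem norm_dz_last_heisCutoff_le (hB : ∀ y, ‖fderiv ℝ (heisBump n) y‖ ≤ B) :
    ‖dz (Fin.last n) (heisCutoff i₀ R ε) x‖ ≤ B :=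
  norm_dz_le fun a ha => by
    simpa [heisLin_single_last, ha] using
      norm_fderiv_heisCutoff_apply_le (i₀ := i₀) (R := R) (ε := ε) (x := x) hB
        (EuclideanSpace.single (Fin.last n) a)

theorem gradZbar_heisPeak : gradZbar (heisPeak i₀ R ε) x = 0 := by
  ext k
  exact dzbar_eq_zero_of_hasFDerivAt_complex (hasFDerivAt_heisPeak i₀ R ε x) k

theorem dz_heisPeak (k : Fin (n + 1)) :
    dz k (heisPeak i₀ R ε) x = heisPeak i₀ R ε x *
      (Complex.I / ε ^ 2 * heisLin i₀ R ε (EuclideanSpace.single k 1) (Fin.last n)) :=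
  dz_eq_of_hasFDerivAt_complex (hasFDerivAt_heisPeak i₀ R ε x) k

theorem tangGradZ_heisPeak (hε : ε ≠ 0) :
    tangGradZ (heisPeak i₀ R ε) x =
      (-2 / ε * heisPeak i₀ R ε x) • conjVec (zPart n (heisMap i₀ R ε x)) := by
  have hε' : (ε : ℂ) ≠ 0 := by exact_mod_cast hε
  ext k
  refine Fin.lastCases ?_ (fun l => ?_) k
  · simp [tangGradZ_last, conjVec_apply]
  · have hlin : heisLin i₀ R ε (EuclideanSpace.single l.castSucc 1) (Fin.last n) =
        -(2 * Complex.I * R * if l = i₀ then 1 else 0) := by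
      simp [heisLin_last, PiLp.single_apply, (Fin.castSucc_lt_last l).ne', eq_comm (a := i₀)]
    have hconj : conj (heisMap i₀ R ε x l.castSucc) =
        (ε : ℂ)⁻¹ * (conj (x l.castSucc) - R * if l = i₀ then 1 else 0) := by
      rw [heisMap_castSucc]
      split_ifs <;> simp
    rw [tangGradZ_castSucc, dz_heisPeak, dz_heisPeak, hlin, heisLin_single_last,
      PiLp.single_eq_same, PiLp.smul_apply, conjVec_apply, zPart_castSucc, hconj, smul_eq_mul]
    field_simp
    linear_combination
      heisPeak i₀ R ε x * (conj (x l.castSucc) - R * (if l = i₀ then 1 else 0)) * Complex.I_sq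

theorem norm_tangGradZ_heisPeak_le (hε : 0 < ε) (hx : ‖heisMap i₀ R ε x‖ ≤ 2) :
    ‖tangGradZ (heisPeak i₀ R ε) x‖ ≤ 4 / ε * ‖heisPeak i₀ R ε x‖ := by
  have hz : ‖zPart n (heisMap i₀ R ε x)‖ ≤ 2 := (norm_zPart_le _).trans hx
  rw [tangGradZ_heisPeak hε.ne', norm_smul, LinearIsometryEquiv.norm_map, norm_mul, norm_div,
    Complex.norm_real, Real.norm_of_nonneg hε.le, norm_neg, Complex.norm_ofNat]
  calc _ ≤ 2 / ε * ‖heisPeak i₀ R ε x‖ * 2 := by gcongr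
    _ = 4 / ε * ‖heisPeak i₀ R ε x‖ := by ring

theorem norm_gradZbar_heisTest_le (hB : ∀ y, ‖fderiv ℝ (heisBump n) y‖ ≤ B) (hR : 0 ≤ R)
    (hε : 0 < ε) (hRε : (1 + 2 * R) * ε ≤ 2) :
    ‖gradZbar (heisTest i₀ R ε) x‖ ≤ 3 * (n + 1) * B / ε * ‖heisPeak i₀ R ε x‖ := by
  have h : gradZbar (heisTest i₀ R ε) x = heisPeak i₀ R ε x • gradZbar (heisCutoff i₀ R ε) x := by
    have hmul : gradZbar (heisTest i₀ R ε) x = _ :=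
      gradZbar_mul differentiableAt_heisCutoff differentiableAt_heisPeak
    rw [hmul, gradZbar_heisPeak, smul_zero, add_zero]
  rw [h, norm_smul, mul_comm]
  gcongr
  calc _ ≤ ((n + 1 : ℕ) : ℝ) * (B * (3 / ε)) :=
        norm_gradZbar_le.trans (by gcongr; exact norm_fderiv_heisCutoff_le hB hR hε hRε)
    _ = 3 * (n + 1) * B / ε := by
        push_cast
        ring

theorem norm_tangGradZ_heisCutoff_le (hB : ∀ y, ‖fderiv ℝ (heisBump n) y‖ ≤ B) (hR : 1 ≤ R)
    (hε : 0 < ε) (hRε : 4 * (R * ε) ≤ 1) (hx : ‖heisMap i₀ R ε x‖ ≤ 2) :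
    ‖tangGradZ (heisCutoff i₀ R ε) x‖ ≤ (3 * (n + 1) + 1) * B / ε := by
  have hB0 : 0 ≤ B := (norm_nonneg _).trans (hB 0)
  have hεR : ε ≤ R * ε := le_mul_of_one_le_left hε.le hR
  have hgrad : ‖gradZ (heisCutoff i₀ R ε) x‖ ≤ ((n + 1 : ℕ) : ℝ) * (B * (3 / ε)) :=
    norm_gradZ_le.trans (by
      gcongr; exact norm_fderiv_heisCutoff_le hB (by linarith) hε (by linarith))
  have hRinv : 4 * R ≤ 1 / ε := (le_div_iff₀ hε).2 (by linarith)
  calc _ ≤ ((n + 1 : ℕ) : ℝ) * (B * (3 / ε)) + 2 * B * (2 * R) := by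
        refine (norm_tangGradZ_le _ _).trans (add_le_add hgrad ?_)
        gcongr
        · exact norm_dz_last_heisCutoff_le hB
        · exact norm_siegelNormal_le_of_norm_heisMap_le hR hε hRε hx
    _ ≤ ((n + 1 : ℕ) : ℝ) * (B * (3 / ε)) + B * (1 / ε) := by
        have := mul_le_mul_of_nonneg_left hRinv hB0
        linarith
    _ = _ := by
        push_cast
        ring

theorem norm_tangGradZ_heisTest_le (hB : ∀ y, ‖fderiv ℝ (heisBump n) y‖ ≤ B) (hR : 1 ≤ R)
    (hε : 0 < ε) (hRε : 4 * (R * ε) ≤ 1) (hx : ‖heisMap i₀ R ε x‖ ≤ 2) :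
    ‖tangGradZ (heisTest i₀ R ε) x‖ ≤
      ((3 * (n + 1) + 1) * B + 4) / ε * ‖heisPeak i₀ R ε x‖ := by
  have hmul : tangGradZ (heisTest i₀ R ε) x = _ :=
    tangGradZ_mul differentiableAt_heisCutoff differentiableAt_heisPeak
  rw [hmul]
  refine (norm_add_le _ _).trans ?_
  rw [norm_smul, norm_smul]
  calc _ ≤ ‖heisPeak i₀ R ε x‖ * ((3 * (n + 1) + 1) * B / ε) +
        1 * (4 / ε * ‖heisPeak i₀ R ε x‖) := by
        gcongr
        · exact norm_tangGradZ_heisCutoff_le hB hR hε hRε hx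
        · exact norm_heisCutoff_le_one i₀ R ε x
        · exact norm_tangGradZ_heisPeak_le hε hx
    _ = _ := by ring

theorem exists_norm_dbarForm_heisTest_le {r : ℕ} (p q : ℕ) (e : Forms (n + 1) r) :
    ∃ C, ∀ (i₀ : Fin n) (R ε : ℝ) (x : CSpace (n + 1)), 1 ≤ R → 0 < ε →
      4 * (R * ε) ≤ 1 → ‖heisMap i₀ R ε x‖ ≤ 2 →
        ‖dbarForm p (tangForm q e (heisTest i₀ R ε)) x‖ ≤ C * (R / ε) * ‖heisPeak i₀ R ε x‖ := by
  obtain ⟨B, hB⟩ := exists_forall_norm_fderiv_contDiffBump_le (heisBump n)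
  obtain ⟨C, hC, h⟩ := exists_norm_dbarForm_tangForm_le p q e
  have hB0 : 0 ≤ B := (norm_nonneg _).trans (hB 0)
  refine ⟨C * (6 * (n + 1) * B + 1), fun i₀ R ε x hR hε hRε hx => ?_⟩
  have hεR : ε ≤ R * ε := le_mul_of_one_le_left hε.le hR
  have hone : 1 ≤ R / ε := (one_le_div hε).2 (by linarith)
  calc _ ≤ C * (3 * (n + 1) * B / ε * ‖heisPeak i₀ R ε x‖ * (2 * R) +
        R / ε * ‖heisPeak i₀ R ε x‖) := by
        refine (h _ x ((contDiff_heisTest i₀ R ε).differentiable (by simp) x)).trans ?_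
        gcongr
        · exact norm_gradZbar_heisTest_le hB (by linarith) hε (by linarith)
        · exact norm_siegelNormal_le_of_norm_heisMap_le hR hε hRε hx
        · exact (norm_heisTest_le i₀ R ε x).trans (le_mul_of_one_le_left (norm_nonneg _) hone)
    _ = _ := by ring

theorem exists_norm_dbarStarForm_heisTest_le {r : ℕ} (p q : ℕ) (e : Forms (n + 1) r) :
    ∃ C, ∀ (i₀ : Fin n) (R ε t : ℝ) (x : CSpace (n + 1)), 1 ≤ R → 0 < ε → 0 ≤ t →
      4 * (R * ε) ≤ 1 → 9 * t * R ^ 2 * ε ≤ 1 → ‖heisMap i₀ R ε x‖ ≤ 2 →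
        ‖dbarStarForm p t (tangForm q e (heisTest i₀ R ε)) x‖ ≤
          C * (R / ε) * ‖heisPeak i₀ R ε x‖ := by
  obtain ⟨B, hB⟩ := exists_forall_norm_fderiv_contDiffBump_le (heisBump n)
  obtain ⟨C, hC, h⟩ := exists_norm_dbarStarForm_tangForm_le p q e
  have hB0 : 0 ≤ B := (norm_nonneg _).trans (hB 0)
  refine ⟨C * (2 * ((3 * (n + 1) + 1) * B + 5)),
    fun i₀ R ε t x hR hε ht hRε htε hx => ?_⟩
  have htx : t * ‖x‖ ≤ 1 / ε := by
    rw [le_div_iff₀ hε]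
    calc t * ‖x‖ * ε ≤ t * (9 * R ^ 2) * ε := by
          gcongr
          exact norm_le_mul_sq_of_norm_heisMap_le hR hε hRε hx
      _ ≤ 1 := by linarith
  calc _ ≤ C * ((1 / ε * ‖heisPeak i₀ R ε x‖ + ((3 * (n + 1) + 1) * B + 4) / ε *
        ‖heisPeak i₀ R ε x‖) * (2 * R)) := by
        refine (h t _ x ht ((contDiff_heisTest i₀ R ε).differentiable (by simp) x)).trans ?_
        gcongr
        · exact norm_heisTest_le i₀ R ε x
        · exact norm_tangGradZ_heisTest_le hB hR hε hRε hx
        · exact norm_siegelNormal_le_of_norm_heisMap_le hR hε hRε hx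
    _ = _ := by ring

theorem exists_sq_norm_dbarForm_add_le_heisPeak {r : ℕ} (p p' q : ℕ) (e : Forms (n + 1) r) :
    ∃ C, 0 ≤ C ∧ ∀ (i₀ : Fin n) (R ε t : ℝ) (x : CSpace (n + 1)), 1 ≤ R → 0 < ε → 0 ≤ t →
      4 * (R * ε) ≤ 1 → 9 * t * R ^ 2 * ε ≤ 1 →
        ‖dbarForm p (tangForm q e (heisTest i₀ R ε)) x‖ ^ 2 +
          ‖dbarStarForm p' t (tangForm q e (heisTest i₀ R ε)) x‖ ^ 2 ≤
        C * (R / ε) ^ 2 *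
          {y | ‖heisMap i₀ R ε y‖ ≤ 2}.indicator (fun y => ‖heisPeak i₀ R ε y‖ ^ 2) x := by
  obtain ⟨C₁, h₁⟩ := exists_norm_dbarForm_heisTest_le p q e
  obtain ⟨C₂, h₂⟩ := exists_norm_dbarStarForm_heisTest_le p' q e
  refine ⟨C₁ ^ 2 + C₂ ^ 2, by positivity, fun i₀ R ε t x hR hε ht hRε htε => ?_⟩
  by_cases hx : ‖heisMap i₀ R ε x‖ ≤ 2
  · rw [Set.indicator_of_mem (show x ∈ {y | ‖heisMap i₀ R ε y‖ ≤ 2} from hx)]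
    calc _ ≤ (C₁ * (R / ε) * ‖heisPeak i₀ R ε x‖) ^ 2 +
          (C₂ * (R / ε) * ‖heisPeak i₀ R ε x‖) ^ 2 := by
          gcongr
          · exact h₁ i₀ R ε x hR hε hRε hx
          · exact h₂ i₀ R ε t x hR hε ht hRε htε hx
      _ = _ := by ring
  · have hsupp : x ∉ tsupport (tangForm q e (heisTest i₀ R ε)) := fun h =>
      hx (tsupport_heisTest_subset i₀ R ε (closure_mono (Function.support_smul_subset_left _ _) h))
    rw [Set.indicator_of_notMem (show x ∉ {y | ‖heisMap i₀ R ε y‖ ≤ 2} from hx),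
      dbarForm_eq_zero_of_notMem_tsupport hsupp, dbarStarForm_eq_zero_of_notMem_tsupport hsupp]
    simp

end TestFunctionBounds

section VolumeBound

variable {n : ℕ} {i₀ : Fin n} {R ε : ℝ} {x : CSpace (n + 1)}

theorem exists_lintegral_eq_prod (n : ℕ) : ∃ c : NNReal, ∀ f : ℂ × (Fin n → ℂ) → ℝ≥0∞,
    Measurable f → ∫⁻ x : CSpace (n + 1), f (x (Fin.last n), fun j => x j.castSucc) =
      c * ∫⁻ z : Fin n → ℂ, ∫⁻ w : ℂ, f (w, z) := by
  let e := EuclideanSpace.equiv (Fin (n + 1)) ℂ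
  let μ : Measure (Fin (n + 1) → ℂ) := Measure.map e (volume : Measure (CSpace (n + 1)))
  have : μ.IsAddHaarMeasure := e.isAddHaarMeasure_map volume
  have hpres := volume_preserving_piFinSuccAbove (fun _ : Fin (n + 1) => ℂ) (Fin.last n)
  have hsplit : ∀ y : Fin (n + 1) → ℂ,
      MeasurableEquiv.piFinSuccAbove (fun _ : Fin (n + 1) => ℂ) (Fin.last n) y =
        (y (Fin.last n), fun j => y j.castSucc) := fun y =>
    Prod.ext rfl (funext fun j => congrArg y (Fin.succAbove_last_apply j))
  refine ⟨μ.addHaarScalarFactor volume, fun f hf => ?_⟩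
  have hF : Measurable fun y : Fin (n + 1) → ℂ => f (y (Fin.last n), fun j => y j.castSucc) :=
    hf.comp (by fun_prop)
  calc ∫⁻ x : CSpace (n + 1), f (x (Fin.last n), fun j => x j.castSucc)
      = ∫⁻ y, f (y (Fin.last n), fun j => y j.castSucc) ∂μ :=
        (lintegral_map hF e.continuous.measurable).symm
    _ = μ.addHaarScalarFactor volume *
          ∫⁻ y : Fin (n + 1) → ℂ, f (y (Fin.last n), fun j => y j.castSucc) := by
        conv_lhs => rw [μ.isAddLeftInvariant_eq_smul volume, ENNReal.smul_def,
          lintegral_smul_measure, smul_eq_mul]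
    _ = _ := by
        rw [← lintegral_prod_symm f hf.aemeasurable, ← Measure.volume_eq_prod,
          ← hpres.lintegral_comp hf]
        simp only [hsplit]

theorem setLIntegral_halfStrip_exp {a c : ℝ} (ha : 0 < a) (hc : 0 ≤ c) :
    ∫⁻ w in Set.Icc (-c) c ×ℂ Set.Ioi 0, ENNReal.ofReal (Real.exp (-a * w.im)) =
      ENNReal.ofReal (2 * c / a) := by
  have hexp : ∫⁻ y in Set.Ioi (0 : ℝ), ENNReal.ofReal (Real.exp (-a * y)) =
      ENNReal.ofReal (1 / a) := by
    rw [← ofReal_integral_eq_lintegral_ofReal (integrableOn_exp_mul_Ioi (neg_lt_zero.2 ha) 0)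
      (Eventually.of_forall fun y => (Real.exp_pos _).le), integral_exp_mul_Ioi (neg_lt_zero.2 ha)]
    simp
  calc ∫⁻ w in Set.Icc (-c) c ×ℂ Set.Ioi 0, ENNReal.ofReal (Real.exp (-a * w.im))
      = ∫⁻ p in Set.Icc (-c) c ×ˢ Set.Ioi (0 : ℝ), 1 * ENNReal.ofReal (Real.exp (-a * p.2)) := by
        simp only [one_mul]
        exact Complex.volume_preserving_equiv_real_prod.setLIntegral_comp_preimage_emb
          Complex.measurableEquivRealProd.measurableEmbedding
          (fun p : ℝ × ℝ => ENNReal.ofReal (Real.exp (-a * p.2))) (Set.Icc (-c) c ×ˢ Set.Ioi 0)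
    _ = (∫⁻ _ in Set.Icc (-c) c, 1) *
          ∫⁻ y in Set.Ioi (0 : ℝ), ENNReal.ofReal (Real.exp (-a * y)) := by
        rw [Measure.volume_eq_prod, ← Measure.prod_restrict]
        exact lintegral_prod_mul (f := fun _ => 1)
          (g := fun y => ENNReal.ofReal (Real.exp (-a * y))) aemeasurable_const (by fun_prop)
    _ = _ := by
        rw [hexp, setLIntegral_one, Real.volume_Icc, ← ENNReal.ofReal_mul (by linarith)]
        congr 1
        ring

/-- A function of `(w, z)` with product-like structure that dominates `|heisPeak|²` on the part of
`siegel n` where `‖heisMap‖ ≤ 2`. -/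
def peakMajorant (i₀ : Fin n) (R ε : ℝ) (p : ℂ × (Fin n → ℂ)) : ℝ≥0∞ :=
  (Metric.closedBall (Pi.single i₀ (R : ℂ)) (2 * ε)).indicator 1 p.2 *
    (Set.Icc (-2) 2 ×ℂ Set.Ioi 0).indicator
      (fun w => ENNReal.ofReal (Real.exp (-(2 / ε ^ 2) * w.im)))
      (p.1 - (2 * Complex.I * R * p.2 i₀ - Complex.I * R ^ 2))

theorem measurableSet_halfStrip (c : ℝ) : MeasurableSet (Set.Icc (-c) c ×ℂ Set.Ioi 0) :=
  (Complex.measurable_re measurableSet_Icc).inter (Complex.measurable_im measurableSet_Ioi)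

theorem measurable_peakMajorant (i₀ : Fin n) (R ε : ℝ) : Measurable (peakMajorant i₀ R ε) := by
  refine ((measurable_one.indicator measurableSet_closedBall).comp measurable_snd).mul ?_
  have hexp : Measurable fun w : ℂ => ENNReal.ofReal (Real.exp (-(2 / ε ^ 2) * w.im)) := by
    fun_prop
  exact (hexp.indicator (measurableSet_halfStrip 2)).comp (by fun_prop)

theorem norm_castSucc_sub_le {c : ℝ} (hε : 0 < ε) (hx : ‖heisMap i₀ R ε x‖ ≤ c) (l : Fin n) :
    ‖x l.castSucc - Pi.single (M := fun _ => ℂ) i₀ (R : ℂ) l‖ ≤ c * ε :=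
  calc _ = ‖(zPart n x - EuclideanSpace.single i₀.castSucc (R : ℂ)) l.castSucc‖ := by
        simp [Pi.single_apply]
    _ ≤ ε * ‖zPart n (heisMap i₀ R ε x)‖ :=
        (PiLp.norm_apply_le _ _).trans_eq (norm_zPart_sub_single i₀ R hε x)
    _ ≤ ε * c := by
        gcongr
        exact (norm_zPart_le _).trans hx
    _ = c * ε := mul_comm _ _

theorem mem_closedBall_of_norm_heisMap_le {c : ℝ} (hε : 0 < ε) (hx : ‖heisMap i₀ R ε x‖ ≤ c) :
    (fun j => x j.castSucc) ∈ Metric.closedBall (Pi.single i₀ (R : ℂ)) (c * ε) := by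
  have hc : 0 ≤ c := (norm_nonneg _).trans hx
  rw [Metric.mem_closedBall, dist_pi_le_iff (by positivity)]
  exact fun l => (dist_eq_norm _ _).trans_le (norm_castSucc_sub_le hε hx l)

theorem heisMap_last_mem_halfStrip (hε : 0 < ε) (hxs : x ∈ siegel n)
    (hx : ‖heisMap i₀ R ε x‖ ≤ 2) :
    heisMap i₀ R ε x (Fin.last n) ∈ Set.Icc (-2) 2 ×ℂ Set.Ioi 0 := by
  have hlast : ‖heisMap i₀ R ε x (Fin.last n)‖ ≤ 2 := (PiLp.norm_apply_le _ _).trans hx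
  have him : 0 < (heisMap i₀ R ε x (Fin.last n)).im := by
    rw [heisMap_last_im i₀ R hε x]
    have := mem_siegel_iff.1 hxs
    have := mul_nonneg (sq_nonneg ε) (zNormSq_nonneg (heisMap i₀ R ε x))
    linarith
  exact Complex.mem_reProdIm.2 ⟨abs_le.1 ((Complex.abs_re_le_norm _).trans hlast), him⟩

theorem indicator_sq_norm_heisPeak_le_peakMajorant (hε : 0 < ε) (hxs : x ∈ siegel n) :
    {y | ‖heisMap i₀ R ε y‖ ≤ 2}.indicator (fun y => ENNReal.ofReal (‖heisPeak i₀ R ε y‖ ^ 2)) x ≤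
      peakMajorant i₀ R ε (x (Fin.last n), fun j => x j.castSucc) := by
  refine Set.indicator_apply_le' (fun (hx : ‖heisMap i₀ R ε x‖ ≤ 2) => ?_) fun _ => zero_le
  have hw : x (Fin.last n) - (2 * Complex.I * R * x i₀.castSucc - Complex.I * R ^ 2) =
      heisMap i₀ R ε x (Fin.last n) := by
    rw [heisMap_last]
    ring
  rw [peakMajorant, hw, Set.indicator_of_mem (mem_closedBall_of_norm_heisMap_le hε hx),
    Set.indicator_of_mem (heisMap_last_mem_halfStrip hε hxs hx), Pi.one_apply, one_mul,
    norm_heisPeak, ← Real.exp_nat_mul]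
  refine (congrArg (fun s => ENNReal.ofReal (Real.exp s)) ?_).le
  push_cast
  ring

theorem lintegral_peakMajorant_left (hε : 0 < ε) (z : Fin n → ℂ) :
    ∫⁻ w, peakMajorant i₀ R ε (w, z) =
      (Metric.closedBall (Pi.single i₀ (R : ℂ)) (2 * ε)).indicator 1 z *
        ENNReal.ofReal (2 * ε ^ 2) := by
  have hconst : 2 * 2 / (2 / ε ^ 2) = 2 * ε ^ 2 := by field_simp
  simp only [peakMajorant]
  rw [lintegral_const_mul', lintegral_sub_right_eq_self (fun w : ℂ =>
      (Set.Icc (-2) 2 ×ℂ Set.Ioi 0).indicator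
        (fun w => ENNReal.ofReal (Real.exp (-(2 / ε ^ 2) * w.im))) w),
    lintegral_indicator (measurableSet_halfStrip 2),
    setLIntegral_halfStrip_exp (by positivity) zero_le_two, hconst]
  by_cases h : z ∈ Metric.closedBall (Pi.single i₀ (R : ℂ)) (2 * ε) <;> simp [h]

theorem lintegral_lintegral_peakMajorant (hε : 0 < ε) :
    ∫⁻ z, ∫⁻ w, peakMajorant i₀ R ε (w, z) =
      ENNReal.ofReal (2 * (4 * Real.pi) ^ n * ε ^ (2 * n + 2)) := by
  have hpi : (NNReal.pi : ℝ≥0∞) = ENNReal.ofReal Real.pi := by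
    rw [← NNReal.coe_real_pi, ENNReal.ofReal_coe_nnreal]
  simp only [lintegral_peakMajorant_left hε]
  rw [lintegral_mul_const _ (measurable_one.indicator measurableSet_closedBall),
    lintegral_indicator_one measurableSet_closedBall, volume_pi_closedBall _ (by positivity)]
  simp only [Complex.volume_closedBall, Finset.prod_const, Finset.card_univ, Fintype.card_fin]
  rw [hpi, ← ENNReal.ofReal_pow (by positivity), ← ENNReal.ofReal_mul (by positivity),
    ← ENNReal.ofReal_pow (by positivity), ← ENNReal.ofReal_mul (by positivity)]
  congr 1
  ring

theorem exists_lintegral_heisPeak_le (n : ℕ) : ∃ C : ℝ,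
    ∀ (i₀ : Fin n) (R ε : ℝ), 0 < ε →
      ∫⁻ x in siegel n, {y | ‖heisMap i₀ R ε y‖ ≤ 2}.indicator
        (fun y => ENNReal.ofReal (‖heisPeak i₀ R ε y‖ ^ 2)) x ≤
          ENNReal.ofReal (C * ε ^ (2 * n + 2)) := by
  obtain ⟨c, hc⟩ := exists_lintegral_eq_prod n
  refine ⟨c * (2 * (4 * Real.pi) ^ n), fun i₀ R ε hε => ?_⟩
  calc _ ≤ ∫⁻ x in siegel n, peakMajorant i₀ R ε (x (Fin.last n), fun j => x j.castSucc) :=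
        setLIntegral_mono' isOpen_siegel.measurableSet fun _ =>
          indicator_sq_norm_heisPeak_le_peakMajorant hε
    _ ≤ ∫⁻ x : CSpace (n + 1), peakMajorant i₀ R ε (x (Fin.last n), fun j => x j.castSucc) :=
        setLIntegral_le_lintegral _ _
    _ = c * ENNReal.ofReal (2 * (4 * Real.pi) ^ n * ε ^ (2 * n + 2)) := by
        rw [hc _ (measurable_peakMajorant i₀ R ε), lintegral_lintegral_peakMajorant hε]
    _ = _ := by
        rw [← ENNReal.ofReal_coe_nnreal (p := c), ← ENNReal.ofReal_mul c.coe_nonneg]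
        congr 1
        ring

end VolumeBound

section SurfaceBound

variable {n : ℕ}

/-- The real coordinates of `ℂ^{n+1}` that remain when one `Re zᵢ` is dropped. -/
abbrev ForgetIndex (n : ℕ) : Type := (Fin n ⊕ Fin n) ⊕ Unit

/-- The orthogonal projection of `ℂ^{n+1}` that forgets `Re z_{i₀}`; the slot of `Re z_{i₀}` holds
`Im w`. -/
def forgetRe (i₀ : Fin n) (x : CSpace (n + 1)) : ForgetIndex n → ℝ :=
  Sum.elim (Sum.elim (fun j => (x j.castSucc).im)
    (fun j => if j = i₀ then (x (Fin.last n)).im else (x j.castSucc).re))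
    (fun _ => (x (Fin.last n)).re)

theorem lipschitzWith_forgetRe (i₀ : Fin n) : LipschitzWith 1 (forgetRe i₀) := by
  refine LipschitzWith.of_dist_le_mul fun x y => ?_
  rw [NNReal.coe_one, one_mul, dist_pi_le_iff dist_nonneg]
  have hre : ∀ k, dist (x k).re (y k).re ≤ dist x y := fun k => by
    rw [Real.dist_eq, ← Complex.sub_re, dist_eq_norm]
    exact (Complex.abs_re_le_norm _).trans (PiLp.norm_apply_le (x - y) k)
  have him : ∀ k, dist (x k).im (y k).im ≤ dist x y := fun k => by
    rw [Real.dist_eq, ← Complex.sub_im, dist_eq_norm]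
    exact (Complex.abs_im_le_norm _).trans (PiLp.norm_apply_le (x - y) k)
  rintro ((_ | _) | _)
  · exact him _
  · simp only [forgetRe, Sum.elim_inl, Sum.elim_inr]
    split_ifs
    · exact him _
    · exact hre _
  · exact hre _

theorem volume_le_hausdorffMeasure_of_subset_forgetRe (i₀ : Fin n) {E : Set (CSpace (n + 1))}
    {S : Set (ForgetIndex n → ℝ)} (h : S ⊆ forgetRe i₀ '' E) :
    volume S ≤ Measure.hausdorffMeasure ((2 * (n + 1) - 1 : ℕ) : ℝ) E := by
  have hcard : Fintype.card (ForgetIndex n) = 2 * (n + 1) - 1 := by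
    simp only [Fintype.card_sum, Fintype.card_fin, Fintype.card_unit]
    omega
  have himage := (lipschitzWith_forgetRe i₀).hausdorffMeasure_image_le
    (d := ((2 * (n + 1) - 1 : ℕ) : ℝ)) (by positivity) E
  rw [← hcard, hausdorffMeasure_pi_real, hcard] at himage
  simpa using (measure_mono h).trans himage

/-- `∑ⱼ |zⱼ|² - (Re z_{i₀})²`, read off from the coordinates that `forgetRe i₀` keeps. -/
def forgetRest (i₀ : Fin n) (y : ForgetIndex n → ℝ) : ℝ :=
  ∑ j : Fin n, (y (Sum.inl (Sum.inl j)) ^ 2 + if j = i₀ then 0 else y (Sum.inl (Sum.inr j)) ^ 2)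

/-- The value of `Re z_{i₀}` that puts the point with remaining coordinates `y` on the paraboloid
`Im w = |z|²`. -/
def liftRe (i₀ : Fin n) (y : ForgetIndex n → ℝ) : ℝ :=
  √(y (Sum.inl (Sum.inr i₀)) - forgetRest i₀ y)

/-- The section of `forgetRe i₀` with values in the part of the paraboloid where `0 ≤ Re z_{i₀}`. -/
def boundaryLift (i₀ : Fin n) (y : ForgetIndex n → ℝ) : CSpace (n + 1) :=
  WithLp.toLp 2 (Fin.snoc (α := fun _ => ℂ)
    (fun j => ⟨if j = i₀ then liftRe i₀ y else y (Sum.inl (Sum.inr j)), y (Sum.inl (Sum.inl j))⟩)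
    ⟨y (Sum.inr ()), y (Sum.inl (Sum.inr i₀))⟩)

variable {i₀ : Fin n} {R ε κ : ℝ} {y : ForgetIndex n → ℝ}

@[simp]
theorem boundaryLift_castSucc (i₀ : Fin n) (y : ForgetIndex n → ℝ) (j : Fin n) :
    boundaryLift i₀ y j.castSucc =
      ⟨if j = i₀ then liftRe i₀ y else y (Sum.inl (Sum.inr j)), y (Sum.inl (Sum.inl j))⟩ := by
  simp [boundaryLift]

@[simp]
theorem boundaryLift_last (i₀ : Fin n) (y : ForgetIndex n → ℝ) :
    boundaryLift i₀ y (Fin.last n) = ⟨y (Sum.inr ()), y (Sum.inl (Sum.inr i₀))⟩ := by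
  simp [boundaryLift]

theorem forgetRe_boundaryLift (i₀ : Fin n) (y : ForgetIndex n → ℝ) :
    forgetRe i₀ (boundaryLift i₀ y) = y := by
  funext k
  rcases k with (j | j) | j
  · simp [forgetRe]
  · by_cases hj : j = i₀ <;> simp [forgetRe, hj]
  · simp [forgetRe]

theorem zNormSq_boundaryLift (i₀ : Fin n) (y : ForgetIndex n → ℝ) :
    zNormSq (boundaryLift i₀ y) = liftRe i₀ y ^ 2 + forgetRest i₀ y := by
  have hterm : ∀ j : Fin n, ‖boundaryLift i₀ y j.castSucc‖ ^ 2 =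
      (if j = i₀ then liftRe i₀ y ^ 2 else 0) + (y (Sum.inl (Sum.inl j)) ^ 2 +
        if j = i₀ then 0 else y (Sum.inl (Sum.inr j)) ^ 2) := fun j => by
    rw [boundaryLift_castSucc, Complex.sq_norm, Complex.normSq_mk]
    split_ifs <;> ring
  simp only [zNormSq, forgetRest, hterm]
  rw [Finset.sum_add_distrib, Finset.sum_ite_eq' Finset.univ i₀, if_pos (Finset.mem_univ i₀)]

theorem sq_liftRe (hy : forgetRest i₀ y ≤ y (Sum.inl (Sum.inr i₀))) :
    liftRe i₀ y ^ 2 = y (Sum.inl (Sum.inr i₀)) - forgetRest i₀ y :=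
  Real.sq_sqrt (sub_nonneg.2 hy)

theorem boundaryLift_mem_frontier (hy : forgetRest i₀ y ≤ y (Sum.inl (Sum.inr i₀))) :
    boundaryLift i₀ y ∈ frontier (siegel n) := by
  rw [mem_frontier_siegel_iff, siegelFun, zNormSq_boundaryLift, sq_liftRe hy, boundaryLift_last]
  ring

theorem norm_heisMap_le_one (hε : 0 < ε) (hε1 : ε ≤ 1) {x : CSpace (n + 1)}
    (hx : x ∈ frontier (siegel n))
    (hz : zNormSq x - 2 * R * (x i₀.castSucc).re + R ^ 2 ≤ ε ^ 2 / 2)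
    (hre : |(heisMap i₀ R ε x (Fin.last n)).re| ≤ 1 / 2) : ‖heisMap i₀ R ε x‖ ≤ 1 := by
  have him : (heisMap i₀ R ε x (Fin.last n)).im = ε ^ 2 * zNormSq (heisMap i₀ R ε x) := by
    rw [heisMap_last_im i₀ R hε, mem_frontier_siegel_iff.1 hx, sub_zero]
  have hzN : zNormSq (heisMap i₀ R ε x) ≤ 1 / 2 := by
    refine le_of_mul_le_mul_left ?_ (pow_pos hε 2)
    rw [sq_mul_zNormSq_heisMap i₀ R hε]
    linarith
  have him' : (heisMap i₀ R ε x (Fin.last n)).im ≤ 1 / 2 := by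
    rw [him]
    exact (mul_le_of_le_one_left (zNormSq_nonneg _) (pow_le_one₀ hε.le hε1)).trans hzN
  have him0 : 0 ≤ (heisMap i₀ R ε x (Fin.last n)).im := by
    rw [him]
    exact mul_nonneg (sq_nonneg ε) (zNormSq_nonneg _)
  have hre2 := sq_le_sq' (abs_le.1 hre).1 (abs_le.1 hre).2
  have him2 := pow_le_pow_left₀ him0 him' 2
  refine (sq_le_one_iff₀ (norm_nonneg _)).1 ?_
  rw [norm_sq_eq_zNormSq_add, Complex.sq_norm, Complex.normSq_apply, ← pow_two, ← pow_two]
  linarith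

/-- Lower corner of a box in the image of the boundary of `siegel n` under `forgetRe i₀`. -/
def boxLow (i₀ : Fin n) (R κ : ℝ) : ForgetIndex n → ℝ :=
  Sum.elim (Sum.elim (fun _ => -κ) (fun j => if j = i₀ then R ^ 2 + 2 * n * κ ^ 2 else -κ))
    (fun _ => -(1 / 4))

/-- Upper corner of that box. The slot of `Im w` has length about `2 R κ`: the paraboloid has slope
`2 R` over `Re z_{i₀} = R`. -/
def boxHigh (i₀ : Fin n) (R κ : ℝ) : ForgetIndex n → ℝ :=
  Sum.elim (Sum.elim (fun _ => κ) (fun j => if j = i₀ then R ^ 2 + 2 * R * κ else κ))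
    (fun _ => 1 / 4)

theorem le_volume_box (i₀ : Fin n) (hR : 1 ≤ R) (hκ : 0 < κ) (h : 2 * n * κ ≤ 1) :
    ENNReal.ofReal (R * κ ^ (2 * n) / 2) ≤
      volume (Set.Icc (boxLow i₀ R κ) (boxHigh i₀ R κ)) := by
  have hprod : R * κ ^ (2 * n) / 2 = ∏ k : ForgetIndex n,
      Sum.elim (Sum.elim (fun _ => κ) (fun j => κ * if j = i₀ then R else 1))
        (fun _ => 1 / 2) k := by
    simp only [Fintype.prod_sum_type, Sum.elim_inl, Sum.elim_inr, Finset.prod_mul_distrib,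
      Finset.prod_ite_eq', Finset.mem_univ, if_true, Finset.prod_const, Finset.card_univ,
      Fintype.card_fin, Fintype.card_unit]
    ring
  have hpos : ∀ k : ForgetIndex n, 0 ≤ Sum.elim (Sum.elim (fun _ => κ)
      (fun j => κ * if j = i₀ then R else 1)) (fun _ => 1 / 2) k := by
    rintro ((_ | _) | _)
    · exact hκ.le
    · simp only [Sum.elim_inl, Sum.elim_inr]
      split_ifs <;> positivity
    · norm_num
  rw [Real.volume_Icc_pi, hprod, ENNReal.ofReal_prod_of_nonneg fun k _ => hpos k]
  gcongr with k
  rcases k with (j | j) | j <;> simp only [boxLow, boxHigh, Sum.elim_inl, Sum.elim_inr]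
  · linarith
  · split_ifs
    · nlinarith
    · linarith
  · norm_num

theorem abs_im_le_of_mem_box (hy : y ∈ Set.Icc (boxLow i₀ R κ) (boxHigh i₀ R κ)) (j : Fin n) :
    |y (Sum.inl (Sum.inl j))| ≤ κ :=
  abs_le.2 ⟨hy.1 (Sum.inl (Sum.inl j)), hy.2 (Sum.inl (Sum.inl j))⟩

theorem forgetRest_le_of_mem_box (hy : y ∈ Set.Icc (boxLow i₀ R κ) (boxHigh i₀ R κ)) :
    forgetRest i₀ y ≤ 2 * n * κ ^ 2 := by
  have hre : ∀ j : Fin n, j ≠ i₀ → |y (Sum.inl (Sum.inr j))| ≤ κ := fun j hj => abs_le.2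
    ⟨by simpa [boxLow, hj] using hy.1 (Sum.inl (Sum.inr j)),
      by simpa [boxHigh, hj] using hy.2 (Sum.inl (Sum.inr j))⟩
  calc forgetRest i₀ y ≤ ∑ _j : Fin n, 2 * κ ^ 2 := Finset.sum_le_sum fun j _ => by
        have him := abs_im_le_of_mem_box hy j
        have him2 := sq_le_sq' (abs_le.1 him).1 (abs_le.1 him).2
        split_ifs with hj
        · linarith [sq_nonneg κ]
        · have hre2 := sq_le_sq' (abs_le.1 (hre j hj)).1 (abs_le.1 (hre j hj)).2
          linarith
    _ = 2 * n * κ ^ 2 := by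
        simp only [Finset.sum_const, Finset.card_univ, Fintype.card_fin, nsmul_eq_mul]
        ring

theorem im_mem_Icc_of_mem_box (hy : y ∈ Set.Icc (boxLow i₀ R κ) (boxHigh i₀ R κ)) :
    y (Sum.inl (Sum.inr i₀)) ∈ Set.Icc (R ^ 2 + 2 * n * κ ^ 2) (R ^ 2 + 2 * R * κ) :=
  ⟨by simpa [boxLow] using hy.1 (Sum.inl (Sum.inr i₀)),
    by simpa [boxHigh] using hy.2 (Sum.inl (Sum.inr i₀))⟩

theorem forgetRest_nonneg (i₀ : Fin n) (y : ForgetIndex n → ℝ) : 0 ≤ forgetRest i₀ y :=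
  Finset.sum_nonneg fun j _ => by split_ifs <;> positivity

theorem forgetRest_le_im_of_mem_box (hy : y ∈ Set.Icc (boxLow i₀ R κ) (boxHigh i₀ R κ)) :
    forgetRest i₀ y ≤ y (Sum.inl (Sum.inr i₀)) := by
  linarith [forgetRest_le_of_mem_box hy, (im_mem_Icc_of_mem_box hy).1, sq_nonneg R]

theorem liftRe_mem_Icc_of_mem_box (hR : 0 ≤ R) (hκ : 0 ≤ κ)
    (hy : y ∈ Set.Icc (boxLow i₀ R κ) (boxHigh i₀ R κ)) :
    liftRe i₀ y ∈ Set.Icc R (R + κ) := by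
  obtain ⟨hlow, hhigh⟩ := im_mem_Icc_of_mem_box hy
  refine ⟨Real.le_sqrt_of_sq_le (by linarith [forgetRest_le_of_mem_box hy]),
    Real.sqrt_le_iff.2 ⟨by positivity, ?_⟩⟩
  linarith [forgetRest_nonneg i₀ y, sq_nonneg κ, add_sq R κ]

theorem norm_heisMap_boundaryLift_le_one (hR : 1 ≤ R) (hε : 0 < ε) (hRε : R * ε ≤ 1 / 2)
    (hκ : 0 ≤ κ) (hnκ : 4 * (n + 1) * κ ≤ ε)
    (hy : y ∈ Set.Icc (boxLow i₀ R κ) (boxHigh i₀ R κ)) :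
    ‖heisMap i₀ R ε (boundaryLift i₀ y)‖ ≤ 1 := by
  have hκε : 4 * κ ≤ ε := by linarith [mul_nonneg n.cast_nonneg hκ]
  refine norm_heisMap_le_one hε (by linarith [le_mul_of_one_le_left hε.le hR])
    (boundaryLift_mem_frontier (forgetRest_le_im_of_mem_box hy)) ?_ ?_
  · obtain ⟨hlow, hhigh⟩ := liftRe_mem_Icc_of_mem_box (by linarith) hκ hy
    calc _ = (liftRe i₀ y - R) ^ 2 + forgetRest i₀ y := by
          rw [zNormSq_boundaryLift, boundaryLift_castSucc, if_pos rfl]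
          ring
      _ ≤ κ ^ 2 + 2 * n * κ ^ 2 := add_le_add
          (pow_le_pow_left₀ (sub_nonneg.2 hlow) (by linarith) 2) (forgetRest_le_of_mem_box hy)
      _ ≤ (4 * (n + 1) * κ) * (4 * κ) / 2 := by
          have := mul_nonneg n.cast_nonneg (sq_nonneg κ)
          linarith [sq_nonneg κ]
      _ ≤ ε * ε / 2 := by gcongr
      _ = ε ^ 2 / 2 := by ring
  · have hre : (heisMap i₀ R ε (boundaryLift i₀ y) (Fin.last n)).re =
        y (Sum.inr ()) + 2 * R * y (Sum.inl (Sum.inl i₀)) := by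
      rw [heisMap_last, boundaryLift_last, boundaryLift_castSucc]
      simp [← Complex.ofReal_pow]
    have hu : |y (Sum.inr ())| ≤ 1 / 4 := abs_le.2 ⟨hy.1 (Sum.inr ()), hy.2 (Sum.inr ())⟩
    calc _ ≤ |y (Sum.inr ())| + 2 * R * |y (Sum.inl (Sum.inl i₀))| := by
          rw [hre]
          refine (abs_add_le _ _).trans_eq ?_
          rw [abs_mul, abs_of_nonneg (by linarith : 0 ≤ 2 * R)]
      _ ≤ 1 / 4 + 2 * R * (ε / 4) := by
          gcongr
          linarith [abs_im_le_of_mem_box hy i₀]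
      _ ≤ 1 / 2 := by linarith

theorem box_subset_image_forgetRe (hR : 1 ≤ R) (hε : 0 < ε) (hRε : R * ε ≤ 1 / 2) (hκ : 0 ≤ κ)
    (hnκ : 4 * (n + 1) * κ ≤ ε) :
    Set.Icc (boxLow i₀ R κ) (boxHigh i₀ R κ) ⊆
      forgetRe i₀ '' (frontier (siegel n) ∩ {x | ‖heisMap i₀ R ε x‖ ≤ 1}) := fun y hy =>
  ⟨boundaryLift i₀ y, ⟨boundaryLift_mem_frontier (forgetRest_le_im_of_mem_box hy),
    norm_heisMap_boundaryLift_le_one hR hε hRε hκ hnκ hy⟩, forgetRe_boundaryLift i₀ y⟩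

theorem exists_le_euclideanHausdorffMeasure_frontier (n : ℕ) : ∃ c : ℝ, 0 < c ∧
    ∀ (i₀ : Fin n) (R ε : ℝ), 1 ≤ R → 0 < ε → R * ε ≤ 1 / 2 →
      ENNReal.ofReal (c * R * ε ^ (2 * n)) ≤
        (Measure.euclideanHausdorffMeasure (2 * (n + 1) - 1) : Measure (CSpace (n + 1)))
          (frontier (siegel n) ∩ {x | ‖heisMap i₀ R ε x‖ ≤ 1}) := by
  let a := Measure.addHaarScalarFactor
    (volume : Measure (EuclideanSpace ℝ (Fin (2 * (n + 1) - 1))))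
    (Measure.hausdorffMeasure ((2 * (n + 1) - 1 : ℕ) : ℝ))
  have ha : 0 < (a : ℝ) := NNReal.coe_pos.2 (pos_iff_ne_zero.2
    (Measure.addHaarScalarFactor_volume_hausdorffMeasure_ne_zero (2 * (n + 1) - 1)))
  refine ⟨a * ((4 * (n + 1) : ℝ)⁻¹ ^ (2 * n) / 2), by positivity, fun i₀ R ε hR hε hRε => ?_⟩
  let κ := ε / (4 * (n + 1))
  have hκ : 0 < κ := by positivity
  have hnκ : 4 * (n + 1) * κ = ε := mul_div_cancel₀ ε (by positivity)
  have hbox : 2 * n * κ ≤ 1 := by linarith [le_mul_of_one_le_left hε.le hR, hκ]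
  rw [Measure.euclideanHausdorffMeasure_def, ENNReal.smul_def, Measure.smul_apply, smul_eq_mul]
  calc ENNReal.ofReal (a * ((4 * (n + 1) : ℝ)⁻¹ ^ (2 * n) / 2) * R * ε ^ (2 * n))
      = a * ENNReal.ofReal (R * κ ^ (2 * n) / 2) := by
        rw [← ENNReal.ofReal_coe_nnreal (p := a), ← ENNReal.ofReal_mul ha.le,
          show κ = ε * (4 * (n + 1) : ℝ)⁻¹ from div_eq_mul_inv _ _, mul_pow]
        congr 1
        ring
    _ ≤ _ := by
        gcongr
        exact (le_volume_box i₀ hR hκ hbox).trans (volume_le_hausdorffMeasure_of_subset_forgetRe i₀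
          (box_subset_image_forgetRe hR hε hRε hκ.le hnκ.le))

end SurfaceBound

section WeightedIntegralBounds

variable {N : ℕ} {Ω : Set (CSpace N)} {t : ℝ} {F : CSpace N → ℝ≥0∞}

theorem enorm_sq_eq_ofReal {E : Type*} [NormedAddCommGroup E] (a : E) :
    ‖a‖ₑ ^ 2 = ENNReal.ofReal (‖a‖ ^ 2) := by
  rw [← ofReal_norm, ENNReal.ofReal_pow (norm_nonneg _)]

theorem lintegral_weightedVolume_le {a : ℝ} (hΩ : MeasurableSet Ω) (ht : 0 ≤ t)
    (hF : Measurable F) (ha : ∀ x ∈ Ω, F x ≠ 0 → a ≤ ‖x‖ ^ 2) :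
    ∫⁻ x, F x ∂weightedVolume Ω t ≤
      ENNReal.ofReal (Real.exp (-t * a)) * ∫⁻ x in Ω, F x := by
  rw [weightedVolume, lintegral_withDensity_eq_lintegral_mul _ (by fun_prop) hF,
    ← lintegral_const_mul _ hF]
  refine setLIntegral_mono' hΩ fun x hx => ?_
  rcases eq_or_ne (F x) 0 with h0 | h0
  · simp [h0]
  · refine mul_le_mul_left (ENNReal.ofReal_le_ofReal (Real.exp_le_exp.2 ?_)) _
    exact mul_le_mul_of_nonpos_left (ha x hx h0) (neg_nonpos.2 ht)

theorem le_lintegral_weightedSurface {b : ℝ} {m : ℝ≥0∞} {E : Set (CSpace N)}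
    (hE : MeasurableSet E) (ht : 0 ≤ t) (hF : Measurable F)
    (hb : ∀ x ∈ frontier Ω ∩ E, ‖x‖ ^ 2 ≤ b) (hm : ∀ x ∈ frontier Ω ∩ E, m ≤ F x) :
    ENNReal.ofReal (Real.exp (-t * b)) * m *
        (Measure.euclideanHausdorffMeasure (2 * N - 1) : Measure (CSpace N)) (frontier Ω ∩ E) ≤
      ∫⁻ x, F x ∂weightedSurface Ω t := by
  rw [weightedSurface, lintegral_withDensity_eq_lintegral_mul _ (by fun_prop) hF,
    ← setLIntegral_const]
  refine (setLIntegral_mono' (isClosed_frontier.measurableSet.inter hE) fun x hx => ?_).trans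
    (lintegral_mono_set Set.inter_subset_left)
  exact mul_le_mul' (ENNReal.ofReal_le_ofReal (Real.exp_le_exp.2
    (mul_le_mul_of_nonpos_left (hb x hx) (neg_nonpos.2 ht)))) (hm x hx)

end WeightedIntegralBounds

section HeisenbergBallGeometry

variable {n : ℕ} {i₀ : Fin n} {R ε : ℝ} {x : CSpace (n + 1)}

theorem zNormSq_add_sq_le_norm_sq (hx : x ∈ siegel n) :
    zNormSq x + zNormSq x ^ 2 ≤ ‖x‖ ^ 2 := by
  rw [norm_sq_eq_zNormSq_add]
  gcongr
  · exact zNormSq_nonneg x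
  · exact (show zNormSq x < _ from hx).le.trans
      ((le_abs_self _).trans (Complex.abs_im_le_norm _))

theorem norm_sq_eq_of_siegelFun_eq_zero (hx : siegelFun x = 0) :
    ‖x‖ ^ 2 = zNormSq x + zNormSq x ^ 2 + (x (Fin.last n)).re ^ 2 := by
  rw [norm_sq_eq_zNormSq_add, Complex.sq_norm, Complex.normSq_apply,
    show zNormSq x = (x (Fin.last n)).im from sub_eq_zero.1 hx]
  ring

theorem pow_mul_le_of_pow_three_mul_le (hR : 1 ≤ R) (hε : 0 < ε) (h : 100 * R ^ 3 * ε ≤ 1) {k : ℕ}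
    (hk : k ≤ 3) : R ^ k * ε ≤ 1 / 100 := by
  have : R ^ k * ε ≤ R ^ 3 * ε := by gcongr
  linarith

theorem le_norm_castSucc {c : ℝ} (hε : 0 < ε) (hx : ‖heisMap i₀ R ε x‖ ≤ c) :
    R - c * ε ≤ ‖x i₀.castSucc‖ := by
  have h := norm_castSucc_sub_le hε hx i₀
  rw [Pi.single_eq_same, norm_sub_rev] at h
  have hR : R ≤ ‖(R : ℂ)‖ := by simpa using le_abs_self R
  linarith [norm_sub_norm_le (R : ℂ) (x i₀.castSucc)]

theorem abs_re_last_le {c : ℝ} (hR : 0 ≤ R) (hε : 0 < ε) (hx : ‖heisMap i₀ R ε x‖ ≤ c) :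
    |(x (Fin.last n)).re| ≤ c + 2 * R * (c * ε) := by
  have him : |(x i₀.castSucc).im| ≤ c * ε := by
    have h := norm_castSucc_sub_le hε hx i₀
    rw [Pi.single_eq_same] at h
    simpa using (Complex.abs_im_le_norm _).trans h
  have hre : |(heisMap i₀ R ε x (Fin.last n)).re| ≤ c :=
    (Complex.abs_re_le_norm _).trans ((PiLp.norm_apply_le _ _).trans hx)
  have heq : (x (Fin.last n)).re =
      (heisMap i₀ R ε x (Fin.last n)).re - 2 * R * (x i₀.castSucc).im := by
    simp [heisMap_last, ← Complex.ofReal_pow]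
  calc |(x (Fin.last n)).re|
      ≤ |(heisMap i₀ R ε x (Fin.last n)).re| + 2 * R * |(x i₀.castSucc).im| := by
        rw [heq, ← abs_of_nonneg (by positivity : 0 ≤ 2 * R), ← abs_mul,
          abs_of_nonneg (by positivity : 0 ≤ 2 * R)]
        exact abs_sub _ _
    _ ≤ c + 2 * R * (c * ε) := by gcongr

theorem le_norm_sq_of_mem_siegel (hR : 1 ≤ R) (hε : 0 < ε) (h : 100 * R ^ 3 * ε ≤ 1)
    (hx : ‖heisMap i₀ R ε x‖ ≤ 2) (hxΩ : x ∈ siegel n) : R ^ 2 + R ^ 4 - 1 ≤ ‖x‖ ^ 2 := by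
  have hε1 := pow_mul_le_of_pow_three_mul_le hR hε h (k := 0) (by norm_num)
  have hRε := pow_mul_le_of_pow_three_mul_le hR hε h (k := 1) (by norm_num)
  have hR3ε := pow_mul_le_of_pow_three_mul_le hR hε h le_rfl
  rw [pow_zero, one_mul] at hε1
  rw [pow_one] at hRε
  have hz : R ^ 2 - 4 * (R * ε) ≤ zNormSq x :=
    calc R ^ 2 - 4 * (R * ε) ≤ (R - 2 * ε) ^ 2 := by linarith [sq_nonneg ε]
      _ ≤ ‖x i₀.castSucc‖ ^ 2 := by
        have := le_norm_castSucc hε hx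
        gcongr
        linarith
      _ ≤ zNormSq x := Finset.single_le_sum (f := fun i : Fin n => ‖x i.castSucc‖ ^ 2)
        (fun _ _ => by positivity) (Finset.mem_univ i₀)
  have hz0 : 0 ≤ R ^ 2 - 4 * (R * ε) := by linarith [one_le_pow₀ hR (n := 2)]
  calc R ^ 2 + R ^ 4 - 1
      ≤ R ^ 2 + R ^ 4 - 4 * (R * ε) - 8 * (R ^ 3 * ε) + 16 * (R * ε) ^ 2 := by
        linarith [sq_nonneg (R * ε)]
    _ = (R ^ 2 - 4 * (R * ε)) + (R ^ 2 - 4 * (R * ε)) ^ 2 := by ring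
    _ ≤ zNormSq x + zNormSq x ^ 2 := by gcongr
    _ ≤ ‖x‖ ^ 2 := zNormSq_add_sq_le_norm_sq hxΩ

theorem norm_sq_le_of_mem_frontier_siegel (hR : 1 ≤ R) (hε : 0 < ε) (h : 100 * R ^ 3 * ε ≤ 1)
    (hx : ‖heisMap i₀ R ε x‖ ≤ 1) (hfr : x ∈ frontier (siegel n)) :
    ‖x‖ ^ 2 ≤ R ^ 2 + R ^ 4 + 2 := by
  have hRε := pow_mul_le_of_pow_three_mul_le hR hε h (k := 1) (by norm_num)
  have hR3ε := pow_mul_le_of_pow_three_mul_le hR hε h le_rfl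
  rw [pow_one] at hRε
  have hz : zNormSq x ≤ R ^ 2 + 3 * (R * ε) :=
    calc zNormSq x = ‖zPart n x‖ ^ 2 := (norm_zPart_sq x).symm
      _ ≤ (R + 1 * ε) ^ 2 := by
        gcongr
        exact norm_zPart_le_of_norm_heisMap_le (by linarith) hε hx
      _ = R ^ 2 + 2 * (R * ε) + ε * ε := by ring
      _ ≤ R ^ 2 + 2 * (R * ε) + R * ε := by
        gcongr
        exact (le_mul_of_one_le_left hε.le hR).trans (hRε.trans (by linarith))
      _ = R ^ 2 + 3 * (R * ε) := by ring
  have hu : |(x (Fin.last n)).re| ≤ 51 / 50 := by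
    linarith [abs_re_last_le (by linarith : 0 ≤ R) hε hx]
  rw [norm_sq_eq_of_siegelFun_eq_zero (mem_frontier_siegel_iff.1 hfr)]
  calc zNormSq x + zNormSq x ^ 2 + (x (Fin.last n)).re ^ 2
      ≤ (R ^ 2 + 3 * (R * ε)) + (R ^ 2 + 3 * (R * ε)) ^ 2 + (51 / 50) ^ 2 := by
        rw [← sq_abs (x (Fin.last n)).re]
        have := zNormSq_nonneg x
        gcongr
    _ = R ^ 2 + R ^ 4 + (3 * (R * ε) + 6 * (R ^ 3 * ε) + 9 * (R * ε) ^ 2 + (51 / 50) ^ 2) := by ring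
    _ ≤ R ^ 2 + R ^ 4 + 2 := by
        have : (R * ε) ^ 2 ≤ (1 / 100) ^ 2 := by gcongr
        gcongr
        linarith

end HeisenbergBallGeometry

section FailureOfBasicEstimate

variable {n q : ℕ} {i₀ : Fin n} {R ε t : ℝ} {x : CSpace (n + 1)}

theorem exp_neg_one_le_norm_heisTest (hε : 0 < ε) (hx : ‖heisMap i₀ R ε x‖ ≤ 1)
    (hfr : x ∈ frontier (siegel n)) : Real.exp (-1) ≤ ‖heisTest i₀ R ε x‖ := by
  have hcutoff : heisCutoff i₀ R ε x = 1 := by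
    rw [heisCutoff, (heisBump n).one_of_mem_closedBall (mem_closedBall_zero_iff.2 hx),
      Complex.ofReal_one]
  have hz : zNormSq (heisMap i₀ R ε x) ≤ 1 :=
    (zNormSq_le_norm_sq _).trans (pow_le_one₀ (norm_nonneg _) hx)
  rw [heisTest, hcutoff, one_mul, norm_heisPeak, heisMap_last_im i₀ R hε x,
    mem_frontier_siegel_iff.1 hfr, sub_zero, neg_div, mul_div_cancel_left₀ _ (by positivity)]
  gcongr

theorem le_norm_tangForm_heisTest {K : MultiIndex (n + 1) (q + 1)} (hK : i₀.castSucc ∈ K.1)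
    (hR : 1 ≤ R) (hε : 0 < ε) (h : 100 * R ^ 3 * ε ≤ 1) (hx : ‖heisMap i₀ R ε x‖ ≤ 1)
    (hfr : x ∈ frontier (siegel n)) :
    Real.exp (-1) * (R / 2) ≤
      ‖tangForm q (EuclideanSpace.single K 1) (heisTest i₀ R ε) x‖ := by
  have hA : R / 2 ≤ ‖contract q (siegelNormal x) (EuclideanSpace.single K 1)‖ :=
    calc R / 2 ≤ ‖x i₀.castSucc‖ := by
          have hε1 := pow_mul_le_of_pow_three_mul_le hR hε h (k := 0) (by norm_num)
          linarith [le_norm_castSucc hε hx]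
      _ = ‖siegelNormal x i₀.castSucc‖ := by rw [siegelNormal_castSucc, RCLike.norm_conj]
      _ ≤ _ := norm_le_norm_contract_single _ K hK
  rw [tangForm, norm_smul]
  gcongr
  exact exp_neg_one_le_norm_heisTest hε hx hfr

theorem exists_le_lintegral_tangForm_heisTest (n q : ℕ) : ∃ c : ℝ, 0 < c ∧
    ∀ (K : MultiIndex (n + 1) (q + 1)) (i₀ : Fin n) (R ε t : ℝ), i₀.castSucc ∈ K.1 → 1 ≤ R →
      0 < ε → 0 ≤ t → 100 * R ^ 3 * ε ≤ 1 →
        ENNReal.ofReal (c * Real.exp (-t * (R ^ 2 + R ^ 4 + 2)) * R ^ 3 * ε ^ (2 * n)) ≤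
          ∫⁻ x, ‖tangForm q (EuclideanSpace.single K 1) (heisTest i₀ R ε) x‖ₑ ^ 2
            ∂weightedSurface (siegel n) t := by
  obtain ⟨c, hc, hσ⟩ := exists_le_euclideanHausdorffMeasure_frontier n
  refine ⟨Real.exp (-1) ^ 2 / 4 * c, by positivity, fun K i₀ R ε t hK hR hε ht h => ?_⟩
  have hRε := pow_mul_le_of_pow_three_mul_le hR hε h (k := 1) (by norm_num)
  calc _ = ENNReal.ofReal (Real.exp (-t * (R ^ 2 + R ^ 4 + 2))) *
          ENNReal.ofReal ((Real.exp (-1) * (R / 2)) ^ 2) *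
            ENNReal.ofReal (c * R * ε ^ (2 * n)) := by
        rw [← ENNReal.ofReal_mul (by positivity), ← ENNReal.ofReal_mul (by positivity)]
        congr 1
        ring
    _ ≤ _ := by
        refine (mul_le_mul_right (hσ i₀ R ε hR hε (by linarith)) _).trans
          (le_lintegral_weightedSurface
          (isClosed_le (contDiff_heisMap i₀ R ε).continuous.norm continuous_const).measurableSet ht
          ((contDiff_tangForm (contDiff_heisTest i₀ R ε)).continuous.measurable.enorm.pow_const 2)
          (fun x hx => norm_sq_le_of_mem_frontier_siegel hR hε h hx.2 hx.1) fun x hx => ?_)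
        rw [enorm_sq_eq_ofReal]
        gcongr
        exact le_norm_tangForm_heisTest hK hR hε h hx.2 hx.1

theorem exists_enorm_sq_dbarForm_add_le_heisPeak {r : ℕ} (p p' q : ℕ) (e : Forms (n + 1) r) :
    ∃ C : ℝ, 0 ≤ C ∧ ∀ (i₀ : Fin n) (R ε t : ℝ) (x : CSpace (n + 1)), 1 ≤ R → 0 < ε → 0 ≤ t →
      4 * (R * ε) ≤ 1 → 9 * t * R ^ 2 * ε ≤ 1 →
        ‖dbarForm p (tangForm q e (heisTest i₀ R ε)) x‖ₑ ^ 2 +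
          ‖dbarStarForm p' t (tangForm q e (heisTest i₀ R ε)) x‖ₑ ^ 2 ≤
        ENNReal.ofReal (C * (R / ε) ^ 2) * {y | ‖heisMap i₀ R ε y‖ ≤ 2}.indicator
          (fun y => ENNReal.ofReal (‖heisPeak i₀ R ε y‖ ^ 2)) x := by
  obtain ⟨C, hC, hpt⟩ := exists_sq_norm_dbarForm_add_le_heisPeak p p' q e
  refine ⟨C, hC, fun i₀ R ε t x hR hε ht hRε ht' => ?_⟩
  rw [enorm_sq_eq_ofReal, enorm_sq_eq_ofReal, ← ENNReal.ofReal_add (by positivity) (by positivity)]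
  refine (ENNReal.ofReal_le_ofReal (hpt i₀ R ε t x hR hε ht hRε ht')).trans ?_
  rw [ENNReal.ofReal_mul (by positivity)]
  by_cases hx : x ∈ {y | ‖heisMap i₀ R ε y‖ ≤ 2} <;> simp [hx]

theorem exists_lintegral_energy_heisTest_le {r : ℕ} (p p' q : ℕ) (e : Forms (n + 1) r) :
    ∃ C : ℝ, ∀ (i₀ : Fin n) (R ε t : ℝ), 1 ≤ R → 0 < ε → 0 ≤ t → 100 * R ^ 3 * ε ≤ 1 →
      9 * t * R ^ 2 * ε ≤ 1 →
        ∫⁻ x, ‖dbarForm p (tangForm q e (heisTest i₀ R ε)) x‖ₑ ^ 2 ∂weightedVolume (siegel n) t +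
          ∫⁻ x, ‖dbarStarForm p' t (tangForm q e (heisTest i₀ R ε)) x‖ₑ ^ 2
            ∂weightedVolume (siegel n) t ≤
        ENNReal.ofReal (C * Real.exp (-t * (R ^ 2 + R ^ 4 - 1)) * R ^ 2 * ε ^ (2 * n)) := by
  obtain ⟨C₁, hC₁, hpt⟩ := exists_enorm_sq_dbarForm_add_le_heisPeak p p' q e
  obtain ⟨C₂, hvol⟩ := exists_lintegral_heisPeak_le n
  refine ⟨C₁ * C₂, fun i₀ R ε t hR hε ht h ht' => ?_⟩
  have hRε : 4 * (R * ε) ≤ 1 := by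
    linarith [pow_mul_le_of_pow_three_mul_le hR hε h (k := 1) (by norm_num)]
  have hf : ContDiff ℝ 1 (tangForm q e (heisTest i₀ R ε)) :=
    contDiff_tangForm ((contDiff_heisTest i₀ R ε).of_le (by exact_mod_cast le_top))
  have hu : Measurable fun x => ‖dbarForm p (tangForm q e (heisTest i₀ R ε)) x‖ₑ ^ 2 :=
    (continuous_dbarForm hf).measurable.enorm.pow_const 2
  have hv : Measurable fun x => ‖dbarStarForm p' t (tangForm q e (heisTest i₀ R ε)) x‖ₑ ^ 2 :=
    (continuous_dbarStarForm t hf).measurable.enorm.pow_const 2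
  rw [← lintegral_add_left hu]
  calc _ ≤ ENNReal.ofReal (Real.exp (-t * (R ^ 2 + R ^ 4 - 1))) * ∫⁻ x in siegel n, _ :=
        lintegral_weightedVolume_le isOpen_siegel.measurableSet ht (hu.add hv) fun x hx h0 => by
          refine le_norm_sq_of_mem_siegel (i₀ := i₀) hR hε h (not_lt.1 fun hlt => h0 ?_) hx
          simpa [hlt.not_ge] using hpt i₀ R ε t x hR hε ht hRε ht'
    _ ≤ ENNReal.ofReal (Real.exp (-t * (R ^ 2 + R ^ 4 - 1))) *
          (ENNReal.ofReal (C₁ * (R / ε) ^ 2) * ENNReal.ofReal (C₂ * ε ^ (2 * n + 2))) := by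
        gcongr
        refine (lintegral_mono fun x => hpt i₀ R ε t x hR hε ht hRε ht').trans ?_
        rw [lintegral_const_mul' _ _ ENNReal.ofReal_ne_top]
        gcongr
        exact hvol i₀ R ε hε
    _ = _ := by
        rw [← ENNReal.ofReal_mul (by positivity), ← ENNReal.ofReal_mul (by positivity)]
        congr 1
        rw [pow_add]
        field_simp

theorem exists_pos_mul_le_one {a b : ℝ} (ha : 0 ≤ a) (hb : 0 ≤ b) :
    ∃ ε : ℝ, 0 < ε ∧ a * ε ≤ 1 ∧ b * ε ≤ 1 :=
  ⟨(1 + a + b)⁻¹, by positivity, mul_inv_le_one_of_le₀ (by linarith) (by positivity),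
    mul_inv_le_one_of_le₀ (by linarith) (by positivity)⟩

theorem not_basicEstimateOn_siegel (hq : 1 ≤ q) (hqn : q ≤ n) (ht : 0 ≤ t) :
    ¬ BasicEstimateOn {f : CSpace (n + 1) → Forms (n + 1) q | ContDiff ℝ ∞ f ∧ HasCompactSupport f}
      (siegel n) t := by
  rintro ⟨A, hA, hest⟩
  let i₀ : Fin n := ⟨0, hq.trans hqn⟩
  obtain ⟨K, hK, hcard⟩ : ∃ K : Finset (Fin (n + 1)), {i₀.castSucc} ⊆ K ∧ K.card = q + 1 :=
    Finset.exists_superset_card_eq (by simp) (by simpa using hqn)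
  let e : Forms (n + 1) (q + 1) := EuclideanSpace.single ⟨K, hcard⟩ 1
  obtain ⟨c, hc, hlower⟩ := exists_le_lintegral_tangForm_heisTest n q
  obtain ⟨C, hupper⟩ := exists_lintegral_energy_heisTest_le (q + 1) (q - 1) q e
  obtain ⟨R, hR⟩ := exists_gt (max 1 (A * C * Real.exp (3 * t) / c))
  have hR1 : 1 ≤ R := (le_max_left _ _).trans hR.le
  obtain ⟨ε, hε, h, ht'⟩ := exists_pos_mul_le_one (a := 100 * R ^ 3) (b := 9 * t * R ^ 2)
    (by positivity) (by positivity)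
  have hg := contDiff_heisTest i₀ R ε
  have hgc := hasCompactSupport_heisTest i₀ (zero_le_one.trans hR1) hε
  have hf : ContDiff ℝ ∞ (tangForm q e (heisTest i₀ R ε)) := contDiff_tangForm hg
  have hineq := (hlower ⟨K, hcard⟩ i₀ R ε t (hK (Finset.mem_singleton_self _)) hR1 hε ht h).trans
    ((hest _ ⟨hf, hasCompactSupport_tangForm hgc⟩ _ _
      (isDbar_dbarForm ht (hf.of_le (by exact_mod_cast le_top)) (hasCompactSupport_tangForm hgc))
      (isDbarStar_tangForm ht hg hgc)).trans
        (mul_le_mul_right (hupper i₀ R ε t hR1 hε ht h ht') _))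
  rw [← ENNReal.ofReal_mul hA.le] at hineq
  have hexp : Real.exp (-t * (R ^ 2 + R ^ 4 - 1)) =
      Real.exp (-t * (R ^ 2 + R ^ 4 + 2)) * Real.exp (3 * t) := by
    rw [← Real.exp_add]
    ring_nf
  refine absurd hineq (not_le.2 ((ENNReal.ofReal_lt_ofReal_iff (by positivity)).2 ?_))
  calc A * (C * Real.exp (-t * (R ^ 2 + R ^ 4 - 1)) * R ^ 2 * ε ^ (2 * n))
      = A * C * Real.exp (3 * t) *
          (Real.exp (-t * (R ^ 2 + R ^ 4 + 2)) * R ^ 2 * ε ^ (2 * n)) := by rw [hexp]; ring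
    _ < R * c * (Real.exp (-t * (R ^ 2 + R ^ 4 + 2)) * R ^ 2 * ε ^ (2 * n)) :=
        mul_lt_mul_of_pos_right ((div_lt_iff₀ hc).1 ((le_max_right _ _).trans_lt hR))
          (by positivity)
    _ = _ := by ring

theorem basicEstimateOn_mono {N : ℕ} {S T : Set (CSpace N → Forms N q)} {Ω : Set (CSpace N)}
    (hST : S ⊆ T) (h : BasicEstimateOn T Ω t) : BasicEstimateOn S Ω t := by
  obtain ⟨C, hC, h⟩ := h
  exact ⟨C, hC, fun f hf => h f (hST hf)⟩

theorem not_follandKohnBasicEstimate_siegel (hq : 1 ≤ q) (hqn : q ≤ n) (ht : 0 ≤ t) :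
    ¬ FollandKohnBasicEstimate q (siegel n) t := fun h =>
  not_basicEstimateOn_siegel hq hqn ht
    (basicEstimateOn_mono (fun _ hf => hf.1.continuous.continuousOn) h)

end FailureOfBasicEstimate

end

theorem mainTheorem4 (n : ℕ) (hn : 1 ≤ n) :
    -- a domain with a uniformly smooth (normalized) defining function
    (IsOpen (siegel n) ∧ IsConnected (siegel n) ∧
      ∃ U ρ, IsUniformlySmoothDefiningFunction (siegel n) U ρ ∧ IsNormalizedOn (siegel n) ρ) ∧
    StrictlyPseudoconvex (siegel n) ∧
    ¬ UniformlyStrictlyPseudoconvex (siegel n) ∧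
    -- the eigenvalues of the normalized Levi form
    (∀ U ρ, IsDefiningFunction 2 (siegel n) U ρ → IsNormalizedOn (siegel n) ρ →
      (∀ p ∈ frontier (siegel n),
        leviEigenvalues ρ p =
            {(1 + 4 * zNormSq p) ^ (-(3 / 2) : ℝ)} ∪
              {μ | 2 ≤ n ∧ μ = (1 + 4 * zNormSq p) ^ (-(1 / 2) : ℝ)} ∧
          IsLeast (leviEigenvalues ρ p) ((1 + 4 * zNormSq p) ^ (-(3 / 2) : ℝ))) ∧
      Tendsto (fun p : frontier (siegel n) => sInf (leviEigenvalues ρ p.1))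
        (comap (fun p : frontier (siegel n) => zNormSq p.1) atTop) (𝓝 0)) ∧
    -- failure of the basic estimate, even on smooth compactly supported forms
    (∀ q : ℕ, 1 ≤ q → q ≤ n → ∀ t : ℝ, 0 ≤ t →
      ¬ FollandKohnBasicEstimate q (siegel n) t ∧
      ¬ BasicEstimateOn
          {f : CSpace (n + 1) → Forms (n + 1) q | ContDiff ℝ ∞ f ∧ HasCompactSupport f}
          (siegel n) t) := by
  refine ⟨⟨isOpen_siegel, isConnected_siegel, _, _,
      isUniformlySmoothDefiningFunction_siegelNormalized, isNormalizedOn_siegelNormalized⟩,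
    strictlyPseudoconvex_siegel hn, not_uniformlyStrictlyPseudoconvex_siegel hn, ?_, ?_⟩
  · intro U ρ h hρ
    refine ⟨fun p hp => ?_, tendsto_sInf_leviEigenvalues_siegel hn h hρ⟩
    rw [← siegelScale_cube_eq_rpow, ← siegelScale_eq_rpow]
    exact ⟨leviEigenvalues_siegel hn h hρ hp, isLeast_leviEigenvalues_siegel hn h hρ hp⟩
  · intro q hq hqn t ht
    exact ⟨not_follandKohnBasicEstimate_siegel hq hqn ht, not_basicEstimateOn_siegel hq hqn ht⟩
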